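/- A probabilistic polynomial for a Boolean function $f:\{0,1\}^n\to\{0,1\}$ with error $\varepsilon$ is a random polynomial $\mathbf P\in\mathbb R[x_1,\dots,x_n]$ (on an arbitrary probability space) such that $\Pr_{\mathbf P}[\mathbf P(a)\ne f(a)]\le\varepsilon$ for every $a\in\{0,1\}^n$; it has degree at most $D$ if, almost surely, $\mathbf P$ has total degree at most $D$. Let $\mathrm{OR}_n$ be the OR function on $n$ bits, and let $\log$ denote the logarithm to base $2$. (1) For all sufficiently large $n$, every probabilistic polynomial for $\mathrm{OR}_n$ with error $1/8$ and degree at most $D$ satisfies $$D\ \ge\ \frac{\sqrt{\log n}}{(\log\log n)^2}.$$ (2) For every $\varepsilon<1/2$ there is a constant $c=c(\varepsilon)>0$ such that, for all sufficiently large $n$ (depending on $\varepsilon$), every probabilistic polynomial for $\mathrm{OR}_n$ with error $\varepsilon$ and degree at most $D$ satisfies $$D\ \ge\ c\cdot\frac{\sqrt{\log n}}{(\log\log n)^2}.$$ -/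

import Mathlib

open MeasureTheory

universe u v

/-- The real number `0` or `1` corresponding to a bit. -/
def bitVal (b : Bool) : ℝ := if b then 1 else 0

/-- The OR function on the Boolean variables indexed by `X`. -/
def orFn {X : Type u} [Fintype X] (a : X → Bool) : Bool := decide (∃ x, a x = true)

/-- The event that the random real polynomial `P` disagrees with the Boolean function `f` at the
Boolean point `a`. -/
def errorEvent {X : Type u} {Ω : Type v} (f : (X → Bool) → Bool)
    (P : Ω → MvPolynomial X ℝ) (a : X → Bool) : Set Ω :=
  {ω | MvPolynomial.eval (fun x => bitVal (a x)) (P ω) ≠ bitVal (f a)}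

/-- The random polynomial `P`, defined on a probability space `(Ω, μ)`, is an `ε`-error
probabilistic polynomial over the reals for `f`: at every Boolean point, the probability that `P`
disagrees with `f` is (well defined and) at most `ε`. -/
structure IsProbPoly {X : Type u} {Ω : Type v} [MeasurableSpace Ω] (μ : Measure Ω) (ε : ℝ)
    (f : (X → Bool) → Bool) (P : Ω → MvPolynomial X ℝ) : Prop where
  measurableSet_errorEvent : ∀ a, MeasurableSet (errorEvent f P a)
  error_le : ∀ a, μ.real (errorEvent f P a) ≤ ε

/-- The random polynomial `P` is supported on polynomials of (total) degree at most `D`. -/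
def HasDegreeLE {X : Type u} {Ω : Type v} [MeasurableSpace Ω] (μ : Measure Ω)
    (P : Ω → MvPolynomial X ℝ) (D : ℕ) : Prop :=
  ∀ᵐ ω ∂μ, (P ω).totalDegree ≤ D

/-- The quantity `√(log n) / (log log n) ^ 2`, with logarithms to base `2`. -/
noncomputable def orBound (n : ℕ) : ℝ :=
  Real.sqrt (Real.logb 2 n) / (Real.logb 2 (Real.logb 2 n)) ^ 2

/-! The engine is an anticoncentration bound losing only a polynomial factor in the degree `d`: a
multilinear polynomial that stays nonzero under all restrictions of up to `robustDepth d` variables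
is nonzero at a random sign vector with probability at least `1 / (2 ^ 20 * d ^ 2)`
(`nzProb_ge_of_robust`). Mere nonvanishing would give only `2 ^ (-d)`.

If all influences are small (`cubeAvg_ne_zero_ge_of_regular`), Lindeberg replacement allows random
signs to be exchanged for variables `√2 cos θ`. For these, `sqNorm_rpow_le_integral_cosVar` bounds
the `L^{1/d}` norm from below: all angles are rotated by a common unimodular number, which is then
moved off the circle. Subharmonicity compares the two situations, and off the circle a two-point
hypercontractive inequality tensorizes. The exponent `1/d` turns a loss `w ^ d` into `w`, of order
`1/d`. In general, a decision tree querying influential variables reaches a regular leaf with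
probability at least `1 / (2 * 9 ^ d)`; robustness permits restarting it `2 * 9 ^ d` times.

A hard measure for OR follows by recursion on the degree (`exists_hard_weights`). Away from the
origin, a polynomial `c` errs exactly where `c - 1` is nonzero. If `c - 1` is robust, the uniform
measure detects many errors. If not, its top-degree monomials contain no large disjoint family, so
few variables meet all of them, and on most of `K` disjoint blocks the degree drops. The resulting
weights have total mass at most `d + 2`, while every polynomial of degree `d` errs on mass of order
`1 / d ^ 2`. This needs `K ^ d` variables with `K = (2 ^ 10 * d) ^ (18 * d)`, that is, `d ^ 2 log d`
at most a small multiple of `log n`.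

Finally, the majority of `t = C ⌈log log n⌉` independent copies of a probabilistic polynomial of
degree `D` has degree at most `d = t D` and error at most `(log n) ^ (-4)`. Averaging against the
hard weights contradicts `d ≤ √(log n)`. If `D` were below the claimed bound, `d` would be of order
`√(log n) / log log n`; the room left over absorbs `C`. -/

set_option linter.unusedSectionVars false

/-! ### Averages over the unit circle -/

theorem integral_unitAddCircle_eq_circleAverage {E : Type*} [NormedAddCommGroup E]
    [NormedSpace ℝ E] (F : ℂ → E) :
    ∫ t : UnitAddCircle, F (AddCircle.toCircle t : ℂ) = Real.circleAverage F 0 1 := by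
  rw [← UnitAddCircle.intervalIntegral_preimage 0, Real.circleAverage_def, zero_add]
  have h : ∀ t : ℝ, F (AddCircle.toCircle (t : UnitAddCircle) : ℂ)
      = (fun θ => F (circleMap 0 1 θ)) ((2 * Real.pi) * t) := by
    intro t
    congr 1
    rw [AddCircle.toCircle_apply_mk, Circle.coe_exp, circleMap]
    simp
  simp_rw [h]
  rw [intervalIntegral.integral_comp_mul_left (fun θ => F (circleMap 0 1 θ))
    (by positivity : (2 * Real.pi) ≠ 0)]
  simp

theorem Continuous.circleIntegrable_zero_one {E : Type*} [NormedAddCommGroup E] {f : ℂ → E}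
    (hf : Continuous f) : CircleIntegrable f 0 1 :=
  hf.continuousOn.circleIntegrable zero_le_one

/-- Bessel's inequality for the first two Taylor coefficients `a`, `b`: the average of `‖f u - (a +
b u)‖ ^ 2` is nonnegative. -/
theorem DiffContOnCl.sq_norm_add_sq_norm_deriv_le_circleAverage {f : ℂ → ℂ}
    (hf : DifferentiableOn ℂ f (Metric.closedBall 0 1)) :
    ‖f 0‖ ^ 2 + ‖deriv f 0‖ ^ 2 ≤ Real.circleAverage (fun u => ‖f u‖ ^ 2) 0 1 := by
  have hcl : DiffContOnCl ℂ f (Metric.ball 0 1) :=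
    (hf.mono (Metric.closure_ball_subset_closedBall)).diffContOnCl
  have hc : ContinuousOn f (Metric.sphere 0 1) :=
    hf.continuousOn.mono Metric.sphere_subset_closedBall
  have h0 : Real.circleAverage f 0 1 = f 0 := by
    have := DiffContOnCl.circleAverage (c := 0) (R := 1) (f := f) (by simpa using hcl)
    simpa using this
  have h1 : Real.circleAverage (fun u => u⁻¹ * f u) 0 1 = deriv f 0 := by
    rw [Real.circleAverage_eq_circleIntegral one_ne_zero]
    have hd := hcl.deriv_eq_smul_circleIntegral one_pos
    have he : (∮ z in C(0, 1), (z - 0)⁻¹ • (z⁻¹ * f z)) = ∮ z in C(0, 1), (1 / (z - 0) ^ 2) • f z := by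
      congr 1
      ext z
      simp [pow_two, mul_assoc]
    rw [he, hd, inv_smul_smul₀ Complex.two_pi_I_ne_zero]
  set a := f 0
  set b := deriv f 0
  have hint0 : CircleIntegrable f 0 1 := hc.circleIntegrable zero_le_one
  have hinv : ContinuousOn (fun u : ℂ => u⁻¹) (Metric.sphere (0 : ℂ) 1) := by
    apply continuousOn_inv₀.mono
    intro x hx
    simp only [mem_sphere_iff_norm, sub_zero] at hx
    simp only [Set.mem_compl_iff, Set.mem_singleton_iff]
    rintro rfl; simp at hx
  have hint1 : CircleIntegrable (fun u => u⁻¹ * f u) 0 1 :=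
    (hinv.mul hc).circleIntegrable zero_le_one
  -- On the circle `u⁻¹` is the conjugate of `u`, so `L u` is `f u` times the conjugate of `a + b
  -- u`, the cross term of the square.
  set L : ℂ → ℂ := fun u => (starRingEnd ℂ) a * f u + (starRingEnd ℂ) b * (u⁻¹ * f u)
  have hL : Real.circleAverage (fun u => 2 * (L u).re - (‖a‖ ^ 2 + 2 *
      ((starRingEnd ℂ) a * b * u).re + ‖b‖ ^ 2)) 0 1 = ‖a‖ ^ 2 + ‖b‖ ^ 2 := by
    have hLint : CircleIntegrable L 0 1 := by
      apply ContinuousOn.circleIntegrable zero_le_one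
      exact (continuousOn_const.mul hc).add (continuousOn_const.mul (hinv.mul hc))
    have hLavg : Real.circleAverage L 0 1 = (‖a‖ ^ 2 + ‖b‖ ^ 2 : ℝ) := by
      have : L = (starRingEnd ℂ a • f) + (starRingEnd ℂ b • fun u => u⁻¹ * f u) := by
        ext u; simp [L]
      rw [this, Real.circleAverage_add (hint0.const_smul) (hint1.const_smul),
        Real.circleAverage_smul, Real.circleAverage_smul, h0, h1]
      simp only [smul_eq_mul]
      rw [mul_comm, Complex.mul_conj, mul_comm, Complex.mul_conj]
      simp [Complex.normSq_eq_norm_sq]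
    have hM : Real.circleAverage (fun u : ℂ => (starRingEnd ℂ) a * b * u) 0 1 = 0 := by
      have := DiffContOnCl.circleAverage (c := 0) (R := 1)
        (f := fun u : ℂ => (starRingEnd ℂ) a * b * u)
        (by apply Differentiable.diffContOnCl; fun_prop)
      simpa using this
    have e1 : Real.circleAverage (fun u => (L u).re) 0 1 = ‖a‖ ^ 2 + ‖b‖ ^ 2 := by
      have := Complex.reCLM.circleAverage_comp_comm hLint
      rw [hLavg] at this
      simpa only [Function.comp_def, Complex.reCLM_apply, Complex.ofReal_re] using this
    have hMint : CircleIntegrable (fun u : ℂ => (starRingEnd ℂ) a * b * u) 0 1 :=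
      Continuous.circleIntegrable_zero_one (by fun_prop)
    have e2 : Real.circleAverage (fun u => ((starRingEnd ℂ) a * b * u).re) 0 1 = 0 := by
      have := Complex.reCLM.circleAverage_comp_comm hMint
      rw [hM] at this
      simpa [Function.comp_def] using this
    have hLre : CircleIntegrable (fun u => (L u).re) 0 1 := by
      apply ContinuousOn.circleIntegrable zero_le_one
      exact Complex.continuous_re.comp_continuousOn
        ((continuousOn_const.mul hc).add (continuousOn_const.mul (hinv.mul hc)))
    have hMre : CircleIntegrable (fun u => ((starRingEnd ℂ) a * b * u).re) 0 1 :=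
      Continuous.circleIntegrable_zero_one (by fun_prop)
    have e3 : (fun u => 2 * (L u).re - (‖a‖ ^ 2 + 2 *
      ((starRingEnd ℂ) a * b * u).re + ‖b‖ ^ 2)) = ((2 : ℝ) • fun u => (L u).re) -
        (((fun _ => ‖a‖ ^ 2 + ‖b‖ ^ 2) : ℂ → ℝ) +
          (2 : ℝ) • fun u => ((starRingEnd ℂ) a * b * u).re) := by
      ext u; simp; ring
    have hcst : CircleIntegrable ((fun _ => ‖a‖ ^ 2 + ‖b‖ ^ 2) : ℂ → ℝ) 0 1 :=
      Continuous.circleIntegrable_zero_one continuous_const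
    rw [e3, Real.circleAverage_sub hLre.const_smul (hcst.add hMre.const_smul),
      Real.circleAverage_add hcst hMre.const_smul, Real.circleAverage_smul,
      Real.circleAverage_smul, e1, e2, Real.circleAverage_const]
    simp; ring
  rw [← hL]
  apply Real.circleAverage_mono
  · apply ContinuousOn.circleIntegrable zero_le_one
    apply ContinuousOn.sub
    · apply ContinuousOn.mul continuousOn_const
      exact Complex.continuous_re.comp_continuousOn
        ((continuousOn_const.mul hc).add (continuousOn_const.mul (hinv.mul hc)))
    · fun_prop
  · exact (hc.norm.pow 2).circleIntegrable zero_le_one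
  · intro u hu
    have hu1 : ‖u‖ = 1 := by simpa using hu
    have hn : Complex.normSq u = 1 := by rw [Complex.normSq_eq_norm_sq, hu1]; norm_num
    have huinv : u⁻¹ = (starRingEnd ℂ) u := by
      rw [Complex.inv_def, hn]; simp
    have key : 0 ≤ Complex.normSq (f u - (a + b * u)) := Complex.normSq_nonneg _
    have h2 : Complex.normSq (f u - (a + b * u)) = ‖f u‖ ^ 2 - (2 * (L u).re - (‖a‖ ^ 2 + 2 *
      ((starRingEnd ℂ) a * b * u).re + ‖b‖ ^ 2)) := by
      simp only [L, huinv, ← Complex.normSq_eq_norm_sq]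
      rw [Complex.normSq_apply] at hn
      simp [Complex.normSq_apply]
      linear_combination (b.re ^ 2 + b.im ^ 2) * hn
    linarith

theorem Continuous.circleAverage_parametric {f : ℝ → ℂ → ℝ}
    (hf : Continuous (Function.uncurry f)) :
    Continuous fun r => Real.circleAverage (f r) 0 1 := by
  simp only [Real.circleAverage_def]
  simp only [smul_eq_mul]
  refine Continuous.mul continuous_const ?_
  apply intervalIntegral.continuous_parametric_intervalIntegral_of_continuous' (μ := volume)
  exact hf.comp (continuous_fst.prodMk ((continuous_circleMap 0 1).comp continuous_snd))

/-- Strict bounds keep both factors in the right half-plane, so their `q`-th powers are holomorphic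
on the closed disc. The product has value `1` and derivative `q (α + β)` at `0`. -/
theorem one_add_sq_norm_add_le_circleAverage_of_lt {q : ℝ} (α β : ℂ) (hα : ‖α‖ < 1)
    (hβ : ‖β‖ < 1) :
    1 + q ^ 2 * ‖α + β‖ ^ 2 ≤
      Real.circleAverage (fun u => ‖(1 + α * u) * (1 + β * u)‖ ^ (2 * q)) 0 1 := by
  have hs : ∀ γ : ℂ, ‖γ‖ < 1 → ∀ u ∈ Metric.closedBall (0 : ℂ) 1, 1 + γ * u ∈ Complex.slitPlane := by
    intro γ hγ u hu
    left
    have hu : ‖u‖ ≤ 1 := by simpa using hu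
    have h1 : ‖γ * u‖ < 1 := by
      rw [norm_mul]
      calc _ ≤ ‖γ‖ * 1 := by gcongr
        _ < 1 := by simpa using hγ
    have := (abs_lt.1 ((Complex.abs_re_le_norm _).trans_lt h1)).1
    simp only [Complex.add_re, Complex.one_re]
    linarith
  set f : ℂ → ℂ := fun u => (1 + α * u) ^ (q : ℂ) * (1 + β * u) ^ (q : ℂ)
  have hd : ∀ γ : ℂ, ‖γ‖ < 1 → ∀ u ∈ Metric.closedBall (0 : ℂ) 1,
      HasDerivAt (fun u => (1 + γ * u) ^ (q : ℂ)) (q * (1 + γ * u) ^ ((q : ℂ) - 1) * γ) u := by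
    intro γ hγ u hu
    have h1 : HasDerivAt (fun u : ℂ => 1 + γ * u) γ u := by
      simpa using ((hasDerivAt_id u).const_mul γ).const_add 1
    exact h1.cpow_const (hs γ hγ u hu)
  have hf : DifferentiableOn ℂ f (Metric.closedBall 0 1) := fun u hu =>
    (((hd α hα u hu).mul (hd β hβ u hu)).differentiableAt).differentiableWithinAt
  have h := DiffContOnCl.sq_norm_add_sq_norm_deriv_le_circleAverage hf
  have hf' : deriv f 0 = q * (α + β) := by
    refine ((hd α hα 0 (by simp)).mul (hd β hβ 0 (by simp))).deriv.trans ?_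
    simp; ring
  have hf0 : f 0 = 1 := by simp [f]
  rw [hf', hf0] at h
  have e : (fun u => ‖f u‖ ^ 2) = fun u => ‖(1 + α * u) * (1 + β * u)‖ ^ (2 * q) := by
    ext u
    simp only [f, norm_mul, Complex.norm_cpow_real]
    rw [← Real.mul_rpow (norm_nonneg _) (norm_nonneg _), mul_comm 2 q, Real.rpow_mul (by positivity)]
    norm_cast
  rw [e] at h
  simpa [mul_pow] using h

/-- The two-root case of Weissler's inequality. -/
theorem one_add_sq_norm_add_le_circleAverage {q : ℝ} (hq : 0 < q) (α β : ℂ) (hα : ‖α‖ ≤ 1)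
    (hβ : ‖β‖ ≤ 1) :
    1 + q ^ 2 * ‖α + β‖ ^ 2 ≤
      Real.circleAverage (fun u => ‖(1 + α * u) * (1 + β * u)‖ ^ (2 * q)) 0 1 := by
  have hc : Continuous fun r : ℝ => Real.circleAverage
      (fun u => ‖(1 + (r * α) * u) * (1 + (r * β) * u)‖ ^ (2 * q)) 0 1 := by
    apply Continuous.circleAverage_parametric
    simp only [Function.uncurry_def]
    exact Continuous.rpow_const (by fun_prop) (fun _ => Or.inr (by positivity))
  have hc' : Continuous fun r : ℝ => 1 + q ^ 2 * ‖r * α + r * β‖ ^ 2 := by fun_prop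
  -- The boundary case is the limit of the strict one as `α`, `β` are scaled by `r → 1⁻`.
  have h := le_of_tendsto_of_tendsto (f := fun r : ℝ => 1 + q ^ 2 * ‖r * α + r * β‖ ^ 2)
    (b := nhdsWithin 1 (Set.Iio (1 : ℝ))) (hc'.continuousWithinAt (x := (1 : ℝ)).tendsto)
    (hc.continuousWithinAt (x := (1 : ℝ)).tendsto) ?_
  · simpa using h
  · filter_upwards [Ioo_mem_nhdsLT (show (0 : ℝ) < 1 by norm_num)] with r hr
    apply one_add_sq_norm_add_le_circleAverage_of_lt
    · rw [norm_mul, Complex.norm_real, Real.norm_of_nonneg hr.1.le]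
      nlinarith [norm_nonneg α, hr.1, hr.2]
    · rw [norm_mul, Complex.norm_real, Real.norm_of_nonneg hr.1.le]
      nlinarith [norm_nonneg β, hr.1, hr.2]

/-- Subharmonicity of `‖S‖ ^ p` at the centre, valid for every `p > 0`: the Mahler measure `M` is
the geometric mean of `‖S‖` on the circle and dominates `‖S.eval 0‖`. -/
theorem norm_eval_zero_rpow_le_circleAverage {p : ℝ} (hp : 0 < p) (S : Polynomial ℂ) :
    ‖S.eval 0‖ ^ p ≤ Real.circleAverage (fun u => ‖S.eval u‖ ^ p) 0 1 := by
  by_cases hS : S = 0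
  · simp [hS, Real.zero_rpow hp.ne', Real.circleAverage_const]
  have hM := S.norm_coeff_le_choose_mul_mahlerMeasure 0
  simp only [Nat.choose_zero_right, Nat.cast_one, one_mul] at hM
  rw [Polynomial.coeff_zero_eq_eval_zero] at hM
  have hMpos : 0 < S.mahlerMeasure := Polynomial.mahlerMeasure_pos_of_ne_zero hS
  set M := S.mahlerMeasure with hMdef
  refine (Real.rpow_le_rpow (norm_nonneg _) hM hp.le).trans ?_
  have hlog : (2 * Real.pi)⁻¹ * ∫ x in (0 : ℝ)..(2 * Real.pi),
      Real.log ‖S.eval (circleMap 0 1 x)‖ = Real.log M := by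
    rw [hMdef, Polynomial.mahlerMeasure_def_of_ne_zero hS, Real.log_exp]
  have hint := S.intervalIntegrable_mahlerMeasure
  rw [Real.circleAverage_def, smul_eq_mul]
  have hpi : 0 < 2 * Real.pi := by positivity
  have hlow : ∫ x in (0 : ℝ)..(2 * Real.pi),
      (M ^ p * (1 - p * Real.log M) + M ^ p * p * Real.log ‖S.eval (circleMap 0 1 x)‖)
      = 2 * Real.pi * M ^ p := by
    rw [intervalIntegral.integral_add (by simp) (hint.const_mul _),
      intervalIntegral.integral_const_mul (M ^ p * p), intervalIntegral.integral_const]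
    have : ∫ x in (0 : ℝ)..(2 * Real.pi), Real.log ‖S.eval (circleMap 0 1 x)‖
        = 2 * Real.pi * Real.log M := by rw [← hlog]; field_simp
    rw [this]; simp; ring
  have hmono : ∫ x in (0 : ℝ)..(2 * Real.pi),
      (M ^ p * (1 - p * Real.log M) + M ^ p * p * Real.log ‖S.eval (circleMap 0 1 x)‖)
      ≤ ∫ x in (0 : ℝ)..(2 * Real.pi), ‖S.eval (circleMap 0 1 x)‖ ^ p := by
    apply intervalIntegral.integral_mono_ae hpi.le
    · exact IntervalIntegrable.add (by simp) (hint.const_mul _)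
    · apply Continuous.intervalIntegrable
      exact Continuous.rpow_const (by fun_prop) (fun _ => Or.inr hp.le)
    · have hcount : (S.rootSet ℂ).Countable := (S.rootSet_finite ℂ).countable
      have hz := (hcount.preimage_circleMap 0 (one_ne_zero' ℝ)).measure_zero volume
      have hae := measure_eq_zero_iff_ae_notMem.1 hz
      filter_upwards [hae] with x hx
      have hne : S.eval (circleMap 0 1 x) ≠ 0 := by
        intro h0
        apply hx
        simp [Polynomial.mem_rootSet, hS, h0]
      have hy : 0 < ‖S.eval (circleMap 0 1 x)‖ := norm_pos_iff.2 hne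
      set y := ‖S.eval (circleMap 0 1 x)‖
      -- Jensen by the tangent line `1 + x ≤ exp x`, where `x = p (log y - log M)` has mean zero.
      have : y ^ p = M ^ p * Real.exp (p * (Real.log y - Real.log M)) := by
        rw [Real.rpow_def_of_pos hy, Real.rpow_def_of_pos hMpos, ← Real.exp_add]; ring_nf
      rw [this]
      have h1 := Real.add_one_le_exp (p * (Real.log y - Real.log M))
      have h2 : 0 < M ^ p := Real.rpow_pos_of_pos hMpos _
      nlinarith
  rw [hlow] at hmono
  rw [inv_mul_eq_div, le_div_iff₀ hpi]
  linarith

/-- Reflecting a root in the unit circle brings a factor `u - s` to the shape `1 + α u` of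
Weissler's inequality. -/
theorem norm_sub_eq_norm_one_sub_conj_mul {u s : ℂ} (hu : ‖u‖ = 1) :
    ‖u - s‖ = ‖1 + (-(starRingEnd ℂ) s) * u‖ := by
  have h : 1 + (-(starRingEnd ℂ) s) * u = u * (starRingEnd ℂ) (u - s) := by
    have : u * (starRingEnd ℂ) u = 1 := by
      rw [Complex.mul_conj, Complex.normSq_eq_norm_sq, hu]; simp
    rw [map_sub, mul_sub, this]; ring
  rw [h, norm_mul, hu, one_mul, Complex.norm_conj]

theorem circleAverage_const_mul_rpow {q B : ℝ} (hB : 0 ≤ B) {f g : ℂ → ℂ}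
    (h : ∀ u, ‖u‖ = 1 → ‖f u‖ = B * ‖g u‖) :
    Real.circleAverage (fun u => ‖f u‖ ^ (2 * q)) 0 1 =
      (B ^ 2) ^ q * Real.circleAverage (fun u => ‖g u‖ ^ (2 * q)) 0 1 := by
  rw [← smul_eq_mul (a := (B ^ 2) ^ q), ← Real.circleAverage_fun_smul]
  apply Real.circleAverage_congr_sphere
  intro u hu
  have hu : ‖u‖ = 1 := by simpa using hu
  simp only [h u hu, smul_eq_mul]
  rw [Real.mul_rpow hB (norm_nonneg _), Real.rpow_mul hB]
  norm_cast

/-- A two-point hypercontractive inequality on the circle, for a slightly non-analytic perturbation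
of the variable `u`. -/
theorem rpow_le_circleAverage_perturbed {q w : ℝ} (hq : 0 < q) (hq' : q ≤ 1 / 2) (hw : 0 < w)
    (hwq : w ^ 2 ≤ q / 16) (a b : ℂ) :
    (‖a‖ ^ 2 + q / 2 * ‖b‖ ^ 2) ^ q ≤
      Real.circleAverage (fun u => ‖a + b * (u + w ^ 2 * (starRingEnd ℂ) u)‖ ^ (2 * q)) 0 1 := by
  by_cases hb : b = 0
  · subst hb
    simp only [zero_mul, add_zero, norm_zero, ne_eq, OfNat.ofNat_ne_zero, not_false_eq_true,
      zero_pow, mul_zero]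
    rw [Real.circleAverage_const, Real.rpow_mul (norm_nonneg _)]
    norm_cast
  have hw1 : w < 1 := by nlinarith
  have hwc : (w : ℂ) ≠ 0 := by exact_mod_cast hw.ne'
  -- On the circle, multiplying by `u` turns the expression into `b (u - r) (u - s)` with `r s = w ^
  -- 2`. Taking `r` as the larger root gives `‖s‖ ≤ w ≤ ‖r‖`, so only `r` can lie outside the disc.
  obtain ⟨r, hr0, hrw, hr⟩ : ∃ r : ℂ, r ≠ 0 ∧ w ≤ ‖r‖ ∧ r + w ^ 2 / r = - (a / b) := by
    obtain ⟨r, hr⟩ : ∃ r : ℂ, 1 * (r * r) + (a / b) * r + (w : ℂ) ^ 2 = 0 :=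
      exists_quadratic_eq_zero one_ne_zero (by
        obtain ⟨z, hz⟩ := IsAlgClosed.exists_pow_nat_eq (discrim 1 (a / b) ((w : ℂ) ^ 2)) two_pos
        exact ⟨z, by rw [← hz, pow_two]⟩)
    have hr0 : r ≠ 0 := by
      rintro rfl
      simp [hwc] at hr
    have hr' : r + w ^ 2 / r = -(a / b) := by
      field_simp
      field_simp at hr
      linear_combination hr
    by_cases h : w ≤ ‖r‖
    · exact ⟨r, hr0, h, hr'⟩
    · refine ⟨w ^ 2 / r, by simp [hr0, hwc], ?_, ?_⟩
      · rw [norm_div, norm_pow, Complex.norm_real, Real.norm_of_nonneg hw.le,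
          le_div_iff₀ (norm_pos_iff.2 hr0)]
        nlinarith
      · rw [← hr']; field_simp; ring
  set R := ‖r‖ with hR
  set B := ‖b‖ with hBdef
  have hRpos : 0 < R := norm_pos_iff.2 hr0
  have hB : 0 < B := norm_pos_iff.2 hb
  set s : ℂ := w ^ 2 / r with hs
  have hsn : ‖s‖ = w ^ 2 / R := by
    rw [hs, norm_div, norm_pow, Complex.norm_real, Real.norm_of_nonneg hw.le]
  have hab : a = - (b * (r + s)) := by rw [hr]; field_simp
  have hval : ∀ u : ℂ, ‖u‖ = 1 → ‖a + b * (u + w ^ 2 * (starRingEnd ℂ) u)‖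
      = B * (‖u - r‖ * ‖u - s‖) := by
    intro u hu
    have hu1 : u * (starRingEnd ℂ) u = 1 := by
      rw [Complex.mul_conj, Complex.normSq_eq_norm_sq, hu]; simp
    have hrs : r * s = w ^ 2 := by rw [hs]; field_simp
    rw [← norm_mul, ← norm_mul, ← one_mul ‖a + _‖, ← hu, ← norm_mul]
    congr 1
    rw [hab]
    linear_combination (b * w ^ 2) * hu1 - b * hrs
  have hs1 : ‖s‖ ≤ 1 := by
    rw [hsn, div_le_one hRpos]
    nlinarith
  -- A root outside the disc is factored out and inverted; a root inside is reflected. In both cases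
  -- Bernoulli's inequality for exponent `q ≤ 1` reduces the claim to a comparison with the term `q
  -- ^ 2 ‖α + β‖ ^ 2`, and `w ^ 2 ≤ q / 16` makes the errors from `w` small enough.
  by_cases hR1 : 1 ≤ R
  · have hval2 : ∀ u : ℂ, ‖u‖ = 1 → ‖a + b * (u + w ^ 2 * (starRingEnd ℂ) u)‖
        = (B * R) * ‖(1 + (-(starRingEnd ℂ) s) * u) * (1 + (-r⁻¹) * u)‖ := by
      intro u hu
      have : u - r = -r * (1 + (-r⁻¹) * u) := by field_simp; ring
      rw [hval u hu, norm_sub_eq_norm_one_sub_conj_mul (s := s) hu, this, norm_mul, norm_mul,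
        norm_neg]
      ring
    rw [circleAverage_const_mul_rpow (by positivity) hval2]
    have hZ := one_add_sq_norm_add_le_circleAverage hq (-(starRingEnd ℂ) s) (-r⁻¹)
      (by simpa using hs1) (by rw [norm_neg, norm_inv]; exact inv_le_one_of_one_le₀ hR1)
    refine le_trans ?_ (mul_le_mul_of_nonneg_left hZ (by positivity))
    have hlow : (1 - w ^ 2) / R ≤ ‖-(starRingEnd ℂ) s + -r⁻¹‖ := by
      have h1 : ‖r⁻¹‖ ≤ ‖-(starRingEnd ℂ) s + -r⁻¹‖ + ‖s‖ := by
        have := norm_sub_le (-(starRingEnd ℂ) s + -r⁻¹) (-(starRingEnd ℂ) s)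
        simpa using this
      rw [hsn, norm_inv] at h1
      rw [sub_div, one_div]
      linarith
    have hsq : ((1 - w ^ 2) / R) ^ 2 ≤ ‖-(starRingEnd ℂ) s + -r⁻¹‖ ^ 2 := by
      apply pow_le_pow_left₀ _ hlow
      apply div_nonneg _ hRpos.le
      nlinarith
    have han : ‖a‖ ≤ B * (R + w ^ 2 / R) := by
      rw [hab, norm_neg, norm_mul]
      gcongr
      exact (norm_add_le _ _).trans (by rw [hsn])
    have hx : ‖a‖ ^ 2 + q / 2 * B ^ 2 ≤
        (B * R) ^ 2 * (1 + (2 * w ^ 2 + w ^ 4 / R ^ 2 + q / 2) / R ^ 2) := by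
      have : (B * R) ^ 2 * (1 + (2 * w ^ 2 + w ^ 4 / R ^ 2 + q / 2) / R ^ 2)
          = (B * (R + w ^ 2 / R)) ^ 2 + q / 2 * B ^ 2 := by field_simp; ring
      rw [this]
      gcongr
    refine (Real.rpow_le_rpow (by positivity) hx hq.le).trans ?_
    rw [Real.mul_rpow (by positivity) (by positivity)]
    gcongr
    refine (rpow_one_add_le_one_add_mul_self ?_ hq.le (by linarith)).trans ?_
    · have : 0 ≤ (2 * w ^ 2 + w ^ 4 / R ^ 2 + q / 2) / R ^ 2 := by positivity
      linarith
    have h4 : w ^ 4 / R ^ 2 ≤ w ^ 2 := by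
      rw [div_le_iff₀ (by positivity)]
      have : w ^ 2 ≤ R ^ 2 := by nlinarith
      nlinarith [sq_nonneg w]
    have h5 : (2 * w ^ 2 + w ^ 4 / R ^ 2 + q / 2) ≤ q * (1 - w ^ 2) ^ 2 := by
      have h7 : 15 / 16 ≤ (1 - w ^ 2) ^ 2 := by nlinarith
      linarith [mul_le_mul_of_nonneg_left h7 hq.le]
    have h6 : q * ((2 * w ^ 2 + w ^ 4 / R ^ 2 + q / 2) / R ^ 2) ≤ q ^ 2 * ((1 - w ^ 2) / R) ^ 2 := by
      rw [div_pow]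
      calc _ ≤ q * ((q * (1 - w ^ 2) ^ 2) / R ^ 2) := by gcongr
        _ = _ := by ring
    nlinarith [sq_nonneg q]
  · push Not at hR1
    have hval2 : ∀ u : ℂ, ‖u‖ = 1 → ‖a + b * (u + w ^ 2 * (starRingEnd ℂ) u)‖
        = B * ‖(1 + (-(starRingEnd ℂ) r) * u) * (1 + (-(starRingEnd ℂ) s) * u)‖ := by
      intro u hu
      rw [hval u hu, norm_sub_eq_norm_one_sub_conj_mul (s := s) hu,
        norm_sub_eq_norm_one_sub_conj_mul (s := r) hu, norm_mul]
    rw [circleAverage_const_mul_rpow (by positivity) hval2]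
    have hZ := one_add_sq_norm_add_le_circleAverage hq (-(starRingEnd ℂ) r) (-(starRingEnd ℂ) s)
      (by simpa using hR1.le) (by simpa using hs1)
    refine le_trans ?_ (mul_le_mul_of_nonneg_left hZ (by positivity))
    have hm : ‖-(starRingEnd ℂ) r + -(starRingEnd ℂ) s‖ = ‖r + s‖ := by
      rw [← neg_add, norm_neg, ← map_add, Complex.norm_conj]
    rw [hm]
    have han : ‖a‖ = B * ‖r + s‖ := by rw [hab, norm_neg, norm_mul]
    have hm1 : ‖r + s‖ ≤ 1 + w ^ 2 := by
      refine (norm_add_le _ _).trans ?_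
      rw [hsn, ← hR]
      have : w ^ 2 / R ≤ 1 + w ^ 2 - R := by
        rw [div_le_iff₀ hRpos]
        have h1 : w ^ 2 ≤ R := by nlinarith
        nlinarith [mul_nonneg (sub_nonneg.2 hR1.le) (sub_nonneg.2 h1)]
      linarith
    set m := ‖r + s‖
    have hm0 : 0 ≤ m := norm_nonneg _
    have : ‖a‖ ^ 2 + q / 2 * B ^ 2 = B ^ 2 * (1 + (m ^ 2 + q / 2 - 1)) := by rw [han]; ring
    rw [this, Real.mul_rpow (by positivity) (by nlinarith)]
    gcongr
    refine (rpow_one_add_le_one_add_mul_self ?_ hq.le (by linarith)).trans ?_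
    · nlinarith
    · have h1 : m ^ 2 ≤ (1 + w ^ 2) ^ 2 := pow_le_pow_left₀ hm0 hm1 2
      have h2 : m ^ 2 ≤ 1 + 3 * q / 16 := by nlinarith [sq_nonneg w]
      have h3 : m ^ 2 * (1 - q) ≤ (1 + 3 * q / 16) * (1 - q) :=
        mul_le_mul_of_nonneg_right h2 (by linarith)
      have h4 : m ^ 2 * (1 - q) ≤ 1 - q / 2 := by linarith [mul_pos hq hq]
      linarith [mul_le_mul_of_nonneg_left h4 hq.le]

/-! ### Multilinear polynomials given by their coefficients -/

section Multilinear
variable {V : Type*} [DecidableEq V]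

/-- The coefficients of the part of a multilinear polynomial not involving the variable `v`. -/
def coefOff (v : V) (c : Finset V → ℝ) (T : Finset V) : ℝ := if v ∈ T then 0 else c T

/-- The coefficients of the derivative of a multilinear polynomial in the variable `v`. -/
def coefOn (v : V) (c : Finset V → ℝ) (T : Finset V) : ℝ := if v ∈ T then 0 else c (insert v T)

/-- The multilinear polynomial with coefficients `c` has degree at most `d`. -/
def DegLE (c : Finset V → ℝ) (d : ℕ) : Prop := ∀ T : Finset V, d < T.card → c T = 0

theorem DegLE.off {c : Finset V → ℝ} {d : ℕ} (h : DegLE c d) (v : V) :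
    DegLE (coefOff v c) d := by
  intro T hT
  simp [coefOff, h T hT]

theorem DegLE.on {c : Finset V → ℝ} {d : ℕ} (h : DegLE c (d + 1)) (v : V) :
    DegLE (coefOn v c) d := by
  intro T hT
  by_cases hv : v ∈ T
  · simp [coefOn, hv]
  · simp only [coefOn, hv, if_false]
    apply h
    rw [Finset.card_insert_of_notMem hv]
    omega

theorem DegLE.on_eq_zero {c : Finset V → ℝ} (h : DegLE c 0) (v : V) : coefOn v c = 0 := by
  ext T
  by_cases hv : v ∈ T
  · simp [coefOn, hv]
  · simp only [coefOn, hv, if_false, Pi.zero_apply]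
    apply h
    rw [Finset.card_insert_of_notMem hv]
    omega

theorem DegLE.mono {c : Finset V → ℝ} {d e : ℕ} (h : DegLE c d) (hde : d ≤ e) : DegLE c e :=
  fun T hT => h T (by omega)

theorem coefOff_supported {c : Finset V → ℝ} {v : V} {s : Finset V}
    (h : ∀ T, c T ≠ 0 → T ⊆ insert v s) : ∀ T, coefOff v c T ≠ 0 → T ⊆ s := by
  intro T hT
  by_cases hv : v ∈ T
  · simp [coefOff, hv] at hT
  · simp only [coefOff, hv, if_false] at hT
    exact (Finset.subset_insert_iff_of_notMem hv).1 (h T hT)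

theorem coefOn_supported {c : Finset V → ℝ} {v : V} {s : Finset V}
    (h : ∀ T, c T ≠ 0 → T ⊆ insert v s) : ∀ T, coefOn v c T ≠ 0 → T ⊆ s := by
  intro T hT
  by_cases hv : v ∈ T
  · simp [coefOn, hv] at hT
  · simp only [coefOn, hv, if_false] at hT
    exact (Finset.subset_insert_iff_of_notMem hv).1
      ((Finset.subset_insert _ _).trans (h _ hT))

variable [Fintype V]

theorem Finset.sum_eq_sum_insert {M : Type*} [AddCommMonoid M] (v : V) (f : Finset V → M) :
    ∑ T, f T = ∑ T, if v ∈ T then 0 else f T + f (insert v T) := by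
  rw [← Finset.sum_filter_add_sum_filter_not Finset.univ (fun T => v ∈ T) f]
  have h1 : ∑ T with v ∈ T, f T = ∑ T with v ∉ T, f (insert v T) := by
    refine Finset.sum_bij' (fun T _ => T.erase v) (fun T _ => insert v T) ?_ ?_ ?_ ?_ ?_
    · simp
    · simp
    · intro T hT
      exact Finset.insert_erase (by simpa using hT)
    · intro T hT
      exact Finset.erase_insert (by simpa using hT)
    · intro T hT
      rw [Finset.insert_erase (by simpa using hT)]
  rw [h1, ← Finset.sum_add_distrib, Finset.sum_filter]
  refine Finset.sum_congr rfl fun T _ => ?_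
  by_cases h : v ∈ T <;> simp [h, add_comm]

/-- Evaluation of the multilinear polynomial with coefficients `c`. -/
def mlEval {A : Type*} [CommRing A] [Module ℝ A] (c : Finset V → ℝ) (y : V → A) : A :=
  ∑ T, c T • ∏ v ∈ T, y v

/-- The sum of the squares of the coefficients. -/
def sqNorm (c : Finset V → ℝ) : ℝ := ∑ T, c T ^ 2

/-- The influence of the variable `v`. -/
def infl (v : V) (c : Finset V → ℝ) : ℝ := sqNorm (coefOn v c)

theorem sqNorm_nonneg (c : Finset V → ℝ) : 0 ≤ sqNorm c := Finset.sum_nonneg fun _ _ => sq_nonneg _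

theorem infl_nonneg (v : V) (c : Finset V → ℝ) : 0 ≤ infl v c := sqNorm_nonneg _

theorem sqNorm_eq_zero {c : Finset V → ℝ} (h : sqNorm c = 0) : c = 0 := by
  ext T
  have := (Finset.sum_eq_zero_iff_of_nonneg (fun T _ => sq_nonneg (c T))).1 h T (Finset.mem_univ T)
  simpa using this

theorem sqNorm_split (v : V) (c : Finset V → ℝ) :
    sqNorm c = sqNorm (coefOff v c) + sqNorm (coefOn v c) := by
  unfold sqNorm
  rw [Finset.sum_eq_sum_insert v, ← Finset.sum_add_distrib]
  refine Finset.sum_congr rfl fun T _ => ?_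
  by_cases h : v ∈ T <;> simp [h, coefOff, coefOn]

section Eval
variable {A : Type*} [CommRing A] [Algebra ℝ A]

theorem mlEval_split (v : V) (c : Finset V → ℝ) (y : V → A) :
    mlEval c y = mlEval (coefOff v c) y + y v * mlEval (coefOn v c) y := by
  unfold mlEval
  rw [Finset.sum_eq_sum_insert v, Finset.mul_sum, ← Finset.sum_add_distrib]
  refine Finset.sum_congr rfl fun T _ => ?_
  by_cases h : v ∈ T
  · simp [h, coefOff, coefOn]
  · simp [h, coefOff, coefOn, Finset.prod_insert h]

theorem mlEval_congr_of_eqOn {s : Finset V} {c : Finset V → ℝ} (h : ∀ T, c T ≠ 0 → T ⊆ s)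
    {y z : V → A} (hyz : ∀ v ∈ s, y v = z v) : mlEval c y = mlEval c z := by
  unfold mlEval
  refine Finset.sum_congr rfl fun T _ => ?_
  by_cases hc : c T = 0
  · simp [hc]
  · rw [Finset.prod_congr rfl fun v hv => hyz v (h T hc hv)]

theorem mlEval_coefOff_congr (v : V) (c : Finset V → ℝ) {y z : V → A}
    (hyz : ∀ u, u ≠ v → y u = z u) : mlEval (coefOff v c) y = mlEval (coefOff v c) z := by
  refine mlEval_congr_of_eqOn (s := Finset.univ.erase v) ?_ (fun u hu => hyz u (by simpa using hu))
  exact coefOff_supported (by simp)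

theorem mlEval_coefOn_congr (v : V) (c : Finset V → ℝ) {y z : V → A}
    (hyz : ∀ u, u ≠ v → y u = z u) : mlEval (coefOn v c) y = mlEval (coefOn v c) z := by
  refine mlEval_congr_of_eqOn (s := Finset.univ.erase v) ?_ (fun u hu => hyz u (by simpa using hu))
  exact coefOn_supported (by simp)

theorem mlEval_of_supported_empty {c : Finset V → ℝ} (h : ∀ T, c T ≠ 0 → T ⊆ ∅) (y : V → A) :
    mlEval c y = algebraMap ℝ A (c ∅) := by
  unfold mlEval
  rw [Finset.sum_eq_single ∅]
  · simp [Algebra.smul_def]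
  · intro T _ hT
    have : c T = 0 := by
      by_contra hc
      exact hT (Finset.subset_empty.1 (h T hc))
    simp [this]
  · simp

theorem sqNorm_of_supported_empty {c : Finset V → ℝ} (h : ∀ T, c T ≠ 0 → T ⊆ ∅) :
    sqNorm c = c ∅ ^ 2 := by
  unfold sqNorm
  rw [Finset.sum_eq_single ∅]
  · intro T _ hT
    have : c T = 0 := by
      by_contra hc
      exact hT (Finset.subset_empty.1 (h T hc))
    simp [this]
  · simp

theorem continuous_mlEval {X : Type*} [TopologicalSpace X] [TopologicalSpace A]
    [IsTopologicalRing A] [ContinuousConstSMul ℝ A] (c : Finset V → ℝ) {y : X → V → A}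
    (hy : ∀ v, Continuous fun x => y x v) : Continuous fun x => mlEval c (y x) := by
  unfold mlEval
  refine continuous_finsetSum _ fun T _ => ?_
  exact (continuous_finsetProd _ fun v _ => hy v).const_smul (c T)

end Eval
end Multilinear

/-! ### Product probability spaces -/

theorem Continuous.integrable_compact {X : Type*} [TopologicalSpace X] [CompactSpace X]
    [MeasurableSpace X] [BorelSpace X] (ν : Measure X) [IsFiniteMeasure ν] {E : Type*}
    [NormedAddCommGroup E] [SecondCountableTopologyEither X E] {f : X → E} (hf : Continuous f) :
    Integrable f ν :=
  hf.integrable_of_hasCompactSupport (HasCompactSupport.of_compactSpace f)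

section Pi
variable {V : Type*} [DecidableEq V] [Fintype V] {Ω : Type*} [MeasurableSpace Ω]
  (μ : Measure Ω) [IsProbabilityMeasure μ]

/-- Resampling one coordinate preserves the product measure; every induction over variables below
rests on this. -/
theorem measurePreserving_update (v : V) :
    MeasurePreserving (fun p : Ω × (V → Ω) => Function.update p.2 v p.1)
      (μ.prod (Measure.pi fun _ : V => μ)) (Measure.pi fun _ : V => μ) := by
  have hm : Measurable (fun p : Ω × (V → Ω) => Function.update p.2 v p.1) := by
    rw [measurable_pi_iff]
    intro u
    by_cases h : u = v
    · subst h; simpa using measurable_fst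
    · simp only [Function.update_of_ne h]
      exact (measurable_pi_apply u).comp measurable_snd
  refine ⟨hm, ?_⟩
  symm
  apply Measure.pi_eq
  intro s hs
  rw [Measure.map_apply hm (MeasurableSet.univ_pi hs)]
  have : (fun p : Ω × (V → Ω) => Function.update p.2 v p.1) ⁻¹' Set.univ.pi s
      = s v ×ˢ Set.univ.pi (Function.update s v Set.univ) := by
    ext p
    simp only [Set.mem_preimage, Set.mem_univ_pi, Set.mem_prod]
    constructor
    · intro h
      refine ⟨by simpa using h v, fun u => ?_⟩
      by_cases hu : u = v
      · subst hu; simp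
      · simpa [hu] using h u
    · rintro ⟨h1, h2⟩ u
      by_cases hu : u = v
      · subst hu; simpa using h1
      · simpa [hu] using h2 u
  rw [this, Measure.prod_prod, Measure.pi_pi, ← Finset.mul_prod_erase Finset.univ _ (Finset.mem_univ v),
    ← Finset.mul_prod_erase Finset.univ (fun i => μ (s i)) (Finset.mem_univ v)]
  simp only [Function.update_self, measure_univ, one_mul]
  congr 1
  refine Finset.prod_congr rfl fun u hu => ?_
  rw [Function.update_of_ne (by simpa using hu)]

variable [TopologicalSpace Ω] [CompactSpace Ω] [SecondCountableTopology Ω] [BorelSpace Ω]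

theorem integral_pi_eq_integral_update {E : Type*} [NormedAddCommGroup E] [NormedSpace ℝ E]
    (v : V) {F : (V → Ω) → E} (hF : Continuous F) :
    ∫ ω, F ω ∂(Measure.pi fun _ : V => μ) =
      ∫ ω, ∫ t, F (Function.update ω v t) ∂μ ∂(Measure.pi fun _ : V => μ) := by
  have h := measurePreserving_update μ v
  have hcont : Continuous (fun p : Ω × (V → Ω) => F (Function.update p.2 v p.1)) :=
    hF.comp (continuous_snd.update v continuous_fst)
  rw [← h.map_eq, integral_map h.measurable.aemeasurable, h.map_eq, integral_prod_symm]
  · exact hcont.integrable_compact _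
  · exact hF.aestronglyMeasurable

end Pi

/-- Concavity of the power at `x / l` and `y / (1 - l)`, with equality when `x : y = l : (1 - l)`.
It stands in for Minkowski's inequality in the tensorization. -/
theorem rpow_add_ge_of_convex_weights {q l x y : ℝ} (hq : 0 < q) (hq1 : q < 1) (hl : 0 ≤ l)
    (hl1 : l ≤ 1) (hx : 0 ≤ x) (hy : 0 ≤ y) :
    l ^ (1 - q) * x ^ q + (1 - l) ^ (1 - q) * y ^ q ≤ (x + y) ^ q := by
  rcases hl.eq_or_lt with rfl | hl0
  · rw [Real.zero_rpow (by linarith)]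
    simp only [zero_mul, sub_zero, Real.one_rpow, one_mul, zero_add]
    exact Real.rpow_le_rpow hy (by linarith) hq.le
  rcases hl1.eq_or_lt with rfl | hl2
  · rw [sub_self, Real.zero_rpow (by linarith)]
    simp only [zero_mul, Real.one_rpow, one_mul, add_zero]
    exact Real.rpow_le_rpow hx (by linarith) hq.le
  have h2 : 0 < 1 - l := by linarith
  have hc := (Real.concaveOn_rpow hq.le hq1.le).2 (x := x / l) (y := y / (1 - l))
    (Set.mem_Ici.2 (by positivity)) (Set.mem_Ici.2 (by positivity)) hl h2.le (by ring)
  simp only [smul_eq_mul] at hc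
  rw [mul_div_cancel₀ _ hl0.ne', mul_div_cancel₀ _ h2.ne'] at hc
  refine le_trans (le_of_eq ?_) hc
  rw [Real.div_rpow hx hl, Real.div_rpow hy h2.le, Real.rpow_sub hl0, Real.rpow_sub h2]
  simp only [Real.rpow_one]
  ring

/-! ### Tensorization, and moments of multilinear polynomials -/

section Tensor
variable {V : Type*} [DecidableEq V] [Fintype V] {Ω : Type*} [MeasurableSpace Ω]
  (μ : Measure Ω) [IsProbabilityMeasure μ]
  [TopologicalSpace Ω] [CompactSpace Ω] [SecondCountableTopology Ω] [BorelSpace Ω]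

/-- Tensorization of a two-point inequality between the norms `L^{2q}` and `L^2`. -/
theorem sqNorm_rpow_le_integral {q : ℝ} (hq : 0 < q) (hq1 : q < 1) {h : Ω → ℂ} (hh : Continuous h)
    (htp : ∀ a b : ℂ, (‖a‖ ^ 2 + ‖b‖ ^ 2) ^ q ≤ ∫ t, ‖a + b * h t‖ ^ (2 * q) ∂μ) :
    ∀ c : Finset V → ℝ, (sqNorm c) ^ q ≤
      ∫ ω, ‖mlEval c (fun v => h (ω v))‖ ^ (2 * q) ∂(Measure.pi fun _ : V => μ) := by
  suffices H : ∀ s : Finset V, ∀ c : Finset V → ℝ, (∀ T, c T ≠ 0 → T ⊆ s) → (sqNorm c) ^ q ≤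
      ∫ ω, ‖mlEval c (fun v => h (ω v))‖ ^ (2 * q) ∂(Measure.pi fun _ : V => μ) from
    fun c => H Finset.univ c (by simp)
  have hsq : ∀ z : ℂ, (‖z‖ ^ 2) ^ q = ‖z‖ ^ (2 * q) := fun z => by
    rw [Real.rpow_mul (norm_nonneg _)]; norm_cast
  intro s
  induction s using Finset.induction_on with
  | empty =>
    intro c hc
    simp_rw [mlEval_of_supported_empty hc]
    rw [sqNorm_of_supported_empty hc]
    simp only [Complex.coe_algebraMap, Complex.norm_real, integral_const, probReal_univ, smul_eq_mul,
      one_mul, Real.norm_eq_abs]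
    rw [← sq_abs, Real.rpow_mul (abs_nonneg _)]
    norm_cast
  | insert v s hv ih =>
    intro c hc
    have hA := ih _ (coefOff_supported hc)
    have hB := ih _ (coefOn_supported hc)
    set a := sqNorm (coefOff v c)
    set b := sqNorm (coefOn v c)
    have ha : 0 ≤ a := sqNorm_nonneg _
    have hb : 0 ≤ b := sqNorm_nonneg _
    set A : (V → Ω) → ℂ := fun ω => mlEval (coefOff v c) (fun v => h (ω v)) with hAdef
    set B : (V → Ω) → ℂ := fun ω => mlEval (coefOn v c) (fun v => h (ω v)) with hBdef
    have hcy : ∀ u, Continuous fun ω : V → Ω => h (ω u) := fun u => hh.comp (continuous_apply u)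
    have hAc : Continuous A := continuous_mlEval _ hcy
    have hBc : Continuous B := continuous_mlEval _ hcy
    have hF : Continuous fun ω : V → Ω => ‖mlEval c (fun v => h (ω v))‖ ^ (2 * q) :=
      Continuous.rpow_const (continuous_mlEval _ hcy).norm (fun _ => Or.inr (by positivity))
    rw [integral_pi_eq_integral_update μ v hF, sqNorm_split v]
    have hval : ∀ ω t, mlEval c (fun u => h (Function.update ω v t u)) = A ω + B ω * h t := by
      intro ω t
      rw [mlEval_split v]
      rw [mlEval_coefOff_congr v c (z := fun u => h (ω u))
          (fun u hu => by simp [Function.update_of_ne hu]),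
        mlEval_coefOn_congr v c (z := fun u => h (ω u))
          (fun u hu => by simp [Function.update_of_ne hu])]
      simp [hAdef, hBdef, mul_comm]
    simp_rw [hval]
    have hjoint : Continuous fun p : (V → Ω) × Ω => ‖A p.1 + B p.1 * h p.2‖ ^ (2 * q) :=
      Continuous.rpow_const (by fun_prop) (fun _ => Or.inr (by positivity))
    have hAi : Continuous fun ω => (‖A ω‖ ^ 2) ^ q :=
      Continuous.rpow_const (by fun_prop) (fun _ => Or.inr hq.le)
    have hBi : Continuous fun ω => (‖B ω‖ ^ 2) ^ q :=
      Continuous.rpow_const (by fun_prop) (fun _ => Or.inr hq.le)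
    by_cases hab : a + b = 0
    · rw [show a + b = 0 from hab, Real.zero_rpow hq.ne']
      exact integral_nonneg fun ω => integral_nonneg fun t => by positivity
    have hab' : 0 < a + b := lt_of_le_of_ne (by positivity) (Ne.symm hab)
    -- With this `l`, inserting the inductive lower bounds `a ^ q` and `b ^ q` gives exactly `(a +
    -- b) ^ q`.
    set l := a / (a + b) with hl
    have hl0 : 0 ≤ l := by positivity
    have hl1 : l ≤ 1 := by rw [hl, div_le_one hab']; linarith
    have h1l : 1 - l = b / (a + b) := by rw [hl]; field_simp; ring
    have key : ∀ ω, l ^ (1 - q) * (‖A ω‖ ^ 2) ^ q + (1 - l) ^ (1 - q) * (‖B ω‖ ^ 2) ^ q ≤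
        ∫ t, ‖A ω + B ω * h t‖ ^ (2 * q) ∂μ := fun ω =>
      (rpow_add_ge_of_convex_weights hq hq1 hl0 hl1 (by positivity) (by positivity)).trans
        (htp _ _)
    have step : ∫ ω, (l ^ (1 - q) * (‖A ω‖ ^ 2) ^ q + (1 - l) ^ (1 - q) * (‖B ω‖ ^ 2) ^ q)
        ∂(Measure.pi fun _ : V => μ) ≤
        ∫ ω, ∫ t, ‖A ω + B ω * h t‖ ^ (2 * q) ∂μ ∂(Measure.pi fun _ : V => μ) := by
      apply integral_mono
      · exact Continuous.integrable_compact _ (by fun_prop)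
      · exact (hjoint.integrable_compact ((Measure.pi fun _ : V => μ).prod μ)).integral_prod_left
      · exact key
    refine le_trans ?_ step
    rw [integral_add ((hAi.integrable_compact _).const_mul _)
      ((hBi.integrable_compact _).const_mul _), integral_const_mul, integral_const_mul]
    simp_rw [hsq]
    have e : ∀ x, 0 ≤ x → (x / (a + b)) ^ (1 - q) * x ^ q = (a + b) ^ q * (x / (a + b)) := by
      intro x hx
      have h1 : x ^ q = (a + b) ^ q * (x / (a + b)) ^ q := by
        rw [← Real.mul_rpow (by positivity) (by positivity), mul_div_cancel₀ _ hab'.ne']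
      rw [h1, mul_left_comm, ← Real.rpow_add' (by positivity) (by norm_num)]
      simp
    calc (a + b) ^ q = l ^ (1 - q) * a ^ q + (1 - l) ^ (1 - q) * b ^ q := by
          rw [h1l, hl, e a ha, e b hb]; field_simp
      _ ≤ _ := by
          have : 0 ≤ 1 - l := by linarith
          gcongr

/-- A bounded real random variable with the same first three moments as a random sign, and whose
fourth moment is at most `3 / 2`. -/
structure SignLike (ξ : Ω → ℝ) : Prop where
  cont : Continuous ξ
  m1 : ∫ t, ξ t ∂μ = 0
  m2 : ∫ t, ξ t ^ 2 ∂μ = 1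
  m3 : ∫ t, ξ t ^ 3 ∂μ = 0
  m4 : ∫ t, ξ t ^ 4 ∂μ ≤ 3 / 2

variable {μ}

theorem SignLike.integral_fourth_power_le {ξ : Ω → ℝ} (hξ : SignLike μ ξ) (A B : ℝ) :
    ∫ t, (A + ξ t * B) ^ 4 ∂μ ≤ A ^ 4 + 6 * (A ^ 2 * B ^ 2) + 3 / 2 * B ^ 4 := by
  have hc := hξ.cont
  have i1 : Integrable (fun t => 4 * A ^ 3 * B * ξ t) μ :=
    Continuous.integrable_compact _ (by fun_prop)
  have i2 : Integrable (fun t => 6 * A ^ 2 * B ^ 2 * ξ t ^ 2) μ :=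
    Continuous.integrable_compact _ (by fun_prop)
  have i3 : Integrable (fun t => 4 * A * B ^ 3 * ξ t ^ 3) μ :=
    Continuous.integrable_compact _ (by fun_prop)
  have i4 : Integrable (fun t => B ^ 4 * ξ t ^ 4) μ :=
    Continuous.integrable_compact _ (by fun_prop)
  have e : (fun t => (A + ξ t * B) ^ 4) = fun t => A ^ 4 + (4 * A ^ 3 * B * ξ t +
      (6 * A ^ 2 * B ^ 2 * ξ t ^ 2 + (4 * A * B ^ 3 * ξ t ^ 3 + B ^ 4 * ξ t ^ 4))) := by
    ext t; ring
  have i34 : Integrable (fun t => 4 * A * B ^ 3 * ξ t ^ 3 + B ^ 4 * ξ t ^ 4) μ := i3.add i4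
  have i24 : Integrable (fun t => 6 * A ^ 2 * B ^ 2 * ξ t ^ 2 +
    (4 * A * B ^ 3 * ξ t ^ 3 + B ^ 4 * ξ t ^ 4)) μ := i2.add i34
  have i14 : Integrable (fun t => 4 * A ^ 3 * B * ξ t + (6 * A ^ 2 * B ^ 2 * ξ t ^ 2 +
    (4 * A * B ^ 3 * ξ t ^ 3 + B ^ 4 * ξ t ^ 4))) μ := i1.add i24
  rw [e, integral_add (integrable_const _) i14, integral_add i1 i24, integral_add i2 i34,
    integral_add i3 i4,
    integral_const_mul, integral_const_mul, integral_const_mul, integral_const_mul, hξ.m1, hξ.m2,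
    hξ.m3, integral_const]
  simp only [probReal_univ, smul_eq_mul]
  have : B ^ 4 * ∫ t, ξ t ^ 4 ∂μ ≤ B ^ 4 * (3 / 2) := by
    have := hξ.m4
    gcongr
  linarith

/-- Cauchy–Schwarz recovered from weighted AM–GM by optimizing `k`; the auxiliary `e` covers
vanishing `p` or `r`. -/
theorem le_mul_of_forall_two_mul_le {X P R p r : ℝ} (hp : 0 ≤ p) (hr : 0 ≤ r)
    (hP : P ≤ p ^ 2) (hR : R ≤ r ^ 2) (h : ∀ k : ℝ, 0 < k → 2 * X ≤ k * P + k⁻¹ * R) :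
    X ≤ p * r := by
  have : ∀ e : ℝ, 0 < e → X ≤ p * r + e * (p + r) := by
    intro e he
    have h1 := h ((r + e) / (p + e)) (by positivity)
    rw [inv_div] at h1
    have h2 : (r + e) / (p + e) * P ≤ (r + e) * p := by
      calc _ ≤ (r + e) / (p + e) * (p * (p + e)) := by gcongr; nlinarith
        _ = _ := by field_simp
    have h3 : (p + e) / (r + e) * R ≤ (p + e) * r := by
      calc _ ≤ (p + e) / (r + e) * (r * (r + e)) := by gcongr; nlinarith
        _ = _ := by field_simp
    nlinarith
  apply le_of_forall_pos_le_add
  intro e he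
  refine (this (e / (p + r + 1)) (by positivity)).trans ?_
  have : e / (p + r + 1) * (p + r) ≤ e := by
    rw [div_mul_eq_mul_div, div_le_iff₀ (by positivity)]
    nlinarith
  linarith

/-- Bonami's inequality for the fourth moment. -/
theorem integral_fourth_power_mlEval_le {ξ : V → Ω → ℝ} (hξ : ∀ v, SignLike μ (ξ v)) :
    ∀ (c : Finset V → ℝ) (d : ℕ), DegLE c d →
      ∫ ω, (mlEval c (fun v => ξ v (ω v))) ^ 4 ∂(Measure.pi fun _ : V => μ)
        ≤ 9 ^ d * sqNorm c ^ 2 := by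
  suffices H : ∀ s : Finset V, ∀ (c : Finset V → ℝ) (d : ℕ), (∀ T, c T ≠ 0 → T ⊆ s) → DegLE c d →
      ∫ ω, (mlEval c (fun v => ξ v (ω v))) ^ 4 ∂(Measure.pi fun _ : V => μ)
        ≤ 9 ^ d * sqNorm c ^ 2 from fun c d => H Finset.univ c d (by simp)
  intro s
  induction s using Finset.induction_on with
  | empty =>
    intro c d hc _
    simp_rw [mlEval_of_supported_empty hc]
    rw [sqNorm_of_supported_empty hc]
    simp only [Algebra.algebraMap_self, RingHom.id_apply, integral_const, probReal_univ,
      smul_eq_mul, one_mul]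
    have : (1 : ℝ) ≤ 9 ^ d := one_le_pow₀ (by norm_num)
    nlinarith [sq_nonneg (c ∅ ^ 2)]
  | insert v s hv ih =>
    intro c d hc hd
    have hcy : ∀ u, Continuous fun ω : V → Ω => ξ u (ω u) := fun u =>
      (hξ u).cont.comp (continuous_apply u)
    set A : (V → Ω) → ℝ := fun ω => mlEval (coefOff v c) (fun v => ξ v (ω v)) with hAdef
    set B : (V → Ω) → ℝ := fun ω => mlEval (coefOn v c) (fun v => ξ v (ω v)) with hBdef
    have hAc : Continuous A := continuous_mlEval _ hcy
    have hBc : Continuous B := continuous_mlEval _ hcy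
    have hA := ih _ d (coefOff_supported hc) (hd.off v)
    set a := sqNorm (coefOff v c)
    set b := sqNorm (coefOn v c) with hbdef
    have ha : 0 ≤ a := sqNorm_nonneg _
    have hb : 0 ≤ b := sqNorm_nonneg _
    -- The derivative has degree `d - 1`, which saves a factor `3`; for `d = 0` it vanishes and `r =
    -- 0`.
    obtain ⟨r, hr0, hr, hB⟩ : ∃ r : ℝ, 0 ≤ r ∧ 3 * r ≤ 3 ^ d * b ∧
        ∫ ω, B ω ^ 4 ∂(Measure.pi fun _ : V => μ) ≤ r ^ 2 := by
      cases d with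
      | zero =>
        refine ⟨0, le_rfl, by simpa using hb, ?_⟩
        have := hd.on_eq_zero v
        simp [hBdef, this, mlEval]
      | succ d =>
        refine ⟨3 ^ d * b, by positivity, by rw [pow_succ]; linarith, ?_⟩
        have := ih _ d (coefOn_supported hc) (hd.on v)
        refine this.trans (le_of_eq ?_)
        rw [mul_pow, ← pow_mul, mul_comm d 2, pow_mul, hbdef]
        norm_num
    have hF : Continuous fun ω : V → Ω => (mlEval c (fun v => ξ v (ω v))) ^ 4 :=
      (continuous_mlEval _ hcy).pow 4
    rw [integral_pi_eq_integral_update μ v hF, sqNorm_split v]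
    have hval : ∀ ω t, mlEval c (fun u => ξ u (Function.update ω v t u)) = A ω + ξ v t * B ω := by
      intro ω t
      rw [mlEval_split v]
      rw [mlEval_coefOff_congr v c (z := fun u => ξ u (ω u))
          (fun u hu => by simp [Function.update_of_ne hu]),
        mlEval_coefOn_congr v c (z := fun u => ξ u (ω u))
          (fun u hu => by simp [Function.update_of_ne hu])]
      simp [hAdef, hBdef]
    simp_rw [hval]
    have hvc := (hξ v).cont
    have hjoint : Continuous fun p : (V → Ω) × Ω => (A p.1 + ξ v p.2 * B p.1) ^ 4 := by fun_prop
    have iA : Integrable (fun ω => A ω ^ 4) (Measure.pi fun _ : V => μ) :=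
      Continuous.integrable_compact _ (by fun_prop)
    have iB : Integrable (fun ω => B ω ^ 4) (Measure.pi fun _ : V => μ) :=
      Continuous.integrable_compact _ (by fun_prop)
    have iAB : Integrable (fun ω => A ω ^ 2 * B ω ^ 2) (Measure.pi fun _ : V => μ) :=
      Continuous.integrable_compact _ (by fun_prop)
    have step : ∫ ω, ∫ t, (A ω + ξ v t * B ω) ^ 4 ∂μ ∂(Measure.pi fun _ : V => μ) ≤
        ∫ ω, (A ω ^ 4 + 6 * (A ω ^ 2 * B ω ^ 2) + 3 / 2 * B ω ^ 4)
          ∂(Measure.pi fun _ : V => μ) := by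
      apply integral_mono
      · exact (hjoint.integrable_compact ((Measure.pi fun _ : V => μ).prod μ)).integral_prod_left
      · exact Continuous.integrable_compact _ (by fun_prop)
      · exact fun ω => (hξ v).integral_fourth_power_le _ _
    have iA2 : Integrable (fun ω => A ω ^ 4 + 6 * (A ω ^ 2 * B ω ^ 2))
      (Measure.pi fun _ : V => μ) := iA.add (iAB.const_mul 6)
    rw [integral_add iA2 (iB.const_mul _), integral_add iA (iAB.const_mul 6),
      integral_const_mul, integral_const_mul] at step
    have hX : ∫ ω, A ω ^ 2 * B ω ^ 2 ∂(Measure.pi fun _ : V => μ) ≤ (3 ^ d * a) * r := by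
      refine le_mul_of_forall_two_mul_le (by positivity) hr0 (hA.trans (le_of_eq ?_)) hB ?_
      · rw [mul_pow, ← pow_mul, mul_comm d 2, pow_mul]
        norm_num
      · intro k hk
        rw [← integral_const_mul, ← integral_const_mul, ← integral_const_mul,
          ← integral_add (iA.const_mul _) (iB.const_mul _)]
        apply integral_mono (iAB.const_mul _) ((iA.const_mul _).add (iB.const_mul _))
        intro ω
        have : k * A ω ^ 4 + k⁻¹ * B ω ^ 4 - 2 * (A ω ^ 2 * B ω ^ 2)
            = k * (A ω ^ 2 - k⁻¹ * B ω ^ 2) ^ 2 := by field_simp; ring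
        have h2 : 0 ≤ k * (A ω ^ 2 - k⁻¹ * B ω ^ 2) ^ 2 := by positivity
        simp only [Pi.add_apply]
        linarith
    have h9 : (9 : ℝ) ^ d = (3 ^ d) ^ 2 := by rw [← pow_mul, mul_comm d 2, pow_mul]; norm_num
    rw [h9] at hA ⊢
    have h3 : (0 : ℝ) ≤ 3 ^ d := by positivity
    set t : ℝ := 3 ^ d
    -- The mixed term is at most `6 * (t a) * (t b / 3) = 2 t ^ 2 a b`, exactly the cross term of
    -- `(t (a + b)) ^ 2`.
    have h4 : t * a * r ≤ t * a * (t * b / 3) := by gcongr; linarith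
    have h5 : r ^ 2 ≤ (t * b / 3) ^ 2 := by gcongr; linarith
    nlinarith [mul_nonneg ha hb, sq_nonneg (t * b)]

end Tensor

/-! ### Replacing random signs by other variables -/

/-- The function `t ↦ 1 / (t - i)` on the real line. -/
noncomputable def cauchyKer (t : ℝ) : ℂ := ((t : ℂ) - Complex.I)⁻¹

theorem one_le_norm_ofReal_sub_I (t : ℝ) : 1 ≤ ‖(t : ℂ) - Complex.I‖ := by
  have := Complex.abs_im_le_norm ((t : ℂ) - Complex.I)
  simpa using this

theorem ofReal_sub_I_ne_zero (t : ℝ) : (t : ℂ) - Complex.I ≠ 0 := by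
  have := one_le_norm_ofReal_sub_I t
  exact norm_pos_iff.1 (by linarith)

theorem continuous_cauchyKer : Continuous cauchyKer :=
  (Complex.continuous_ofReal.sub continuous_const).inv₀ ofReal_sub_I_ne_zero

theorem cauchyKer_im (t : ℝ) : (cauchyKer t).im = 1 / (1 + t ^ 2) := by
  simp [cauchyKer, Complex.inv_im, Complex.normSq_apply, add_comm, pow_two]

/-- A finite geometric expansion with exact remainder, whose denominators all have norm at least
`1`. A rational test function makes Taylor's theorem algebraic. -/
theorem cauchyKer_expansion (A x B : ℝ) :
    ‖cauchyKer (A + x * B) - (cauchyKer A - x * B * cauchyKer A ^ 2 + x ^ 2 * B ^ 2 * cauchyKer A ^ 3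
      - x ^ 3 * B ^ 3 * cauchyKer A ^ 4)‖ ≤ x ^ 4 * B ^ 4 := by
  have h1 := ofReal_sub_I_ne_zero A
  have h2 := ofReal_sub_I_ne_zero (A + x * B)
  have hle1 := one_le_norm_ofReal_sub_I A
  have hle2 := one_le_norm_ofReal_sub_I (A + x * B)
  have e : cauchyKer (A + x * B) - (cauchyKer A - x * B * cauchyKer A ^ 2 +
      x ^ 2 * B ^ 2 * cauchyKer A ^ 3 - x ^ 3 * B ^ 3 * cauchyKer A ^ 4)
      = ((x ^ 4 * B ^ 4 : ℝ) : ℂ) *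
        (((A : ℂ) - Complex.I) ^ 4 * (((A + x * B : ℝ) : ℂ) - Complex.I))⁻¹ := by
    unfold cauchyKer
    push_cast at h2 ⊢
    field_simp
    ring
  rw [e, norm_mul, Complex.norm_real, Real.norm_of_nonneg (show 0 ≤ x ^ 4 * B ^ 4 by positivity),
    norm_inv, norm_mul, norm_pow]
  apply mul_le_of_le_one_right (by positivity)
  apply inv_le_one_of_one_le₀
  exact one_le_mul_of_one_le_of_one_le (one_le_pow₀ hle1) hle2

section Lindeberg
variable {V : Type*} [DecidableEq V] [Fintype V] {Ω : Type*} [MeasurableSpace Ω]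
  {μ : Measure Ω} [IsProbabilityMeasure μ]
  [TopologicalSpace Ω] [CompactSpace Ω] [SecondCountableTopology Ω] [BorelSpace Ω]

/-- The main term depends only on the first three moments, so it is common to all sign-like
variables. -/
theorem SignLike.norm_integral_cauchyKer_sub_le {ξ : Ω → ℝ} (hξ : SignLike μ ξ) (A B : ℝ) :
    ‖∫ t, cauchyKer (A + ξ t * B) ∂μ - (cauchyKer A + B ^ 2 * cauchyKer A ^ 3)‖
      ≤ 3 / 2 * B ^ 4 := by
  have hc := hξ.cont
  have hk := continuous_cauchyKer
  set z := cauchyKer A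
  have i1 : Integrable (fun t => -(B * z ^ 2) * (ξ t : ℂ)) μ :=
    Continuous.integrable_compact _ (by fun_prop)
  have i2 : Integrable (fun t => (B ^ 2 * z ^ 3) * ((ξ t ^ 2 : ℝ) : ℂ)) μ :=
    Continuous.integrable_compact _ (by fun_prop)
  have i3 : Integrable (fun t => -(B ^ 3 * z ^ 4) * ((ξ t ^ 3 : ℝ) : ℂ)) μ :=
    Continuous.integrable_compact _ (by fun_prop)
  have i23 : Integrable (fun t => (B ^ 2 * z ^ 3) * ((ξ t ^ 2 : ℝ) : ℂ) +
    -(B ^ 3 * z ^ 4) * ((ξ t ^ 3 : ℝ) : ℂ)) μ := i2.add i3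
  have i13 : Integrable (fun t => -(B * z ^ 2) * (ξ t : ℂ) + ((B ^ 2 * z ^ 3) * ((ξ t ^ 2 : ℝ) : ℂ) +
    -(B ^ 3 * z ^ 4) * ((ξ t ^ 3 : ℝ) : ℂ))) μ := i1.add i23
  have hpoly : ∫ t, (z + (-(B * z ^ 2) * (ξ t : ℂ) + ((B ^ 2 * z ^ 3) * ((ξ t ^ 2 : ℝ) : ℂ) +
      -(B ^ 3 * z ^ 4) * ((ξ t ^ 3 : ℝ) : ℂ)))) ∂μ = z + B ^ 2 * z ^ 3 := by
    rw [integral_add (integrable_const _) i13, integral_add i1 i23, integral_add i2 i3,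
      integral_const_mul, integral_const_mul, integral_const_mul, integral_complex_ofReal,
      integral_complex_ofReal, integral_complex_ofReal, hξ.m1, hξ.m2, hξ.m3]
    simp
  have ik : Integrable (fun t => cauchyKer (A + ξ t * B)) μ :=
    Continuous.integrable_compact _ (by fun_prop)
  have i03 : Integrable (fun t => z + (-(B * z ^ 2) * (ξ t : ℂ) + ((B ^ 2 * z ^ 3) *
      ((ξ t ^ 2 : ℝ) : ℂ) + -(B ^ 3 * z ^ 4) * ((ξ t ^ 3 : ℝ) : ℂ)))) μ := (integrable_const _).add i13
  rw [← hpoly, ← integral_sub ik i03]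
  refine (norm_integral_le_of_norm_le (g := fun t => B ^ 4 * ξ t ^ 4)
    (Continuous.integrable_compact _ (by fun_prop)) (Filter.Eventually.of_forall fun t => ?_)).trans ?_
  · have := cauchyKer_expansion A (ξ t) B
    refine le_trans (le_of_eq ?_) (this.trans (le_of_eq (mul_comm _ _)))
    congr 2
    push_cast
    ring
  · rw [integral_const_mul]
    have := hξ.m4
    nlinarith [sq_nonneg (B ^ 2)]

theorem DegLE.on_same {c : Finset V → ℝ} {d : ℕ} (h : DegLE c d) (v : V) :
    DegLE (coefOn v c) d := by
  cases d with
  | zero => rw [h.on_eq_zero v]; intro T _; rfl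
  | succ d => exact (h.on v).mono (Nat.le_succ d)

/-- Lindeberg's replacement method for low-degree polynomials. -/
theorem norm_integral_cauchyKer_mlEval_sub_le {ξ₀ ξ₁ : Ω → ℝ} (h₀ : SignLike μ ξ₀)
    (h₁ : SignLike μ ξ₁) {c : Finset V → ℝ} {d : ℕ} (hd : DegLE c d) :
    ‖∫ ω, cauchyKer (mlEval c fun v => ξ₀ (ω v)) ∂(Measure.pi fun _ : V => μ) -
      ∫ ω, cauchyKer (mlEval c fun v => ξ₁ (ω v)) ∂(Measure.pi fun _ : V => μ)‖
      ≤ 3 * 9 ^ d * ∑ v, infl v c ^ 2 := by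
  set π := Measure.pi fun _ : V => μ
  -- The hybrid in which the variables of `s` have already been replaced.
  set Y : Finset V → V → Ω → ℝ := fun s v => if v ∈ s then ξ₁ else ξ₀ with hY
  have hYs : ∀ s v, SignLike μ (Y s v) := by
    intro s v
    by_cases hv : v ∈ s
    · simpa [hY, hv] using h₁
    · simpa [hY, hv] using h₀
  suffices H : ∀ s : Finset V, ‖∫ ω, cauchyKer (mlEval c fun v => Y ∅ v (ω v)) ∂π -
      ∫ ω, cauchyKer (mlEval c fun v => Y s v (ω v)) ∂π‖ ≤ 3 * 9 ^ d * ∑ v ∈ s, infl v c ^ 2 by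
    have := H Finset.univ
    simpa [hY] using this
  have hcyY : ∀ s, ∀ u, Continuous fun ω : V → Ω => Y s u (ω u) := fun s u =>
    (hYs s u).cont.comp (continuous_apply u)
  intro s
  induction s using Finset.induction_on with
  | empty => simp
  | insert v s hv ih =>
    rw [Finset.sum_insert hv]
    have hcy := hcyY s
    set A : (V → Ω) → ℝ := fun ω => mlEval (coefOff v c) (fun u => Y s u (ω u)) with hAdef
    set B : (V → Ω) → ℝ := fun ω => mlEval (coefOn v c) (fun u => Y s u (ω u)) with hBdef
    have hAc : Continuous A := continuous_mlEval _ hcy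
    have hBc : Continuous B := continuous_mlEval _ hcy
    have hB4 : ∫ ω, B ω ^ 4 ∂π ≤ 9 ^ d * infl v c ^ 2 :=
      integral_fourth_power_mlEval_le (hYs s) _ d (hd.on_same v)
    have hk := continuous_cauchyKer
    -- Consecutive hybrids are both compared with `M`, which does not involve the variable at `v`.
    set M : ℂ := ∫ ω, (cauchyKer (A ω) + (B ω : ℂ) ^ 2 * cauchyKer (A ω) ^ 3) ∂π
    have half : ∀ s', (∀ u, u ≠ v → Y s' u = Y s u) →
        ‖∫ ω, cauchyKer (mlEval c fun u => Y s' u (ω u)) ∂π - M‖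
          ≤ 3 / 2 * (9 ^ d * infl v c ^ 2) := by
      intro s' hs'
      have hF : Continuous fun ω : V → Ω => cauchyKer (mlEval c fun u => Y s' u (ω u)) :=
        hk.comp (continuous_mlEval _ (hcyY s'))
      rw [integral_pi_eq_integral_update μ v hF]
      have hval : ∀ ω t, mlEval c (fun u => Y s' u (Function.update ω v t u))
          = A ω + Y s' v t * B ω := by
        intro ω t
        rw [mlEval_split v]
        rw [mlEval_coefOff_congr v c (z := fun u => Y s u (ω u))
            (fun u hu => by simp [Function.update_of_ne hu, hs' u hu]),
          mlEval_coefOn_congr v c (z := fun u => Y s u (ω u))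
            (fun u hu => by simp [Function.update_of_ne hu, hs' u hu])]
        simp [hAdef, hBdef]
      simp_rw [hval]
      have hvc := (hYs s' v).cont
      have hjoint : Continuous fun p : (V → Ω) × Ω => cauchyKer (A p.1 + Y s' v p.2 * B p.1) := by
        fun_prop
      rw [← integral_sub
        (hjoint.integrable_compact (π.prod μ)).integral_prod_left
        (Continuous.integrable_compact _ (by fun_prop))]
      refine (norm_integral_le_of_norm_le (g := fun ω => 3 / 2 * B ω ^ 4)
        (Continuous.integrable_compact _ (by fun_prop))
        (Filter.Eventually.of_forall fun ω => (hYs s' v).norm_integral_cauchyKer_sub_le _ _)).trans ?_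
      rw [integral_const_mul]
      linarith
    have hh1 := half s (fun _ _ => rfl)
    have hh2 := half (insert v s) (fun u hu => by simp [hY, hu])
    have htri := norm_sub_le_norm_sub_add_norm_sub
      (∫ ω, cauchyKer (mlEval c fun u => Y s u (ω u)) ∂π) M
      (∫ ω, cauchyKer (mlEval c fun u => Y (insert v s) u (ω u)) ∂π)
    rw [norm_sub_rev M] at htri
    have htri2 := norm_sub_le_norm_sub_add_norm_sub
      (∫ ω, cauchyKer (mlEval c fun u => Y ∅ u (ω u)) ∂π)
      (∫ ω, cauchyKer (mlEval c fun u => Y s u (ω u)) ∂π)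
      (∫ ω, cauchyKer (mlEval c fun u => Y (insert v s) u (ω u)) ∂π)
    linarith

end Lindeberg

/-! ### The two concrete variables -/

/-- A uniform bit together with a uniform point of the circle. -/
noncomputable def bitCircle : Measure (Bool × UnitAddCircle) :=
  (PMF.uniformOfFintype Bool).toMeasure.prod volume

instance : IsProbabilityMeasure (volume : Measure UnitAddCircle) :=
  ⟨UnitAddCircle.measure_univ⟩

instance : IsProbabilityMeasure bitCircle := by unfold bitCircle; infer_instance

/-- The sign of a bit. -/
def bitSign (b : Bool) : ℝ := if b then 1 else -1

theorem integral_bitCircle_fst (f : Bool → ℝ) :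
    ∫ p, f p.1 ∂bitCircle = (f true + f false) / 2 := by
  unfold bitCircle
  rw [integral_fun_fst, PMF.integral_eq_sum]
  simp; ring

theorem integral_bitCircle_snd (f : UnitAddCircle → ℝ) :
    ∫ p, f p.2 ∂bitCircle = ∫ t, f t := by
  unfold bitCircle
  rw [integral_fun_snd, probReal_univ, one_smul]

theorem signLike_bitSign : SignLike bitCircle fun p => bitSign p.1 where
  cont := (continuous_of_discreteTopology (f := bitSign)).comp continuous_fst
  m1 := by rw [integral_bitCircle_fst bitSign]; simp [bitSign]
  m2 := by rw [integral_bitCircle_fst fun b => bitSign b ^ 2]; simp [bitSign]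
  m3 := by rw [integral_bitCircle_fst fun b => bitSign b ^ 3]; norm_num [bitSign]
  m4 := by rw [integral_bitCircle_fst fun b => bitSign b ^ 4]; norm_num [bitSign]

/-- `√2` times the cosine of an angle. -/
noncomputable def cosVar (t : UnitAddCircle) : ℝ := √2 * (AddCircle.toCircle t : ℂ).re

theorem continuous_coe_toCircle : Continuous fun t : UnitAddCircle => (AddCircle.toCircle t : ℂ) :=
  continuous_subtype_val.comp AddCircle.continuous_toCircle

theorem continuous_cosVar : Continuous cosVar :=
  continuous_const.mul (Complex.continuous_re.comp continuous_coe_toCircle)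

theorem integral_cosVar_pow (n : ℕ) : ∫ t, cosVar t ^ n
    = √2 ^ n * ((2 * Real.pi)⁻¹ * ∫ θ in (0 : ℝ)..2 * Real.pi, Real.cos θ ^ n) := by
  have := integral_unitAddCircle_eq_circleAverage (fun u : ℂ => (√2 * u.re) ^ n)
  rw [show (∫ t, cosVar t ^ n) = _ from this, Real.circleAverage_def, smul_eq_mul]
  simp_rw [mul_pow]
  rw [intervalIntegral.integral_const_mul, mul_left_comm]
  simp [circleMap, Complex.exp_ofReal_mul_I_re]

/-- The factor `√2` normalizes the variance, and the fourth moment is `4 * 3 / 8 = 3 / 2`: the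
source of the constant in `SignLike`. -/
theorem signLike_cosVar : SignLike bitCircle fun p => cosVar p.2 where
  cont := continuous_cosVar.comp continuous_snd
  m1 := by
    rw [integral_bitCircle_snd cosVar]
    have := integral_cosVar_pow 1
    simpa using this
  m2 := by
    rw [integral_bitCircle_snd fun t => cosVar t ^ 2, integral_cosVar_pow, integral_cos_sq]
    simp
    field_simp
  m3 := by
    rw [integral_bitCircle_snd fun t => cosVar t ^ 3, integral_cosVar_pow, integral_cos_pow]
    simp
  m4 := by
    rw [integral_bitCircle_snd fun t => cosVar t ^ 4, integral_cosVar_pow, integral_cos_pow,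
      integral_cos_sq]
    have : √2 ^ 4 = 4 := by
      rw [show 4 = 2 * 2 from rfl, pow_mul, Real.sq_sqrt (by norm_num)]; norm_num
    rw [this]
    simp
    field_simp
    norm_num

/-! ### Polynomials in independent cosines: lower bound on a small norm -/

section Cos
variable {V : Type*} [DecidableEq V] [Fintype V]

/-- `S ω u`, as a function of `u`, is a polynomial; on the unit circle its modulus is comparable to
that of the polynomial `c` at a rotation of the cosine variables. -/
noncomputable def discFamily (c : Finset V → ℝ) (d : ℕ) (w : ℝ) (ω : V → UnitAddCircle)
    (u : ℂ) : ℂ :=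
  ∑ T, c T • (((u + w) * (1 + w * u)) ^ (d - T.card) *
    ∏ v ∈ T, ((√2 : ℂ)⁻¹ * ((u + w) ^ 2 * (starRingEnd ℂ) (AddCircle.toCircle (ω v) : ℂ)
      + (1 + w * u) ^ 2 * (AddCircle.toCircle (ω v) : ℂ))))

theorem discFamily_eq_eval (c : Finset V → ℝ) (d : ℕ) (w : ℝ) (ω : V → UnitAddCircle) :
    ∃ S : Polynomial ℂ, ∀ u, S.eval u = discFamily c d w ω u := by
  open Polynomial in
  refine ⟨∑ T, c T • (((X + C (w : ℂ)) * (1 + C (w : ℂ) * X)) ^ (d - T.card) *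
    ∏ v ∈ T, (C (√2 : ℂ)⁻¹ * ((X + C (w : ℂ)) ^ 2 * C ((starRingEnd ℂ)
      (AddCircle.toCircle (ω v) : ℂ))
      + (1 + C (w : ℂ) * X) ^ 2 * C (AddCircle.toCircle (ω v) : ℂ)))), fun u => ?_⟩
  simp [discFamily, eval_finsetSum, eval_prod]

theorem continuous_discFamily (c : Finset V → ℝ) (d : ℕ) (w : ℝ) :
    Continuous fun p : (V → UnitAddCircle) × UnitAddCircle =>
      discFamily c d w p.1 (AddCircle.toCircle p.2 : ℂ) := by
  have h2 : Continuous fun p : (V → UnitAddCircle) × UnitAddCircle =>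
      (AddCircle.toCircle p.2 : ℂ) := continuous_coe_toCircle.comp continuous_snd
  have h1 : ∀ v, Continuous fun p : (V → UnitAddCircle) × UnitAddCircle =>
      (AddCircle.toCircle (p.1 v) : ℂ) := fun v =>
    continuous_coe_toCircle.comp ((continuous_apply v).comp continuous_fst)
  have h3 : ∀ v, Continuous fun p : (V → UnitAddCircle) × UnitAddCircle =>
      (starRingEnd ℂ) (AddCircle.toCircle (p.1 v) : ℂ) := fun v =>
    Complex.continuous_conj.comp (h1 v)
  unfold discFamily
  refine continuous_finsetSum _ fun T _ => Continuous.const_smul (Continuous.mul ?_ ?_) (c T)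
  · fun_prop
  · exact continuous_finsetProd _ fun v _ => by have := h1 v; have := h3 v; fun_prop

/-- At `u = 0` the rotation `(1 + w u) / (u + w)` has left the circle and equals `1 / w`. The
analytic part of each cosine is thereby magnified, which makes hypercontractivity applicable. -/
theorem discFamily_zero {c : Finset V → ℝ} {d : ℕ} (hd : DegLE c d) {w : ℝ} (hw : 0 < w)
    (ω : V → UnitAddCircle) :
    discFamily c d w ω 0 = (w : ℂ) ^ d * mlEval c (fun v => ((AddCircle.toCircle (ω v) : ℂ)
      + w ^ 2 * (starRingEnd ℂ) (AddCircle.toCircle (ω v) : ℂ)) / (√2 * w)) := by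
  unfold discFamily mlEval
  rw [Finset.mul_sum]
  refine Finset.sum_congr rfl fun T _ => ?_
  by_cases hT : d < T.card
  · simp [hd T hT]
  push Not at hT
  rw [mul_smul_comm]
  congr 1
  have hwc : (w : ℂ) ≠ 0 := by exact_mod_cast hw.ne'
  have e : (w : ℂ) ^ d = w ^ (d - T.card) * ∏ v ∈ T, (w : ℂ) := by
    rw [Finset.prod_const, ← pow_add, Nat.sub_add_cancel hT]
  rw [e, mul_assoc, ← Finset.prod_mul_distrib]
  congr 1
  · simp
  · refine Finset.prod_congr rfl fun v _ => ?_
    field_simp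
    ring

/-- For `‖u‖ = 1` the quotient `z = (1 + w u) / (u + w)` is unimodular, so it shifts all angles by
the same `τ`. Clearing denominators costs `((u + w) (1 + w u)) ^ d`. -/
theorem exists_discFamily_eq {c : Finset V → ℝ} {d : ℕ} (hd : DegLE c d) {w : ℝ} (hw : 0 < w)
    (hw1 : w < 1) (t : UnitAddCircle) : ∃ τ : UnitAddCircle, ∀ ω : V → UnitAddCircle,
    ‖discFamily c d w ω (AddCircle.toCircle t : ℂ)‖ ≤
      (1 + w) ^ (2 * d) * |mlEval c (fun v => cosVar (ω v + τ))| := by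
  set u : ℂ := (AddCircle.toCircle t : ℂ) with hu
  have hun : ‖u‖ = 1 := Circle.norm_coe _
  have huu : u * (starRingEnd ℂ) u = 1 := by
    rw [Complex.mul_conj, Complex.normSq_eq_norm_sq, hun]; simp
  have h1 : 1 + w * u = u * (starRingEnd ℂ) (u + w) := by
    rw [map_add, mul_add, huu, Complex.conj_ofReal]; ring
  have hn : ‖1 + w * u‖ = ‖u + w‖ := by rw [h1, norm_mul, hun, one_mul, Complex.norm_conj]
  have hne : u + w ≠ 0 := by
    intro h
    have : ‖u‖ = w := by
      rw [eq_neg_of_add_eq_zero_left h, norm_neg, Complex.norm_real, Real.norm_of_nonneg hw.le]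
    linarith
  have hne' : 1 + w * u ≠ 0 := by
    rw [← norm_pos_iff, hn]; exact norm_pos_iff.2 hne
  set z : ℂ := (1 + w * u) / (u + w) with hz
  have hzn : ‖z‖ = 1 := by
    rw [hz, norm_div, hn, div_self (norm_ne_zero_iff.2 hne)]
  obtain ⟨τ, hτ⟩ : ∃ τ : UnitAddCircle, (AddCircle.toCircle τ : ℂ) = z := by
    obtain ⟨τ, hτ⟩ := (AddCircle.homeomorphCircle (one_ne_zero' ℝ)).surjective
      ⟨z, mem_sphere_zero_iff_norm.2 hzn⟩
    refine ⟨τ, ?_⟩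
    rw [AddCircle.homeomorphCircle_apply] at hτ
    rw [hτ]
  refine ⟨τ, fun ω => ?_⟩
  have hzz : z * (starRingEnd ℂ) z = 1 := by
    rw [Complex.mul_conj, Complex.normSq_eq_norm_sq, hzn]; simp
  have hcos : ∀ v, (√2 : ℂ)⁻¹ * ((u + w) ^ 2 * (starRingEnd ℂ) (AddCircle.toCircle (ω v) : ℂ)
      + (1 + w * u) ^ 2 * (AddCircle.toCircle (ω v) : ℂ))
      = ((u + w) * (1 + w * u)) * (cosVar (ω v + τ) : ℂ) := by
    intro v
    set ζ := (AddCircle.toCircle (ω v) : ℂ)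
    have e1 : (AddCircle.toCircle (ω v + τ) : ℂ) = ζ * z := by
      rw [AddCircle.toCircle_add, Circle.coe_mul, hτ]
    have hs : ((√2 : ℝ) : ℂ) ^ 2 = 2 := by
      rw [← Complex.ofReal_pow, Real.sq_sqrt (by norm_num)]; norm_num
    have hs0 : ((√2 : ℝ) : ℂ) ≠ 0 := by
      exact_mod_cast (by positivity : √2 ≠ 0)
    have e2 : (cosVar (ω v + τ) : ℂ) = (√2 : ℂ)⁻¹ * (ζ * z + (starRingEnd ℂ) (ζ * z)) := by
      rw [cosVar, e1, Complex.add_conj]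
      push_cast
      field_simp
      rw [hs]
      ring
    have h4 : 1 + w * u = z * (u + w) := by rw [hz]; field_simp
    rw [e2, map_mul, h4]
    linear_combination (-(√2 : ℂ)⁻¹ * (u + w) ^ 2 * (starRingEnd ℂ) ζ) * hzz
  have hS : discFamily c d w ω u = ((u + w) * (1 + w * u)) ^ d *
      ((mlEval c (fun v => cosVar (ω v + τ)) : ℝ) : ℂ) := by
    unfold discFamily mlEval
    rw [Complex.ofReal_sum, Finset.mul_sum]
    refine Finset.sum_congr rfl fun T _ => ?_
    by_cases hT : d < T.card
    · simp [hd T hT]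
    push Not at hT
    rw [Finset.prod_congr rfl fun v _ => hcos v, Finset.prod_mul_distrib, Finset.prod_const,
      ← mul_assoc, ← pow_add, Nat.sub_add_cancel hT]
    simp only [Complex.real_smul, smul_eq_mul, Complex.ofReal_mul, Complex.ofReal_prod]
    ring
  rw [hS, norm_mul, Complex.norm_real, Real.norm_eq_abs, norm_pow, norm_mul, hn, ← pow_two, ← pow_mul]
  gcongr
  refine (norm_add_le _ _).trans ?_
  rw [hun, Complex.norm_real, Real.norm_of_nonneg hw.le]

/-- The `L^{1/d}` norm of a polynomial of degree `d` in independent cosines. -/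
theorem sqNorm_rpow_le_integral_cosVar {c : Finset V → ℝ} {d : ℕ} (hd0 : 0 < d) (hd : DegLE c d) :
    (128 * d : ℝ)⁻¹ * (sqNorm c) ^ (1 / (2 * d) : ℝ) ≤
      ∫ ω, |mlEval c (fun v => cosVar (ω v))| ^ (1 / d : ℝ)
        ∂(Measure.pi fun _ : V => (volume : Measure UnitAddCircle)) := by
  set π := Measure.pi fun _ : V => (volume : Measure UnitAddCircle)
  have hdr : (1 : ℝ) ≤ d := by exact_mod_cast hd0
  -- The exponent `2 q = 1 / d` turns `w ^ d` into `w`; the choice of `w` meets the requirement `w ^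
  -- 2 ≤ q / 16` of the two-point inequality.
  set q : ℝ := 1 / (2 * d) with hq
  set w : ℝ := 1 / (32 * d) with hw
  have hq0 : 0 < q := by positivity
  have hq1 : q ≤ 1 / 2 := by
    rw [hq, div_le_div_iff₀ (by positivity) (by norm_num)]; linarith
  have hw0 : 0 < w := by positivity
  have hw1 : w < 1 := by
    rw [hw, div_lt_one (by positivity)]; linarith
  have hwq : w ^ 2 ≤ q / 16 := by
    rw [hw, hq, div_pow, one_pow, div_div, div_le_div_iff₀ (by positivity) (by positivity)]
    nlinarith
  have h2q : (1 / d : ℝ) = 2 * q := by rw [hq]; field_simp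
  rw [h2q]
  set U := ∫ ω, |mlEval c (fun v => cosVar (ω v))| ^ (2 * q) ∂π with hU
  set h : UnitAddCircle → ℂ := fun t => ((AddCircle.toCircle t : ℂ)
      + w ^ 2 * (starRingEnd ℂ) (AddCircle.toCircle t : ℂ)) / (√2 * w) with hh
  have hc1 := continuous_coe_toCircle
  have hhc : Continuous h := by
    have : Continuous fun t : UnitAddCircle => (starRingEnd ℂ) (AddCircle.toCircle t : ℂ) :=
      Complex.continuous_conj.comp hc1
    fun_prop
  have htp : ∀ a b : ℂ, (‖a‖ ^ 2 + ‖b‖ ^ 2) ^ q ≤ ∫ t, ‖a + b * h t‖ ^ (2 * q) := by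
    intro a b
    have h1 := rpow_le_circleAverage_perturbed hq0 hq1 hw0 hwq a (b / (√2 * w))
    have h2 := integral_unitAddCircle_eq_circleAverage
      (fun u => ‖a + b / (√2 * w) * (u + w ^ 2 * (starRingEnd ℂ) u)‖ ^ (2 * q))
    rw [← h2] at h1
    have h3 : ∀ t : UnitAddCircle, ‖a + b / (√2 * w) * ((AddCircle.toCircle t : ℂ) +
        w ^ 2 * (starRingEnd ℂ) (AddCircle.toCircle t : ℂ))‖ ^ (2 * q) = ‖a + b * h t‖ ^ (2 * q) := by
      intro t
      congr 3
      rw [hh]; ring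
    simp_rw [h3] at h1
    refine le_trans ?_ h1
    gcongr
    rw [norm_div, norm_mul, Complex.norm_real, Complex.norm_real, Real.norm_of_nonneg hw0.le,
      Real.norm_of_nonneg (Real.sqrt_nonneg _), div_pow, mul_pow, Real.sq_sqrt (by norm_num)]
    rw [← mul_div_assoc, le_div_iff₀ (by positivity)]
    nlinarith [sq_nonneg ‖b‖]
  have hT := sqNorm_rpow_le_integral (V := V) (μ := (volume : Measure UnitAddCircle)) hq0
    (by linarith) hhc htp c
  have hSc := continuous_discFamily c d w
  have hSp : Continuous fun p : (V → UnitAddCircle) × UnitAddCircle =>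
      ‖discFamily c d w p.1 (AddCircle.toCircle p.2 : ℂ)‖ ^ (2 * q) :=
    Continuous.rpow_const hSc.norm (fun _ => Or.inr (by positivity))
  have hcos : Continuous fun ω : V → UnitAddCircle =>
      |mlEval c (fun v => cosVar (ω v))| ^ (2 * q) :=
    Continuous.rpow_const (continuous_mlEval _ fun v =>
      continuous_cosVar.comp (continuous_apply v)).abs (fun _ => Or.inr (by positivity))
  have hU0 : 0 ≤ U := integral_nonneg fun ω => by positivity
  -- The product measure is invariant under a common shift, and `(1 + w) ^ (2 d)` raised to the
  -- power `1 / d` is at most `4`.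
  have hup : ∀ t : UnitAddCircle,
      ∫ ω, ‖discFamily c d w ω (AddCircle.toCircle t : ℂ)‖ ^ (2 * q) ∂π ≤ 4 * U := by
    intro t
    obtain ⟨τ, hτ⟩ := exists_discFamily_eq hd hw0 hw1 t
    have hinv : ∫ ω, |mlEval c (fun v => cosVar (ω v + τ))| ^ (2 * q) ∂π = U :=
      integral_add_right_eq_self (μ := π)
        (fun ω : V → UnitAddCircle => |mlEval c (fun v => cosVar (ω v))| ^ (2 * q)) (fun _ => τ)
    have hshift : Continuous fun ω : V → UnitAddCircle =>
        |mlEval c (fun v => cosVar (ω v + τ))| ^ (2 * q) :=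
      hcos.comp (continuous_pi fun v => (continuous_apply v).add continuous_const)
    rw [← hinv, ← integral_const_mul]
    apply integral_mono
    · exact (hSp.comp (continuous_id.prodMk continuous_const)).integrable_compact π
    · exact (hshift.integrable_compact π).const_mul 4
    · intro ω
      refine (Real.rpow_le_rpow (norm_nonneg _) (hτ ω) (by positivity)).trans ?_
      rw [Real.mul_rpow (by positivity) (abs_nonneg _)]
      refine mul_le_mul_of_nonneg_right ?_ (by positivity)
      rw [← Real.rpow_natCast, ← Real.rpow_mul (by positivity)]
      have : ((2 * d : ℕ) : ℝ) * (2 * q) = 2 := by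
        rw [hq]; push_cast; field_simp
      rw [this]
      norm_cast
      nlinarith
  -- Subharmonicity in `u`, for fixed angles: the value at the centre is bounded by the circle
  -- average.
  have hlow : ∀ ω : V → UnitAddCircle, w * ‖mlEval c (fun v => h (ω v))‖ ^ (2 * q) ≤
      ∫ t : UnitAddCircle, ‖discFamily c d w ω (AddCircle.toCircle t : ℂ)‖ ^ (2 * q) := by
    intro ω
    obtain ⟨S, hS⟩ := discFamily_eq_eval c d w ω
    have h1 := norm_eval_zero_rpow_le_circleAverage (p := 2 * q) (by positivity) S
    rw [← integral_unitAddCircle_eq_circleAverage] at h1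
    simp_rw [hS] at h1
    rw [discFamily_zero hd hw0, norm_mul, Real.mul_rpow (norm_nonneg _) (norm_nonneg _), norm_pow,
      Complex.norm_real, Real.norm_of_nonneg hw0.le, ← Real.rpow_natCast,
      ← Real.rpow_mul hw0.le] at h1
    have : (d : ℝ) * (2 * q) = 1 := by rw [hq]; field_simp
    rw [this, Real.rpow_one] at h1
    exact h1
  have hQh : Continuous fun ω : V → UnitAddCircle => ‖mlEval c (fun v => h (ω v))‖ ^ (2 * q) :=
    Continuous.rpow_const (continuous_mlEval _ fun v =>
      hhc.comp (continuous_apply v)).norm (fun _ => Or.inr (by positivity))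
  have hSi := hSp.integrable_compact (π.prod (volume : Measure UnitAddCircle))
  have hswap := integral_integral_swap (μ := π) (ν := (volume : Measure UnitAddCircle))
    (f := fun ω t => ‖discFamily c d w ω (AddCircle.toCircle t : ℂ)‖ ^ (2 * q)) hSi
  have hA : w * (sqNorm c) ^ q ≤
      ∫ ω, (∫ t : UnitAddCircle, ‖discFamily c d w ω (AddCircle.toCircle t : ℂ)‖ ^ (2 * q)) ∂π := by
    calc _ ≤ w * ∫ ω, ‖mlEval c (fun v => h (ω v))‖ ^ (2 * q) ∂π := by gcongr
      _ = ∫ ω, w * ‖mlEval c (fun v => h (ω v))‖ ^ (2 * q) ∂π := by rw [integral_const_mul]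
      _ ≤ _ := integral_mono ((hQh.integrable_compact π).const_mul w) hSi.integral_prod_left hlow
  have hB : ∫ t : UnitAddCircle, ∫ ω, ‖discFamily c d w ω (AddCircle.toCircle t : ℂ)‖ ^ (2 * q) ∂π ≤ 4 * U := by
    have := integral_mono (μ := (volume : Measure UnitAddCircle)) hSi.integral_prod_right
      (integrable_const (4 * U)) hup
    simpa using this
  rw [hswap] at hA
  have hfin : w * (sqNorm c) ^ q ≤ 4 * U := hA.trans hB
  have : (128 * d : ℝ)⁻¹ = w / 4 := by rw [hw]; field_simp; norm_num
  rw [this]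
  linarith

end Cos

/-! ### Low-degree polynomials with small influences -/

section Regular
variable {V : Type*} [DecidableEq V] [Fintype V]

theorem integral_sq_mlEval {Ω : Type*} [MeasurableSpace Ω]
    {μ : Measure Ω} [IsProbabilityMeasure μ]
    [TopologicalSpace Ω] [CompactSpace Ω] [SecondCountableTopology Ω] [BorelSpace Ω]
    {ξ : Ω → ℝ} (hξ : SignLike μ ξ) (c : Finset V → ℝ) :
    ∫ ω, (mlEval c (fun v => ξ (ω v))) ^ 2 ∂(Measure.pi fun _ : V => μ) = sqNorm c := by
  suffices H : ∀ s : Finset V, ∀ (c : Finset V → ℝ), (∀ T, c T ≠ 0 → T ⊆ s) →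
      ∫ ω, (mlEval c (fun v => ξ (ω v))) ^ 2 ∂(Measure.pi fun _ : V => μ) = sqNorm c from
    H Finset.univ c (by simp)
  intro s
  induction s using Finset.induction_on with
  | empty =>
    intro c hc
    simp_rw [mlEval_of_supported_empty hc]
    rw [sqNorm_of_supported_empty hc]
    simp
  | insert v s hv ih =>
    intro c hc
    have hcy : ∀ u, Continuous fun ω : V → Ω => ξ (ω u) := fun u =>
      hξ.cont.comp (continuous_apply u)
    set A : (V → Ω) → ℝ := fun ω => mlEval (coefOff v c) (fun v => ξ (ω v)) with hAdef
    set B : (V → Ω) → ℝ := fun ω => mlEval (coefOn v c) (fun v => ξ (ω v)) with hBdef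
    have hAc : Continuous A := continuous_mlEval _ hcy
    have hBc : Continuous B := continuous_mlEval _ hcy
    have hF : Continuous fun ω : V → Ω => (mlEval c (fun v => ξ (ω v))) ^ 2 :=
      (continuous_mlEval _ hcy).pow 2
    rw [integral_pi_eq_integral_update μ v hF, sqNorm_split v, ← ih _ (coefOff_supported hc),
      ← ih _ (coefOn_supported hc)]
    have hval : ∀ ω t, mlEval c (fun u => ξ (Function.update ω v t u)) = A ω + ξ t * B ω := by
      intro ω t
      rw [mlEval_split v]
      rw [mlEval_coefOff_congr v c (z := fun u => ξ (ω u))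
          (fun u hu => by simp [Function.update_of_ne hu]),
        mlEval_coefOn_congr v c (z := fun u => ξ (ω u))
          (fun u hu => by simp [Function.update_of_ne hu])]
      simp [hAdef, hBdef]
    simp_rw [hval]
    have hvc := hξ.cont
    have hin : ∀ a b : ℝ, ∫ t, (a + ξ t * b) ^ 2 ∂μ = a ^ 2 + b ^ 2 := by
      intro a b
      have i1 : Integrable (fun t => 2 * a * b * ξ t) μ :=
        Continuous.integrable_compact _ (by fun_prop)
      have i2 : Integrable (fun t => b ^ 2 * ξ t ^ 2) μ :=
        Continuous.integrable_compact _ (by fun_prop)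
      have i12 : Integrable (fun t => 2 * a * b * ξ t + b ^ 2 * ξ t ^ 2) μ := i1.add i2
      have e : (fun t => (a + ξ t * b) ^ 2) = fun t => a ^ 2 + (2 * a * b * ξ t + b ^ 2 * ξ t ^ 2) := by
        ext t; ring
      rw [e, integral_add (integrable_const _) i12, integral_add i1 i2, integral_const_mul,
        integral_const_mul, hξ.m1, hξ.m2]
      simp
    simp_rw [hin]
    exact integral_add (Continuous.integrable_compact _ (by fun_prop))
      (Continuous.integrable_compact _ (by fun_prop))

/-- The average of a function over the discrete cube. -/
noncomputable def cubeAvg (F : (V → Bool) → ℝ) : ℝ := (∑ x, F x) / 2 ^ Fintype.card V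

theorem cubeAvg_mono {F G : (V → Bool) → ℝ} (h : ∀ x, F x ≤ G x) : cubeAvg F ≤ cubeAvg G := by
  unfold cubeAvg
  gcongr
  exact h _

theorem integral_bits_eq_cubeAvg (F : (V → Bool) → ℝ) :
    ∫ ω, F (fun v => (ω v).1) ∂(Measure.pi fun _ : V => bitCircle) = cubeAvg F := by
  have h1 : MeasurePreserving (Prod.fst : Bool × UnitAddCircle → Bool) bitCircle
      (PMF.uniformOfFintype Bool).toMeasure := measurePreserving_fst
  have h2 := measurePreserving_pi (ι := V) (fun _ => bitCircle)
    (fun _ => (PMF.uniformOfFintype Bool).toMeasure) (fun _ => h1)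
  have h3 : ∫ ω, F (fun v => (ω v).1) ∂(Measure.pi fun _ : V => bitCircle)
      = ∫ x, F x ∂(Measure.pi fun _ : V => (PMF.uniformOfFintype Bool).toMeasure) := by
    rw [← h2.map_eq, integral_map h2.measurable.aemeasurable]
    exact (measurable_of_finite F).aestronglyMeasurable
  rw [h3, integral_fintype (Integrable.of_finite)]
  unfold cubeAvg
  rw [Finset.sum_div]
  refine Finset.sum_congr rfl fun x _ => ?_
  rw [Measure.real, Measure.pi_singleton]
  simp
  ring

theorem integral_circles_eq {F : (V → UnitAddCircle) → ℝ} (hF : Continuous F) :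
    ∫ ω, F (fun v => (ω v).2) ∂(Measure.pi fun _ : V => bitCircle) =
      ∫ ω, F ω ∂(Measure.pi fun _ : V => (volume : Measure UnitAddCircle)) := by
  have h1 : MeasurePreserving (Prod.snd : Bool × UnitAddCircle → UnitAddCircle) bitCircle volume :=
    measurePreserving_snd
  have h2 := measurePreserving_pi (ι := V) (fun _ => bitCircle)
    (fun _ => (volume : Measure UnitAddCircle)) (fun _ => h1)
  rw [← h2.map_eq, integral_map h2.measurable.aemeasurable]
  exact hF.aestronglyMeasurable

theorem cubeAvg_sq_mlEval (c : Finset V → ℝ) :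
    cubeAvg (fun x => (mlEval c fun v => bitSign (x v)) ^ 2) = sqNorm c := by
  rw [← integral_sq_mlEval signLike_bitSign c, ← integral_bits_eq_cubeAvg]

theorem cubeAvg_pow_four_mlEval_le {c : Finset V → ℝ} {d : ℕ} (hd : DegLE c d) :
    cubeAvg (fun x => (mlEval c fun v => bitSign (x v)) ^ 4) ≤ 9 ^ d * sqNorm c ^ 2 := by
  rw [← integral_bits_eq_cubeAvg]
  exact integral_fourth_power_mlEval_le (fun _ => signLike_bitSign) c d hd

theorem mlEval_smul {A : Type*} [CommRing A] [Algebra ℝ A] (r : ℝ) (c : Finset V → ℝ) (y : V → A) :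
    mlEval (r • c) y = r • mlEval c y := by
  simp [mlEval, Finset.smul_sum, smul_smul]

theorem sqNorm_smul (r : ℝ) (c : Finset V → ℝ) : sqNorm (r • c) = r ^ 2 * sqNorm c := by
  simp [sqNorm, Finset.mul_sum, mul_pow]

theorem infl_smul (r : ℝ) (v : V) (c : Finset V → ℝ) : infl v (r • c) = r ^ 2 * infl v c := by
  rw [infl, infl, ← sqNorm_smul]
  congr 1
  ext T
  by_cases h : v ∈ T <;> simp [coefOn, h]

theorem infl_eq_sum (v : V) (c : Finset V → ℝ) : infl v c = ∑ T, if v ∈ T then c T ^ 2 else 0 := by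
  rw [Finset.sum_eq_sum_insert v]
  unfold infl sqNorm
  refine Finset.sum_congr rfl fun T _ => ?_
  by_cases h : v ∈ T <;> simp [coefOn, h]

/-- The total influence. -/
def totalInfl (c : Finset V → ℝ) : ℝ := ∑ T, (T.card : ℝ) * c T ^ 2

theorem sum_infl (c : Finset V → ℝ) : ∑ v, infl v c = totalInfl c := by
  simp_rw [infl_eq_sum]
  rw [Finset.sum_comm]
  unfold totalInfl
  refine Finset.sum_congr rfl fun T _ => ?_
  rw [Finset.sum_ite_mem, Finset.univ_inter, Finset.sum_const, nsmul_eq_mul]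

theorem totalInfl_le {c : Finset V → ℝ} {d : ℕ} (hd : DegLE c d) : totalInfl c ≤ d * sqNorm c := by
  unfold totalInfl sqNorm
  rw [Finset.mul_sum]
  refine Finset.sum_le_sum fun T _ => ?_
  by_cases hT : d < T.card
  · simp [hd T hT]
  · push Not at hT
    gcongr

theorem totalInfl_nonneg (c : Finset V → ℝ) : 0 ≤ totalInfl c :=
  Finset.sum_nonneg fun T _ => by positivity

/-- The three terms handle `|t| ≤ l`, large `|t| > 1 / e`, and the range between. Given the second
moment, this converts a lower bound on the `L^{1/d}` norm into one on the mean of `t ^ 2 / (t ^ 2 +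
l ^ 2)`. -/
theorem abs_rpow_le_of_one_le {d : ℕ} (hd : 1 ≤ d) {l e : ℝ} (hl : 0 < l) (he : 0 < e)
    (he1 : e ≤ 1) (t : ℝ) :
    |t| ^ (1 / d : ℝ) ≤ l ^ (1 / d : ℝ) + e * t ^ 2 + 2 / e * (t ^ 2 / (t ^ 2 + l ^ 2)) := by
  have hdr : (1 : ℝ) ≤ d := by exact_mod_cast hd
  have hp : 0 ≤ (1 / d : ℝ) := by positivity
  have hp1 : (1 / d : ℝ) ≤ 1 := by rw [div_le_one (by positivity)]; exact hdr
  have hlp : 0 ≤ l ^ (1 / d : ℝ) := by positivity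
  by_cases h1 : |t| ≤ l
  · have : |t| ^ (1 / d : ℝ) ≤ l ^ (1 / d : ℝ) := Real.rpow_le_rpow (abs_nonneg _) h1 hp
    have h2 : 0 ≤ e * t ^ 2 + 2 / e * (t ^ 2 / (t ^ 2 + l ^ 2)) := by positivity
    linarith
  push Not at h1
  have ht : l ^ 2 ≤ t ^ 2 := by rw [← sq_abs t]; gcongr
  have hhalf : 1 / 2 ≤ t ^ 2 / (t ^ 2 + l ^ 2) := by
    rw [div_le_div_iff₀ (by norm_num) (by positivity)]; linarith
  by_cases h2 : |t| ≤ 1 / e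
  · have h3 : |t| ^ (1 / d : ℝ) ≤ 1 / e := by
      by_cases h4 : |t| ≤ 1
      · exact (Real.rpow_le_one (abs_nonneg _) h4 hp).trans
          (by rw [le_div_iff₀ he]; linarith)
      · push Not at h4
        exact (Real.rpow_le_self_of_one_le h4.le hp1).trans h2
    have h4 : 1 / e ≤ 2 / e * (t ^ 2 / (t ^ 2 + l ^ 2)) := by
      calc 1 / e = 2 / e * (1 / 2) := by field_simp
        _ ≤ _ := by gcongr
    have : 0 ≤ e * t ^ 2 := by positivity
    linarith
  · push Not at h2
    have h4 : 1 ≤ |t| := by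
      have : 1 ≤ 1 / e := by rw [le_div_iff₀ he]; linarith
      linarith
    have h5 : |t| ≤ e * t ^ 2 := by
      rw [div_lt_iff₀ he] at h2
      rw [← sq_abs t]
      nlinarith
    have h6 := Real.rpow_le_self_of_one_le h4 hp1
    have h7 : 0 ≤ 2 / e * (t ^ 2 / (t ^ 2 + l ^ 2)) := by positivity
    linarith

/-- The scale `((2 ^ 10 d) ^ d)`. -/
def scaleY (d : ℕ) : ℝ := (2 ^ 10 * d) ^ d

theorem integral_cosVar_ratio_ge {c : Finset V → ℝ} {d : ℕ} (hd0 : 1 ≤ d) (hd : DegLE c d)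
    (hN : sqNorm c = 1) :
    1 / (2 ^ 18 * d ^ 2 : ℝ) ≤
      ∫ ω, (fun t : ℝ => t ^ 2 / (t ^ 2 + ((1 / (512 * d)) ^ d) ^ 2))
        (mlEval c (fun v => cosVar (ω v)))
        ∂(Measure.pi fun _ : V => (volume : Measure UnitAddCircle)) := by
  set π := Measure.pi fun _ : V => (volume : Measure UnitAddCircle)
  have hdr : (1 : ℝ) ≤ d := by exact_mod_cast hd0
  -- Chosen so that the norm bound reads `4 k`. The small and large ranges use up at most `k` each,
  -- leaving `2 k ≤ (2 / k) * ∫ ψ`.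
  set k : ℝ := 1 / (512 * d) with hk
  have hk0 : 0 < k := by positivity
  have hk1 : k ≤ 1 := by rw [hk, div_le_one (by positivity)]; linarith
  set l : ℝ := k ^ d with hl
  have hl0 : 0 < l := by positivity
  have hlp : l ^ (1 / d : ℝ) = k := by
    rw [hl, ← Real.rpow_natCast, ← Real.rpow_mul hk0.le]
    have : (d : ℝ) * (1 / d) = 1 := by field_simp
    rw [this, Real.rpow_one]
  have hcy : Continuous fun ω : V → UnitAddCircle => mlEval c (fun v => cosVar (ω v)) :=
    continuous_mlEval _ fun v => continuous_cosVar.comp (continuous_apply v)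
  have h1 := sqNorm_rpow_le_integral_cosVar (by omega) hd
  rw [hN, Real.one_rpow, mul_one] at h1
  have h2 : ∫ ω, (mlEval c (fun v => cosVar (ω v))) ^ 2 ∂π = 1 :=
    (integral_circles_eq (F := fun ω => (mlEval c (fun v => cosVar (ω v))) ^ 2)
      (hcy.pow 2)).symm.trans ((integral_sq_mlEval signLike_cosVar c).trans hN)
  set ψ : (V → UnitAddCircle) → ℝ := fun ω => (mlEval c (fun v => cosVar (ω v))) ^ 2 /
    ((mlEval c (fun v => cosVar (ω v))) ^ 2 + l ^ 2) with hψ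
  have hψc : Continuous ψ := (hcy.pow 2).div ((hcy.pow 2).add continuous_const)
    (fun ω => by positivity)
  have i2 : Integrable (fun ω => k * (mlEval c (fun v => cosVar (ω v))) ^ 2) π :=
    ((hcy.pow 2).integrable_compact π).const_mul k
  have i3 := (hψc.integrable_compact π).const_mul (2 / k)
  have i12 : Integrable (fun ω => k + k * (mlEval c (fun v => cosVar (ω v))) ^ 2) π :=
    (integrable_const _).add i2
  have h3 : ∫ ω, |mlEval c (fun v => cosVar (ω v))| ^ (1 / d : ℝ) ∂π ≤
      ∫ ω, (k + k * (mlEval c (fun v => cosVar (ω v))) ^ 2 + 2 / k * ψ ω) ∂π := by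
    apply integral_mono
    · exact (Continuous.rpow_const hcy.abs (fun _ => Or.inr (by positivity))).integrable_compact π
    · exact i12.add i3
    · intro ω
      have := abs_rpow_le_of_one_le hd0 hl0 hk0 hk1 (mlEval c (fun v => cosVar (ω v)))
      rw [hlp] at this
      exact this
  rw [integral_add i12 i3, integral_add (integrable_const _) i2, integral_const_mul,
    integral_const_mul, h2] at h3
  simp only [integral_const, probReal_univ, smul_eq_mul, one_mul, mul_one] at h3
  have h4 : (128 * d : ℝ)⁻¹ = 4 * k := by rw [hk]; field_simp; norm_num
  rw [h4] at h1
  have h5 : 2 * k ≤ 2 / k * ∫ ω, ψ ω ∂π := by linarith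
  have h6 : k ^ 2 ≤ ∫ ω, ψ ω ∂π := by
    rw [div_mul_eq_mul_div, le_div_iff₀ hk0] at h5
    nlinarith
  refine le_trans (le_of_eq ?_) h6
  rw [hk]; field_simp; norm_num

/-- Four of the seven powers of `scaleY d` absorb `(512 d) ^ (4 d)` and `9 ^ d`; the other three
absorb the polynomial factors. -/
theorem scaleY_pow_bound {d : ℕ} (hd0 : 1 ≤ d) :
    3 * 9 ^ d * (d / scaleY d ^ 7) * (512 * d : ℝ) ^ (4 * d) ≤ 1 / (2 ^ 19 * d ^ 2) := by
  have hdr : (1 : ℝ) ≤ d := by exact_mod_cast hd0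
  have hd : (0 : ℝ) < d := by linarith
  unfold scaleY
  have e1 : ((2 ^ 10 * d : ℝ) ^ d) ^ 7 = (2 ^ 10 * d) ^ (4 * d) * (2 ^ 10 * d) ^ (3 * d) := by
    rw [← pow_mul, ← pow_add]; congr 1; ring
  have e2 : (2 ^ 10 * d : ℝ) ^ (4 * d) = 16 ^ d * (512 * d) ^ (4 * d) := by
    rw [show (2 ^ 10 * d : ℝ) = 2 * (512 * d) by ring, mul_pow, pow_mul]; norm_num
  have e3 : (2 ^ 10 * d : ℝ) ^ 3 ≤ (2 ^ 10 * d : ℝ) ^ (3 * d) :=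
    pow_le_pow_right₀ (by linarith) (by omega)
  have e4 : (9 : ℝ) ^ d ≤ 16 ^ d := by gcongr; norm_num
  rw [e1, e2]
  set X := (512 * d : ℝ) ^ (4 * d)
  have hX : 0 < X := by positivity
  set Z := (2 ^ 10 * d : ℝ) ^ (3 * d)
  have hZ : 0 < Z := by positivity
  rw [show 3 * 9 ^ d * (d / (16 ^ d * X * Z)) * X = (9 ^ d * (3 * d)) / (16 ^ d * Z) by field_simp,
    div_le_div_iff₀ (by positivity) (by positivity), one_mul]
  calc (9 : ℝ) ^ d * (3 * d) * (2 ^ 19 * d ^ 2) = 9 ^ d * (3 * 2 ^ 19 * d ^ 3) := by ring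
    _ ≤ 16 ^ d * Z := by
      gcongr
      refine le_trans ?_ e3
      rw [mul_pow]
      gcongr
      norm_num

/-- A low-degree polynomial all of whose influences are small is nonzero with a noticeable
probability. -/
theorem cubeAvg_ne_zero_ge_of_regular {c : Finset V → ℝ} {d : ℕ} (hd0 : 1 ≤ d) (hd : DegLE c d)
    (hc : c ≠ 0) (hreg : ∀ v, infl v c ≤ sqNorm c / scaleY d ^ 7) :
    1 / (2 ^ 19 * d ^ 2 : ℝ) ≤
      cubeAvg (fun x => if (mlEval c fun v => bitSign (x v)) ≠ 0 then 1 else 0) := by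
  have hN0 : 0 < sqNorm c := lt_of_le_of_ne (sqNorm_nonneg c) fun h => hc (sqNorm_eq_zero h.symm)
  have hdr : (1 : ℝ) ≤ d := by exact_mod_cast hd0
  have hY : 0 < scaleY d := by unfold scaleY; positivity
  set r : ℝ := (√(sqNorm c))⁻¹ with hr
  have hr0 : 0 < r := by positivity
  have hr2 : r ^ 2 * sqNorm c = 1 := by
    rw [hr, inv_pow, Real.sq_sqrt hN0.le, inv_mul_cancel₀ hN0.ne']
  set l : ℝ := (1 / (512 * d)) ^ d with hl
  have hl0 : 0 < l := by positivity
  have hN1 : sqNorm (r • c) = 1 := by rw [sqNorm_smul, hr2]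
  have hdeg : ∀ s : ℝ, DegLE (s • c) d := fun s T hT => by simp [hd T hT]
  have hcos := integral_cosVar_ratio_ge hd0 (hdeg r) hN1
  rw [← hl] at hcos
  -- Here `r` normalizes the variance, and `l⁻¹` makes the imaginary part of `cauchyKer` equal to `1
  -- - t ^ 2 / (t ^ 2 + l ^ 2)` in the normalized value `t`.
  set c' : Finset V → ℝ := (l⁻¹ * r) • c with hc'
  have hc'2 : c' = l⁻¹ • (r • c) := by rw [hc', smul_smul]
  have hlin := norm_integral_cauchyKer_mlEval_sub_le signLike_bitSign signLike_cosVar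
    (show DegLE c' d from hdeg _)
  have hk := continuous_cauchyKer
  have hcy0 : Continuous fun ω : V → Bool × UnitAddCircle =>
      mlEval c' (fun v => bitSign (ω v).1) :=
    continuous_mlEval _ fun v => signLike_bitSign.cont.comp (continuous_apply v)
  have hcy1 : Continuous fun ω : V → Bool × UnitAddCircle =>
      mlEval c' (fun v => cosVar (ω v).2) :=
    continuous_mlEval _ fun v => signLike_cosVar.cont.comp (continuous_apply v)
  have i0 := (hk.comp hcy0).integrable_compact (Measure.pi fun _ : V => bitCircle)
  have i1 := (hk.comp hcy1).integrable_compact (Measure.pi fun _ : V => bitCircle)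
  have him := (Complex.abs_im_le_norm _).trans hlin
  rw [Complex.sub_im] at him
  have e0 : (∫ ω, cauchyKer (mlEval c' fun v => bitSign (ω v).1)
      ∂(Measure.pi fun _ : V => bitCircle)).im =
      cubeAvg (fun x => 1 / (1 + (mlEval c' fun v => bitSign (x v)) ^ 2)) := by
    rw [← integral_bits_eq_cubeAvg]
    have := (Complex.imCLM.integral_comp_comm i0).symm
    simpa [Function.comp_def, cauchyKer_im] using this
  have e1 : (∫ ω, cauchyKer (mlEval c' fun v => cosVar (ω v).2)
      ∂(Measure.pi fun _ : V => bitCircle)).im =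
      ∫ ω, 1 / (1 + (mlEval c' fun v => cosVar (ω v)) ^ 2)
        ∂(Measure.pi fun _ : V => (volume : Measure UnitAddCircle)) := by
    have hcc : Continuous fun ω : V → UnitAddCircle => (mlEval c' fun v => cosVar (ω v)) :=
      continuous_mlEval _ fun v => continuous_cosVar.comp (continuous_apply v)
    rw [← integral_circles_eq (F := fun ω => 1 / (1 + (mlEval c' fun v => cosVar (ω v)) ^ 2))]
    · have := (Complex.imCLM.integral_comp_comm i1).symm
      simpa [Function.comp_def, cauchyKer_im] using this
    · exact continuous_const.div (continuous_const.add (hcc.pow 2)) (fun ω => by positivity)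
  rw [e0, e1] at him
  have hrat : ∀ t : ℝ, 1 / (1 + (l⁻¹ * t) ^ 2) = 1 - t ^ 2 / (t ^ 2 + l ^ 2) := by
    intro t
    have : t ^ 2 + l ^ 2 ≠ 0 := by positivity
    have h2 : 1 + (l⁻¹ * t) ^ 2 ≠ 0 := by positivity
    field_simp
    ring
  have hcos2 : ∫ ω, 1 / (1 + (mlEval c' fun v => cosVar (ω v)) ^ 2)
        ∂(Measure.pi fun _ : V => (volume : Measure UnitAddCircle)) ≤ 1 - 1 / (2 ^ 18 * (d : ℝ) ^ 2) := by
    have hcc : Continuous fun ω : V → UnitAddCircle => (mlEval (r • c) fun v => cosVar (ω v)) :=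
      continuous_mlEval _ fun v => continuous_cosVar.comp (continuous_apply v)
    rw [hc'2]
    simp_rw [mlEval_smul l⁻¹, smul_eq_mul, hrat]
    rw [integral_sub (integrable_const _)]
    · simp only [integral_const, probReal_univ, smul_eq_mul, one_mul]
      simp only at hcos
      linarith
    · exact ((hcc.pow 2).div ((hcc.pow 2).add continuous_const)
        (fun ω => (add_pos_of_nonneg_of_pos (sq_nonneg _) (pow_pos hl0 2)).ne')).integrable_compact _
  -- The test function is `1` at zeros of the polynomial and nonnegative elsewhere, so its mean
  -- bounds the probability of vanishing.
  have hcube : 1 - cubeAvg (fun x => if (mlEval c fun v => bitSign (x v)) ≠ 0 then 1 else 0) ≤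
      cubeAvg (fun x => 1 / (1 + (mlEval c' fun v => bitSign (x v)) ^ 2)) := by
    have hone : cubeAvg (fun _ : V → Bool => (1 : ℝ)) = 1 := by
      simp [cubeAvg]
    have hsub : cubeAvg (fun x => 1 - if (mlEval c fun v => bitSign (x v)) ≠ 0 then (1 : ℝ) else 0)
        = 1 - cubeAvg (fun x => if (mlEval c fun v => bitSign (x v)) ≠ 0 then 1 else 0) := by
      refine Eq.trans ?_ (congrArg (· - _) hone)
      unfold cubeAvg
      rw [Finset.sum_sub_distrib, sub_div]
    rw [← hsub]
    apply cubeAvg_mono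
    intro x
    by_cases h : (mlEval c fun v => bitSign (x v)) = 0
    · simp [h, hc', mlEval_smul]
    · simp only [ne_eq, h, not_false_eq_true, if_true, sub_self]
      positivity
  -- The sum of squares is bounded by the largest influence times the total influence.
  have hinfl : ∑ v, infl v c' ^ 2 ≤ (l⁻¹) ^ 4 * (d / scaleY d ^ 7) := by
    have h1 : ∀ v, infl v c' ^ 2 ≤ (l⁻¹) ^ 4 * (r ^ 2 / scaleY d ^ 7) * infl v c := by
      intro v
      rw [hc', infl_smul]
      have h2 : r ^ 2 * infl v c ≤ 1 / scaleY d ^ 7 := by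
        calc r ^ 2 * infl v c ≤ r ^ 2 * (sqNorm c / scaleY d ^ 7) := by gcongr; exact hreg v
          _ = 1 / scaleY d ^ 7 := by rw [← mul_div_assoc, hr2]
      have h3 := infl_nonneg v c
      calc ((l⁻¹ * r) ^ 2 * infl v c) ^ 2
          = (l⁻¹) ^ 4 * (r ^ 2 * infl v c) * (r ^ 2 * infl v c) := by ring
        _ ≤ (l⁻¹) ^ 4 * (1 / scaleY d ^ 7) * (r ^ 2 * infl v c) := by gcongr
        _ = _ := by ring
    calc ∑ v, infl v c' ^ 2 ≤ ∑ v, (l⁻¹) ^ 4 * (r ^ 2 / scaleY d ^ 7) * infl v c :=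
          Finset.sum_le_sum fun v _ => h1 v
      _ = (l⁻¹) ^ 4 * (r ^ 2 / scaleY d ^ 7) * totalInfl c := by rw [← Finset.mul_sum, sum_infl]
      _ ≤ (l⁻¹) ^ 4 * (r ^ 2 / scaleY d ^ 7) * (d * sqNorm c) := by
          gcongr; exact totalInfl_le hd
      _ = (l⁻¹) ^ 4 * ((r ^ 2 * sqNorm c) * d / scaleY d ^ 7) := by ring
      _ = _ := by rw [hr2, one_mul]
  have hl4 : (l⁻¹) ^ 4 = (512 * d : ℝ) ^ (4 * d) := by
    rw [hl, one_div, ← inv_pow, inv_inv, ← pow_mul, mul_comm d 4]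
  have hbound : 3 * 9 ^ d * ∑ v, infl v c' ^ 2 ≤ 1 / (2 ^ 19 * d ^ 2 : ℝ) := by
    calc 3 * 9 ^ d * ∑ v, infl v c' ^ 2 ≤ 3 * 9 ^ d * ((l⁻¹) ^ 4 * (d / scaleY d ^ 7)) := by gcongr
      _ = 3 * 9 ^ d * (d / scaleY d ^ 7) * (512 * d : ℝ) ^ (4 * d) := by rw [hl4]; ring
      _ ≤ _ := scaleY_pow_bound hd0
  have h19 : 1 / (2 ^ 18 * d ^ 2 : ℝ) = 2 * (1 / (2 ^ 19 * d ^ 2)) := by field_simp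
  have := (abs_le.1 (him.trans hbound)).2
  linarith

end Regular

/-! ### Decision trees on influential variables, and robust polynomials -/

section Tree
variable {V : Type*} [DecidableEq V] [Fintype V]

/-- The coefficients of the polynomial obtained by setting the variable `v` to `±1`. -/
def restr (v : V) (b : Bool) (c : Finset V → ℝ) : Finset V → ℝ :=
  coefOff v c + bitSign b • coefOn v c

theorem restr_of_mem {v : V} {b : Bool} {c : Finset V → ℝ} {T : Finset V} (h : v ∈ T) :
    restr v b c T = 0 := by
  simp [restr, coefOff, coefOn, h]

theorem restr_of_notMem {v : V} {b : Bool} {c : Finset V → ℝ} {T : Finset V} (h : v ∉ T) :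
    restr v b c T = c T + bitSign b * c (insert v T) := by
  simp [restr, coefOff, coefOn, h]

theorem DegLE.restr {c : Finset V → ℝ} {d : ℕ} (hd : DegLE c d) (v : V) (b : Bool) :
    DegLE (restr v b c) d := by
  intro T hT
  by_cases h : v ∈ T
  · exact restr_of_mem h
  · rw [restr_of_notMem h, hd T hT, hd (insert v T) (hT.trans_le (Finset.card_le_card
      (Finset.subset_insert _ _)))]
    simp

theorem mlEval_restr (v : V) (b : Bool) (c : Finset V → ℝ) (x : V → Bool) :
    (mlEval (restr v b c) fun u => bitSign (x u)) =
      mlEval c fun u => bitSign (Function.update x v b u) := by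
  have hadd : (mlEval (restr v b c) fun u => bitSign (x u)) =
      (mlEval (coefOff v c) fun u => bitSign (x u)) +
        bitSign b * mlEval (coefOn v c) fun u => bitSign (x u) := by
    simp [mlEval, restr, add_mul, Finset.sum_add_distrib, Finset.mul_sum, mul_assoc]
  rw [hadd, mlEval_split v c,
    mlEval_coefOff_congr v c (y := fun u => bitSign (Function.update x v b u)) (z := fun u => bitSign (x u))
      (fun u hu => by simp [Function.update_of_ne hu]),
    mlEval_coefOn_congr v c (y := fun u => bitSign (Function.update x v b u)) (z := fun u => bitSign (x u))
      (fun u hu => by simp [Function.update_of_ne hu])]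
  simp

theorem cubeAvg_eq_update (v : V) (F : (V → Bool) → ℝ) :
    cubeAvg F = (cubeAvg (fun x => F (Function.update x v true)) +
      cubeAvg (fun x => F (Function.update x v false))) / 2 := by
  set fl : (V → Bool) → (V → Bool) := fun x => Function.update x v (!x v) with hfl
  have hinv : Function.Involutive fl := by
    intro x
    simp [hfl]
  have h1 : ∑ x, F (fl x) = ∑ x, F x := (Equiv.sum_comp hinv.toPerm F)
  have h2 : ∀ x, F x + F (fl x) =
      F (Function.update x v true) + F (Function.update x v false) := by
    intro x
    have hx : x = Function.update x v (x v) := by simp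
    cases h : x v
    · rw [h] at hx
      rw [← hx, hfl]
      simp [h, add_comm]
    · rw [h] at hx
      rw [← hx, hfl]
      simp [h]
  have h3 : ∑ x, F x + ∑ x, F x = ∑ x, F (Function.update x v true) +
      ∑ x, F (Function.update x v false) := by
    conv_lhs => enter [2]; rw [← h1]
    rw [← Finset.sum_add_distrib, ← Finset.sum_add_distrib]
    exact Finset.sum_congr rfl fun x _ => h2 x
  unfold cubeAvg
  rw [← add_div, ← h3]
  ring

theorem cubeAvg_restr (G : ℝ → ℝ) (v : V) (c : Finset V → ℝ) :
    cubeAvg (fun x => G (mlEval c fun u => bitSign (x u))) =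
      (cubeAvg (fun x => G (mlEval (restr v true c) fun u => bitSign (x u))) +
        cubeAvg (fun x => G (mlEval (restr v false c) fun u => bitSign (x u)))) / 2 := by
  rw [cubeAvg_eq_update v]
  simp_rw [mlEval_restr]

/-- The probability that the polynomial is nonzero at a random point of the discrete cube. -/
noncomputable def nzProb (c : Finset V → ℝ) : ℝ :=
  cubeAvg fun x => if (mlEval c fun v => bitSign (x v)) ≠ 0 then 1 else 0

theorem nzProb_nonneg (c : Finset V → ℝ) : 0 ≤ nzProb c := by
  refine div_nonneg (Finset.sum_nonneg fun x _ => ?_) (by positivity)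
  split_ifs <;> norm_num

theorem nzProb_restr (v : V) (c : Finset V → ℝ) :
    nzProb c = (nzProb (restr v true c) + nzProb (restr v false c)) / 2 :=
  cubeAvg_restr (fun t => if t ≠ 0 then 1 else 0) v c

theorem sqNorm_restr (v : V) (c : Finset V → ℝ) :
    sqNorm c = (sqNorm (restr v true c) + sqNorm (restr v false c)) / 2 := by
  simp_rw [← cubeAvg_sq_mlEval]
  exact cubeAvg_restr (fun t => t ^ 2) v c

/-- Averaging over the sign cancels the cross terms, and each monomial containing `v` loses one from
its size. -/
theorem totalInfl_restr (v : V) (c : Finset V → ℝ) :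
    (totalInfl (restr v true c) + totalInfl (restr v false c)) / 2 = totalInfl c - infl v c := by
  unfold totalInfl
  rw [infl_eq_sum, ← Finset.sum_sub_distrib, ← Finset.sum_add_distrib, Finset.sum_div,
    Finset.sum_eq_sum_insert v, Finset.sum_eq_sum_insert v (fun T =>
      (T.card : ℝ) * c T ^ 2 - if v ∈ T then c T ^ 2 else 0)]
  refine Finset.sum_congr rfl fun T _ => ?_
  by_cases h : v ∈ T
  · simp [h]
  · simp only [h, if_false, restr_of_notMem h, restr_of_mem (Finset.mem_insert_self v T),
      Finset.mem_insert_self, if_true, Finset.card_insert_of_notMem h, bitSign]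
    push_cast
    simp
    ring

/-- Some variable has influence more than a fraction `τ` of the norm. -/
def HasInfluential (τ : ℝ) (c : Finset V → ℝ) : Prop := ∃ v, sqNorm c * τ < infl v c

open Classical in
/-- The expectation of `Φ` over those leaves, of the depth `t` decision tree querying influential
variables, which still have an influential variable. -/
noncomputable def badAvg (τ : ℝ) (Φ : (Finset V → ℝ) → ℝ) : ℕ → (Finset V → ℝ) → ℝ
  | 0, c => if HasInfluential τ c then Φ c else 0
  | t + 1, c => if h : HasInfluential τ c then
      (badAvg τ Φ t (restr h.choose true c) + badAvg τ Φ t (restr h.choose false c)) / 2 else 0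

/-- Total influence is the potential: each query removes on average a fraction at least `τ / d` of
it, since it is at most `d` times the norm. At a leaf with an influential variable it dominates `τ`
times the norm. -/
theorem badAvg_sqNorm_le {τ : ℝ} {d : ℕ} (hd0 : 1 ≤ d) (hτ : 0 < τ) (hτ1 : τ ≤ 1) (t : ℕ)
    {c : Finset V → ℝ} (hd : DegLE c d) :
    badAvg τ sqNorm t c ≤ (1 - τ / d) ^ t * totalInfl c / τ := by
  have hdr : (1 : ℝ) ≤ d := by exact_mod_cast hd0
  have hx : 0 ≤ 1 - τ / d := by
    rw [sub_nonneg, div_le_one (by positivity)]; linarith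
  induction t generalizing c with
  | zero =>
    have h0 := totalInfl_nonneg c
    by_cases h : HasInfluential τ c
    · simp only [badAvg, h, if_true, pow_zero, one_mul]
      obtain ⟨v, hv⟩ := h
      rw [le_div_iff₀ hτ]
      refine hv.le.trans ?_
      rw [← sum_infl]
      exact Finset.single_le_sum (fun u _ => infl_nonneg u c) (Finset.mem_univ v)
    · simp only [badAvg, h, if_false]
      positivity
  | succ t ih =>
    have h0 := totalInfl_nonneg c
    by_cases h : HasInfluential τ c
    · simp only [badAvg, h, dite_true]
      set v := h.choose
      have hv : sqNorm c * τ < infl v c := h.choose_spec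
      have h1 := ih (hd.restr v true)
      have h2 := ih (hd.restr v false)
      have h3 := totalInfl_restr v c
      have h4 : totalInfl c * (τ / d) ≤ infl v c := by
        refine le_trans ?_ hv.le
        rw [← mul_div_assoc, div_le_iff₀ (by positivity)]
        nlinarith [totalInfl_le hd]
      have h5 : 0 ≤ (1 - τ / d) ^ t / τ := by positivity
      calc _ ≤ (1 - τ / d) ^ t / τ *
            ((totalInfl (restr v true c) + totalInfl (restr v false c)) / 2) := by
            have : ∀ z, (1 - τ / d) ^ t * z / τ = (1 - τ / d) ^ t / τ * z := fun z => by ring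
            rw [this] at h1 h2
            linarith
        _ ≤ (1 - τ / d) ^ t / τ * (totalInfl c * (1 - τ / d)) := by
            rw [h3]
            gcongr
            linarith
        _ = _ := by ring
    · simp only [badAvg, h, dite_false]
      positivity

/-- On the remaining, regular leaves, AM–GM gives `2 y ^ 2 ≤ l y ^ 4 + 1 / l`. Thus a bounded fourth
moment prevents those leaves from carrying much norm unless they have noticeable probability. -/
theorem sqNorm_le_badAvg {τ : ℝ} {l : ℝ} (hl : 0 < l) (t : ℕ) (c : Finset V → ℝ) :
    sqNorm c ≤ badAvg τ sqNorm t c +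
      (l * cubeAvg (fun x => (mlEval c fun v => bitSign (x v)) ^ 4) +
        (1 - badAvg τ (fun _ => 1) t c) / l) / 2 := by
  have hpos : ∀ c : Finset V → ℝ,
      0 ≤ cubeAvg (fun x => (mlEval c fun v => bitSign (x v)) ^ 4) := fun c =>
    div_nonneg (Finset.sum_nonneg fun x _ => by positivity) (by positivity)
  have hgood : ∀ c : Finset V → ℝ, sqNorm c ≤ 0 +
      (l * cubeAvg (fun x => (mlEval c fun v => bitSign (x v)) ^ 4) + (1 - 0) / l) / 2 := by
    intro c
    have h1 : cubeAvg (fun x => (mlEval c fun v => bitSign (x v)) ^ 2) ≤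
        cubeAvg (fun x => (l / 2) * (mlEval c fun v => bitSign (x v)) ^ 4 + 1 / l / 2) := by
      refine cubeAvg_mono fun x => ?_
      set y := mlEval c fun v => bitSign (x v)
      have : 0 ≤ (l * y ^ 2 - 1) ^ 2 / (2 * l) := by positivity
      have e : (l * y ^ 2 - 1) ^ 2 / (2 * l) = l / 2 * y ^ 4 + 1 / l / 2 - y ^ 2 := by
        field_simp; ring
      linarith
    have h2 : cubeAvg (fun x => (l / 2) * (mlEval c fun v => bitSign (x v)) ^ 4 + 1 / l / 2) =
        l / 2 * cubeAvg (fun x => (mlEval c fun v => bitSign (x v)) ^ 4) + 1 / l / 2 := by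
      unfold cubeAvg
      rw [Finset.sum_add_distrib, ← Finset.mul_sum]
      simp
      field_simp
    rw [← cubeAvg_sq_mlEval]
    linarith
  induction t generalizing c with
  | zero =>
    by_cases h : HasInfluential τ c
    · simp only [badAvg, h, if_true]
      have := hpos c
      have : 0 ≤ l * cubeAvg (fun x => (mlEval c fun v => bitSign (x v)) ^ 4) := by positivity
      simp only [sub_self, zero_div]
      linarith
    · simp only [badAvg, h, if_false]
      exact hgood c
  | succ t ih =>
    by_cases h : HasInfluential τ c
    · simp only [badAvg, h, dite_true]
      set v := h.choose
      have h1 := ih (restr v true c)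
      have h2 := ih (restr v false c)
      rw [sqNorm_restr v c, cubeAvg_restr (fun s => s ^ 4) v c]
      have : ∀ a b : ℝ, (1 - (a + b) / 2) / l = ((1 - a) / l + (1 - b) / l) / 2 := fun a b => by
        ring
      rw [this]
      linarith
    · simp only [badAvg, h, dite_false]
      exact hgood c

/-- The polynomial stays nonzero under all restrictions of at most `k` variables. -/
def Robust : ℕ → (Finset V → ℝ) → Prop
  | 0, c => c ≠ 0
  | k + 1, c => c ≠ 0 ∧ ∀ v b, Robust k (restr v b c)

theorem Robust.ne_zero {k : ℕ} {c : Finset V → ℝ} (h : Robust k c) : c ≠ 0 := by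
  cases k with
  | zero => exact h
  | succ k => exact h.1

/-- One phase of depth `t`: regular leaves contribute `η`, and at the others the process restarts
with robustness `k` left, contributing `m`. -/
theorem nzProb_ge_badAvg {τ η m : ℝ} {d k : ℕ}
    (hreg : ∀ c : Finset V → ℝ, DegLE c d → c ≠ 0 → ¬ HasInfluential τ c → η ≤ nzProb c)
    (hk : ∀ c : Finset V → ℝ, DegLE c d → Robust k c → m ≤ nzProb c) (t : ℕ)
    {c : Finset V → ℝ} (hd : DegLE c d) (hr : Robust (k + t) c) :
    η * (1 - badAvg τ (fun _ => 1) t c) + m * badAvg τ (fun _ => 1) t c ≤ nzProb c := by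
  induction t generalizing c with
  | zero =>
    by_cases h : HasInfluential τ c
    · simp only [badAvg, h, if_true]
      linarith [hk c hd hr]
    · simp only [badAvg, h, if_false]
      linarith [hreg c hd hr.ne_zero h]
  | succ t ih =>
    by_cases h : HasInfluential τ c
    · simp only [badAvg, h, dite_true]
      set v := h.choose
      have h1 := ih (hd.restr v true) (hr.2 v true)
      have h2 := ih (hd.restr v false) (hr.2 v false)
      rw [nzProb_restr v c]
      linarith
    · simp only [badAvg, h, dite_false]
      linarith [hreg c hd hr.ne_zero h]

theorem one_sub_pow_mul_le {x : ℝ} (hx0 : 0 ≤ x) (hx1 : x ≤ 1) (t : ℕ) :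
    (1 - x) ^ t * (1 + t * x) ≤ 1 := by
  have h1 := one_add_mul_le_pow (show (-2 : ℝ) ≤ x by linarith) t
  calc (1 - x) ^ t * (1 + t * x) ≤ (1 - x) ^ t * (1 + x) ^ t := by
        gcongr
    _ = (1 - x ^ 2) ^ t := by rw [← mul_pow]; ring
    _ ≤ 1 := pow_le_one₀ (by nlinarith) (by nlinarith)

theorem badAvg_one_le {τ : ℝ} {d : ℕ} (hd0 : 1 ≤ d) (hτ : 0 < τ) (hτ1 : τ ≤ 1) {t : ℕ}
    (ht : 4 * (d / τ) ^ 2 ≤ t) {c : Finset V → ℝ} (hd : DegLE c d) (hc : c ≠ 0) :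
    badAvg τ (fun _ => 1) t c ≤ 1 - 1 / (2 * 9 ^ d) := by
  have hdr : (1 : ℝ) ≤ d := by exact_mod_cast hd0
  have hN0 : 0 < sqNorm c := lt_of_le_of_ne (sqNorm_nonneg c) fun h => hc (sqNorm_eq_zero h.symm)
  have hx1 : τ / d ≤ 1 := by rw [div_le_one (by positivity)]; linarith
  have hb : badAvg τ sqNorm t c ≤ sqNorm c / 4 := by
    refine (badAvg_sqNorm_le hd0 hτ hτ1 t hd).trans ?_
    have h1 := one_sub_pow_mul_le (x := τ / d) (by positivity) hx1 t
    have h2 : 4 * (d / τ) ≤ 1 + t * (τ / d) := by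
      have : 4 * (d / τ) = 4 * (d / τ) ^ 2 * (τ / d) := by field_simp
      rw [this]
      have : 4 * (d / τ) ^ 2 * (τ / d) ≤ t * (τ / d) := by gcongr
      linarith
    have h3 : (0 : ℝ) ≤ (1 - τ / d) ^ t := pow_nonneg (by linarith) _
    have h4 : (1 - τ / d) ^ t * (4 * (d / τ)) ≤ 1 := (by gcongr : _ ≤ _).trans h1
    calc (1 - τ / d) ^ t * totalInfl c / τ ≤ (1 - τ / d) ^ t * (d * sqNorm c) / τ := by
          gcongr; exact totalInfl_le hd
      _ = (1 - τ / d) ^ t * (4 * (d / τ)) * (sqNorm c / 4) := by ring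
      _ ≤ 1 * (sqNorm c / 4) := by gcongr
      _ = _ := one_mul _
  -- This weight makes Bonami's bound on the fourth-moment term equal to `sqNorm c`.
  have hl : 0 < 1 / (9 ^ d * sqNorm c) := by positivity
  have h1 := sqNorm_le_badAvg (τ := τ) hl t c
  have h2 : 1 / (9 ^ d * sqNorm c) * cubeAvg (fun x => (mlEval c fun v => bitSign (x v)) ^ 4) ≤
      sqNorm c := by
    calc _ ≤ 1 / (9 ^ d * sqNorm c) * (9 ^ d * sqNorm c ^ 2) := by
          gcongr; exact cubeAvg_pow_four_mlEval_le hd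
      _ = sqNorm c := by field_simp
  set b := badAvg τ (fun _ => 1) t c
  have h3 : sqNorm c / 2 ≤ (1 - b) * (9 ^ d * sqNorm c) := by
    have : (1 - b) / (1 / (9 ^ d * sqNorm c)) = (1 - b) * (9 ^ d * sqNorm c) := by
      rw [div_div_eq_mul_div, div_one]
    rw [this] at h1
    linarith
  have h4 : 1 / 2 ≤ (1 - b) * 9 ^ d := by
    by_contra hcon
    push Not at hcon
    nlinarith
  have : 1 / (2 * 9 ^ d : ℝ) ≤ 1 - b := by
    rw [div_le_iff₀ (by positivity)]; linarith
  linarith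

/-- The robustness needed in `nzProb_ge_of_robust`. -/
def robustDepth (d : ℕ) : ℕ := 2 * 9 ^ d * (4 * d ^ 2 * (2 ^ 10 * d) ^ (14 * d))

theorem nzProb_ge_of_robust {d : ℕ} (hd0 : 1 ≤ d) {c : Finset V → ℝ} (hd : DegLE c d)
    (hr : Robust (robustDepth d) c) : 1 / (2 ^ 20 * d ^ 2 : ℝ) ≤ nzProb c := by
  have hdr : (1 : ℝ) ≤ d := by exact_mod_cast hd0
  have hY : 1 ≤ scaleY d := one_le_pow₀ (by linarith)
  set τ : ℝ := 1 / scaleY d ^ 7 with hτdef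
  have hτ : 0 < τ := by positivity
  have hτ1 : τ ≤ 1 := by
    rw [hτdef, div_le_one (by positivity)]; exact one_le_pow₀ hY
  set t : ℕ := 4 * d ^ 2 * (2 ^ 10 * d) ^ (14 * d) with htdef
  have ht : 4 * (d / τ) ^ 2 ≤ (t : ℝ) := by
    rw [htdef, hτdef, div_div_eq_mul_div, div_one]
    unfold scaleY
    push_cast
    rw [mul_pow, ← pow_mul, ← pow_mul, ← mul_assoc 4, mul_comm d (7 * 2)]
    norm_num
  set η : ℝ := 1 / (2 ^ 19 * d ^ 2) with hη
  have hη0 : 0 < η := by positivity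
  set β : ℝ := 1 / (2 * 9 ^ d) with hβ
  have hβ0 : 0 ≤ β := by positivity
  have hβ1 : β ≤ 1 := by
    rw [hβ, div_le_one (by positivity)]
    have : (1 : ℝ) ≤ 9 ^ d := one_le_pow₀ (by norm_num)
    linarith
  have hreg : ∀ c : Finset V → ℝ, DegLE c d → c ≠ 0 → ¬ HasInfluential τ c → η ≤ nzProb c := by
    intro c hd hc h
    refine cubeAvg_ne_zero_ge_of_regular hd0 hd hc fun v => ?_
    unfold HasInfluential at h
    push Not at h
    have := h v
    rw [hτdef, mul_one_div] at this
    exact this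
  -- After `s` phases the chance of having met no regular leaf is at most `(1 - β) ^ s`; with `s = 2
  -- * 9 ^ d = 1 / β` this is at most `1 / 2`.
  have key : ∀ s : ℕ, ∀ c : Finset V → ℝ, DegLE c d → Robust (s * t) c →
      η * (1 - (1 - β) ^ s) ≤ nzProb c := by
    intro s
    induction s with
    | zero =>
      intro c _ _
      simpa using nzProb_nonneg c
    | succ s ih =>
      intro c hd hr
      rw [Nat.succ_mul] at hr
      have h1 := nzProb_ge_badAvg hreg ih t hd hr
      have h2 := badAvg_one_le hd0 hτ hτ1 ht hd hr.ne_zero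
      have h3 : 0 ≤ (1 - β) ^ s := pow_nonneg (by linarith) _
      set b := badAvg τ (fun _ => 1) t c
      have h4 : η * (1 - β) ^ s * b ≤ η * (1 - β) ^ s * (1 - β) := by gcongr
      rw [pow_succ]
      nlinarith
  have h1 := key (2 * 9 ^ d) c hd hr
  have h2 := one_sub_pow_mul_le hβ0 hβ1 (2 * 9 ^ d)
  have h3 : ((2 * 9 ^ d : ℕ) : ℝ) * β = 1 := by rw [hβ]; push_cast; field_simp
  rw [h3] at h2
  refine le_trans ?_ h1
  have : 1 / (2 ^ 20 * d ^ 2 : ℝ) = η * (1 / 2) := by rw [hη]; field_simp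
  rw [this]
  gcongr
  linarith

/-- Fixing one variable destroys at most one of the disjoint top-degree monomials. The coefficients
of the others do not change, as nothing of higher degree can collapse onto them. -/
theorem robust_of_disjoint {j : ℕ} (N : ℕ) {c : Finset V → ℝ} (hd : DegLE c j)
    (M : Finset (Finset V)) (hM : (M : Set (Finset V)).PairwiseDisjoint id)
    (hcard : ∀ T ∈ M, T.card = j) (hne : ∀ T ∈ M, c T ≠ 0) (hN : N < M.card) : Robust N c := by
  have hc : c ≠ 0 := by
    obtain ⟨T, hT⟩ := Finset.card_pos.1 (by omega : 0 < M.card)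
    intro h
    exact hne T hT (by simp [h])
  induction N generalizing c M with
  | zero => exact hc
  | succ N ih =>
    refine ⟨hc, fun v b => ?_⟩
    set M' := M.filter (v ∉ ·) with hM'
    have hcard' : N < M'.card := by
      have h1 : (M.filter (v ∈ ·)).card ≤ 1 := by
        rw [Finset.card_le_one]
        intro S hS T hT
        rw [Finset.mem_filter] at hS hT
        by_contra hST
        exact Finset.disjoint_left.1 (hM hS.1 hT.1 hST) hS.2 hT.2
      have h2 := Finset.card_filter_add_card_filter_not (s := M) (v ∈ ·)
      rw [hM']
      omega
    have hne' : ∀ T ∈ M', restr v b c T ≠ 0 := by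
      intro T hT
      rw [hM', Finset.mem_filter] at hT
      rw [restr_of_notMem hT.2, hd (insert v T)
        (by rw [Finset.card_insert_of_notMem hT.2, hcard T hT.1]; omega)]
      simpa using hne T hT.1
    refine ih (hd.restr v b) M' (hM.subset fun T hT => (Finset.mem_filter.1 hT).1) (fun T hT => hcard T ?_) hne' hcard' ?_
    · exact (Finset.mem_filter.1 hT).1
    · obtain ⟨T, hT⟩ := Finset.card_pos.1 (by omega : 0 < M'.card)
      intro h
      exact hne' T hT (by simp [h])

end Tree

/-! ### Weights that are hard for OR -/

section HardMeasure
variable {V : Type*} [DecidableEq V] [Fintype V]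

/-- The value at the indicator of `S` of the multilinear polynomial with coefficients `c`. -/
def evalSet (c : Finset V → ℝ) (S : Finset V) : ℝ := ∑ T ∈ S.powerset, c T

/-- The coefficients, in `±1` variables, of the restriction to subsets of `R` of the multilinear
polynomial with coefficients `c` in `0`-`1` variables. -/
noncomputable def signCoef (R : Finset V) (c : Finset V → ℝ) (T : Finset V) : ℝ :=
  ∑ U ∈ R.powerset, if T ⊆ U then c U * (1 / 2) ^ U.card else 0

/-- Substituting `(1 + s) / 2` for each bit: a monomial on `U` becomes `2 ^ (-|U|)` times the sum of
all sign monomials on subsets of `U`. -/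
theorem mlEval_signCoef (R : Finset V) (c : Finset V → ℝ) (x : V → Bool) :
    (mlEval (signCoef R c) fun v => bitSign (x v)) = evalSet c {v ∈ R | x v = true} := by
  unfold mlEval signCoef evalSet
  simp_rw [smul_eq_mul, Finset.sum_mul]
  rw [Finset.sum_comm]
  have h1 : ∀ U : Finset V, (∑ T, (if T ⊆ U then c U * (1 / 2) ^ U.card else 0) *
      ∏ v ∈ T, bitSign (x v)) = if ∀ v ∈ U, x v = true then c U else 0 := by
    intro U
    have h2 : (∑ T, (if T ⊆ U then c U * (1 / 2) ^ U.card else 0) * ∏ v ∈ T, bitSign (x v)) =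
        c U * ((1 / 2) ^ U.card * ∑ T ∈ U.powerset, ∏ v ∈ T, bitSign (x v)) := by
      rw [← mul_assoc, Finset.mul_sum]
      simp_rw [ite_mul, zero_mul, ← Finset.mem_powerset]
      rw [Finset.sum_ite_mem, Finset.univ_inter]
    rw [h2, ← Finset.prod_one_add, ← Finset.prod_const, ← Finset.prod_mul_distrib]
    split_ifs with h
    · rw [Finset.prod_eq_one, mul_one]
      intro v hv
      rw [h v hv]
      norm_num [bitSign]
    · push Not at h
      obtain ⟨v, hv, hxv⟩ := h
      rw [Finset.prod_eq_zero hv, mul_zero]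
      simp only [ne_eq, Bool.not_eq_true] at hxv
      rw [hxv]
      simp [bitSign]
  simp_rw [h1]
  rw [← Finset.sum_filter]
  refine Finset.sum_congr ?_ fun _ _ => rfl
  ext U
  simp only [Finset.mem_filter, Finset.mem_powerset, Finset.subset_iff]
  exact ⟨fun h v hv => ⟨h.1 hv, h.2 v hv⟩, fun h => ⟨fun v hv => (h hv).1, fun v hv => (h hv).2⟩⟩

/-- On the subsets of `R` the polynomial has degree at most `j`. -/
def DegLEOn (R : Finset V) (c : Finset V → ℝ) (j : ℕ) : Prop :=
  ∀ T ⊆ R, j < T.card → c T = 0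

theorem DegLEOn.signCoef {R : Finset V} {c : Finset V → ℝ} {j : ℕ} (h : DegLEOn R c j) :
    DegLE (signCoef R c) j := by
  intro T hT
  refine Finset.sum_eq_zero fun U hU => ?_
  split_ifs with hTU
  · rw [h U (Finset.mem_powerset.1 hU) (hT.trans_le (Finset.card_le_card hTU)), zero_mul]
  · rfl

theorem DegLEOn.signCoef_of_card {R : Finset V} {c : Finset V → ℝ} {j : ℕ} (h : DegLEOn R c j)
    {T : Finset V} (hTR : T ⊆ R) (hT : T.card = j) : _root_.signCoef R c T = c T * (1 / 2) ^ j := by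
  unfold _root_.signCoef
  rw [Finset.sum_eq_single T]
  · simp [hT]
  · intro U hU hne
    split_ifs with hTU
    · have : T.card < U.card := Finset.card_lt_card (hTU.ssubset_of_ne hne.symm)
      rw [h U (Finset.mem_powerset.1 hU) (by omega), zero_mul]
    · rfl
  · intro hT
    exact absurd (Finset.mem_powerset.2 hTR) hT

/-- The value of the OR function at the indicator of `S`. -/
def orVal (S : Finset V) : ℝ := if S = ∅ then 0 else 1

/-- The mass, for the weights `w`, of the points where the polynomial differs from OR. -/
noncomputable def orErr (w : Finset V → ℝ) (c : Finset V → ℝ) : ℝ :=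
  ∑ S, if evalSet c S ≠ orVal S then w S else 0

theorem orErr_nonneg {w : Finset V → ℝ} (hw : ∀ S, 0 ≤ w S) (c : Finset V → ℝ) :
    0 ≤ orErr w c :=
  Finset.sum_nonneg fun S _ => by
    split_ifs
    · exact hw S
    · exact le_rfl

theorem orErr_add (w w' : Finset V → ℝ) (c : Finset V → ℝ) :
    orErr (w + w') c = orErr w c + orErr w' c := by
  unfold orErr
  rw [← Finset.sum_add_distrib]
  refine Finset.sum_congr rfl fun S _ => ?_
  split_ifs <;> simp

theorem orErr_smul_sum {ι : Type*} [Fintype ι] (r : ℝ) (w : ι → Finset V → ℝ)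
    (c : Finset V → ℝ) : orErr (r • ∑ i, w i) c = r * ∑ i, orErr (w i) c := by
  unfold orErr
  rw [Finset.sum_comm, Finset.mul_sum]
  refine Finset.sum_congr rfl fun S _ => ?_
  split_ifs <;> simp

/-- The uniform weights on the subsets of `R`. -/
noncomputable def unifWeight (R S : Finset V) : ℝ :=
  cubeAvg fun x : V → Bool => if {v ∈ R | x v = true} = S then 1 else 0

theorem unifWeight_nonneg (R S : Finset V) : 0 ≤ unifWeight R S := by
  refine div_nonneg (Finset.sum_nonneg fun x _ => ?_) (by positivity)
  split_ifs <;> norm_num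

theorem sum_unifWeight (R : Finset V) (g : Finset V → ℝ) :
    ∑ S, unifWeight R S * g S = cubeAvg fun x : V → Bool => g {v ∈ R | x v = true} := by
  unfold unifWeight cubeAvg
  simp_rw [div_mul_eq_mul_div, Finset.sum_mul]
  rw [← Finset.sum_div, Finset.sum_comm]
  congr 1
  refine Finset.sum_congr rfl fun x _ => ?_
  simp

theorem sum_unifWeight_eq_one (R : Finset V) : ∑ S, unifWeight R S = 1 := by
  have := sum_unifWeight R fun _ => 1
  simp only [mul_one] at this
  rw [this]
  simp [cubeAvg]

theorem unifWeight_empty (R : Finset V) : unifWeight R ∅ = (1 / 2) ^ R.card := by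
  unfold unifWeight
  induction R using Finset.induction_on with
  | empty => simp [cubeAvg]
  | insert v R hv ih =>
    rw [cubeAvg_eq_update v]
    have h1 : ∀ x : V → Bool,
        {u ∈ insert v R | Function.update x v true u = true} ≠ (∅ : Finset V) := by
      intro x h
      have : v ∈ ({u ∈ insert v R | Function.update x v true u = true} : Finset V) := by simp
      simp [h] at this
    have h2 : ∀ x : V → Bool,
        ({u ∈ insert v R | Function.update x v false u = true} : Finset V) =
          {u ∈ R | x u = true} := by
      intro x
      ext u
      by_cases hu : u = v
      · subst hu; simp [hv]
      · simp [hu]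
    simp_rw [h2, h1, ih]
    rw [Finset.card_insert_of_notMem hv, pow_succ]
    simp [cubeAvg, div_eq_mul_inv]

theorem nzProb_signCoef (R : Finset V) (c : Finset V → ℝ) :
    nzProb (signCoef R c) = ∑ S, unifWeight R S * if evalSet c S ≠ 0 then 1 else 0 := by
  rw [sum_unifWeight]
  unfold nzProb
  simp_rw [mlEval_signCoef]

theorem evalSet_sub_single (c : Finset V → ℝ) (S : Finset V) :
    evalSet (c - Pi.single ∅ 1) S = evalSet c S - 1 := by
  unfold evalSet
  simp only [Pi.sub_apply, Finset.sum_sub_distrib]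
  congr 1
  rw [Finset.sum_pi_single']
  simp

/-- Off the origin OR is `1`, so errors are exactly the nonzeros of `c - 1`; the origin costs its
own mass `2 ^ (-|R|)`. -/
theorem le_orErr_unifWeight (R : Finset V) (c : Finset V → ℝ) :
    nzProb (signCoef R (c - Pi.single ∅ 1)) - (1 / 2) ^ R.card ≤ orErr (unifWeight R) c := by
  rw [nzProb_signCoef, ← unifWeight_empty]
  have h1 : unifWeight R ∅ = ∑ S, unifWeight R S * if S = ∅ then 1 else 0 := by simp
  rw [h1, ← Finset.sum_sub_distrib]
  unfold orErr
  refine Finset.sum_le_sum fun S _ => ?_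
  have h0 := unifWeight_nonneg R S
  rw [evalSet_sub_single]
  by_cases hS : S = ∅
  · simp only [hS, if_true]
    subst hS
    split_ifs <;> linarith
  · simp only [hS, if_false, orVal, mul_zero, sub_zero, ne_eq, sub_eq_zero]
    split_ifs <;> simp

theorem exists_disjoint_blocks {k m : ℕ} {R : Finset V} (h : k * m ≤ R.card) :
    ∃ B : Fin k → Finset V, (∀ i, B i ⊆ R) ∧ (∀ i, (B i).card = m) ∧
      Pairwise fun i i' => Disjoint (B i) (B i') := by
  obtain ⟨e⟩ := Function.Embedding.nonempty_of_card_le (α := Fin k × Fin m) (β := R) (by simpa)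
  let f : Fin k → Fin m ↪ V := fun i =>
    ⟨fun a => e (i, a), fun a b hab => by simpa using e.injective (Subtype.ext hab)⟩
  refine ⟨fun i => Finset.univ.map (f i), fun i => ?_, fun i => by simp, fun i i' hii => ?_⟩
  · intro v hv
    obtain ⟨a, _, rfl⟩ := Finset.mem_map.1 hv
    exact (e (i, a)).2
  · refine Finset.disjoint_left.2 fun v hv hv' => ?_
    obtain ⟨a, _, rfl⟩ := Finset.mem_map.1 hv
    obtain ⟨b, _, hb⟩ := Finset.mem_map.1 hv'
    have := e.injective (Subtype.ext hb)
    simp only [Prod.mk.injEq] at this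
    exact hii this.1.symm

/-- The union of a maximal disjoint subfamily meets every member. -/
theorem exists_hitting_set {A : Finset (Finset V)} {j N : ℕ} (hcard : ∀ T ∈ A, T.card = j)
    (hj : 0 < j)
    (h : ∀ M ⊆ A, (M : Set (Finset V)).PairwiseDisjoint id → M.card ≤ N) :
    ∃ H : Finset V, H.card ≤ j * N ∧ ∀ T ∈ A, ¬ Disjoint T H := by
  classical
  obtain ⟨M, hM, hmax⟩ := Finset.exists_max_image
    (A.powerset.filter fun M : Finset (Finset V) => (M : Set (Finset V)).PairwiseDisjoint id) Finset.card
    ⟨∅, by simp⟩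
  rw [Finset.mem_filter, Finset.mem_powerset] at hM
  refine ⟨M.biUnion id, ?_, fun T hT hdis => ?_⟩
  · calc (M.biUnion id).card ≤ M.card * j :=
          Finset.card_biUnion_le_card_mul _ _ _ fun T hT => (hcard T (hM.1 hT)).le
      _ ≤ N * j := Nat.mul_le_mul_right _ (h M hM.1 hM.2)
      _ = j * N := mul_comm _ _
  · have hne : T.Nonempty := Finset.card_pos.1 (by rw [hcard T hT]; exact hj)
    have hTM : ∀ S ∈ M, Disjoint T S := fun S hS =>
      hdis.mono_right (Finset.subset_biUnion_of_mem id hS)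
    have hTM' : T ∉ M := fun hT' => hne.ne_empty (Finset.disjoint_self_iff_empty T |>.1 (hTM T hT'))
    have := hmax (insert T M) (by
      rw [Finset.mem_filter, Finset.mem_powerset]
      refine ⟨Finset.insert_subset hT hM.1, ?_⟩
      rw [Finset.coe_insert]
      exact hM.2.insert fun S hS _ => hTM S hS)
    rw [Finset.card_insert_of_notMem hTM'] at this
    omega

theorem card_filter_not_disjoint_le {k : ℕ} (B : Fin k → Finset V)
    (hB : Pairwise fun i i' => Disjoint (B i) (B i')) (H : Finset V) :
    (Finset.univ.filter fun i => ¬ Disjoint (B i) H).card ≤ H.card := by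
  classical
  have h1 : ∀ i ∈ Finset.univ.filter fun i => ¬ Disjoint (B i) H, 1 ≤ (B i ∩ H).card := by
    intro i hi
    rw [Finset.mem_filter, Finset.disjoint_iff_inter_eq_empty, ← Finset.card_eq_zero] at hi
    omega
  calc _ ≤ ∑ i ∈ Finset.univ.filter fun i => ¬ Disjoint (B i) H, (B i ∩ H).card := by
        rw [Finset.card_eq_sum_ones]
        exact Finset.sum_le_sum h1
    _ = ((Finset.univ.filter fun i => ¬ Disjoint (B i) H).biUnion fun i => B i ∩ H).card :=
        (Finset.card_biUnion fun i _ i' _ hii =>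
          (hB hii).mono Finset.inter_subset_left Finset.inter_subset_left).symm
    _ ≤ H.card := Finset.card_le_card
        (Finset.biUnion_subset.2 fun i _ => Finset.inter_subset_right)

/-- If the polynomial with coefficients `c - 1` is not robust on `R`, then it has smaller degree on
most of many disjoint blocks. -/
theorem exists_hitting_set_of_not_robust {R : Finset V} {c : Finset V → ℝ} {j N : ℕ}
    (hc : DegLEOn R c (j + 1)) (h : ¬ Robust N (signCoef R (c - Pi.single ∅ 1))) :
    ∃ H : Finset V, H.card ≤ (j + 1) * N ∧ ∀ B ⊆ R, Disjoint B H → DegLEOn B c j := by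
  classical
  have hne : ∀ T : Finset V, 0 < T.card → (c - Pi.single ∅ 1 : Finset V → ℝ) T = c T := by
    intro T hT
    have : T ≠ ∅ := by rintro rfl; simp at hT
    simp [this]
  have hc' : DegLEOn R (c - Pi.single ∅ 1) (j + 1) := fun T hTR hT => by
    rw [hne T (by omega), hc T hTR hT]
  obtain ⟨H, hH, hhit⟩ := exists_hitting_set
    (A := R.powerset.filter fun T => T.card = j + 1 ∧ c T ≠ 0) (j := j + 1) (N := N)
    (fun T hT => (Finset.mem_filter.1 hT).2.1) (by omega) (by
      intro M hM hdis
      by_contra hcon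
      push Not at hcon
      refine h (robust_of_disjoint N hc'.signCoef M hdis
        (fun T hT => (Finset.mem_filter.1 (hM hT)).2.1) (fun T hT => ?_) hcon)
      have hT' := Finset.mem_filter.1 (hM hT)
      rw [hc'.signCoef_of_card (Finset.mem_powerset.1 hT'.1) hT'.2.1, hne T (by omega)]
      exact mul_ne_zero hT'.2.2 (by positivity))
  refine ⟨H, hH, fun B hB hdis T hTB hT => ?_⟩
  by_cases hT' : j + 1 < T.card
  · exact hc T (hTB.trans hB) hT'
  · by_contra hcT
    refine hhit T (Finset.mem_filter.2 ⟨Finset.mem_powerset.2 (hTB.trans hB), by omega, hcT⟩) ?_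
    exact hdis.mono_left hTB

/-- There are weights for which no polynomial of low degree approximates OR well. -/
theorem exists_hard_weights {d K : ℕ} (hd0 : 1 ≤ d) (hK : 2 * d ^ 2 * robustDepth d ≤ K)
    (hK' : (1 / 2) ^ K ≤ 1 / (2 ^ 21 * d ^ 2 : ℝ)) {j : ℕ} (hj : j ≤ d) {R : Finset V}
    (hR : K ^ j ≤ R.card) :
    ∃ w : Finset V → ℝ, (∀ S, 0 ≤ w S) ∧ ∑ S, w S ≤ j + 2 ∧
      ∀ c : Finset V → ℝ, DegLEOn R c j →
        1 / (2 ^ 21 * d ^ 2 : ℝ) * (1 - j / (2 * d)) ≤ orErr w c := by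
  have hdr : (1 : ℝ) ≤ d := by exact_mod_cast hd0
  have hK1 : 0 < K := by
    refine lt_of_lt_of_le ?_ hK
    unfold robustDepth
    positivity
  have hKr : (0 : ℝ) < K := by exact_mod_cast hK1
  induction j generalizing R with
  | zero =>
    obtain ⟨v, hv⟩ := Finset.card_pos.1 (by simpa using hR : 0 < R.card)
    -- On subsets of `R` a degree-zero polynomial is constant, so it errs at the origin or at `{v}`.
    refine ⟨Pi.single ∅ 1 + Pi.single {v} 1, fun S => ?_, ?_, fun c hc => ?_⟩
    · refine add_nonneg ?_ ?_ <;> (rw [Pi.single_apply]; split_ifs <;> norm_num)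
    · simp only [Pi.add_apply, Finset.sum_add_distrib, Finset.sum_pi_single', Finset.mem_univ,
        if_true]
      norm_num
    · have h1 : ∀ S : Finset V, orErr (Pi.single S 1) c =
          if evalSet c S ≠ orVal S then 1 else 0 := by
        intro S
        unfold orErr
        rw [Finset.sum_eq_single S]
        · simp
        · intro T _ hT
          simp [hT]
        · simp
      have h2 : evalSet c {v} = evalSet c ∅ := by
        have : c {v} = 0 := hc {v} (by simpa) (by simp)
        unfold evalSet
        rw [← insert_empty_eq, Finset.sum_powerset_insert (Finset.notMem_empty v)]
        simp [this]
      rw [orErr_add, h1, h1, h2]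
      have h3 : (1 : ℝ) ≤ (if evalSet c ∅ ≠ orVal (∅ : Finset V) then 1 else 0) +
          if evalSet c ∅ ≠ orVal ({v} : Finset V) then 1 else 0 := by
        by_cases h : evalSet c ∅ = 0
        · simp [h, orVal]
        · simp only [orVal, if_true, ne_eq, h, not_false_eq_true]
          split_ifs <;> norm_num
      refine le_trans ?_ h3
      simp only [Nat.cast_zero, zero_div, sub_zero, mul_one]
      rw [div_le_one (by positivity)]
      nlinarith
  | succ j ih =>
    rw [pow_succ, mul_comm] at hR
    obtain ⟨B, hBR, hBcard, hBdis⟩ := exists_disjoint_blocks hR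
    have ih' := fun i => ih (by omega) (hBcard i).ge
    choose w hw0 hw1 hw2 using ih'
    -- The uniform part deals with robust `c - 1`; the average over blocks deals with the case where
    -- the degree drops. Each level adds total mass one.
    refine ⟨unifWeight R + (1 / K : ℝ) • ∑ i, w i, fun S => ?_, ?_, fun c hc => ?_⟩
    · simp only [Pi.add_apply, Pi.smul_apply, Finset.sum_apply, smul_eq_mul]
      have := unifWeight_nonneg R S
      have : 0 ≤ ∑ i, w i S := Finset.sum_nonneg fun i _ => hw0 i S
      positivity
    · simp only [Pi.add_apply, Pi.smul_apply, Finset.sum_apply, smul_eq_mul,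
        Finset.sum_add_distrib, sum_unifWeight_eq_one]
      rw [← Finset.mul_sum, Finset.sum_comm]
      have : ∑ i : Fin K, ∑ S, w i S ≤ ∑ i : Fin K, (j + 2 : ℝ) :=
        Finset.sum_le_sum fun i _ => hw1 i
      rw [Finset.sum_const, Finset.card_univ, Fintype.card_fin, nsmul_eq_mul] at this
      have h2 : (1 / K : ℝ) * ∑ i : Fin K, ∑ S, w i S ≤ 1 / K * (K * (j + 2)) := by gcongr
      rw [← mul_assoc, one_div_mul_cancel hKr.ne', one_mul] at h2
      push_cast
      linarith
    · rw [orErr_add, orErr_smul_sum]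
      have hu0 := orErr_nonneg (unifWeight_nonneg R) c
      have hb0 : 0 ≤ ∑ i, orErr (w i) c := Finset.sum_nonneg fun i _ => orErr_nonneg (hw0 i) c
      have hjd : ((j + 1 : ℕ) : ℝ) ≤ d := by exact_mod_cast hj
      set κ : ℝ := 1 / (2 ^ 21 * d ^ 2) with hκ
      have hκ0 : 0 < κ := by positivity
      have hfrac : ((j + 1 : ℕ) : ℝ) / (2 * d) ≤ 1 := by
        rw [div_le_one (by positivity)]; linarith
      by_cases hrob : Robust (robustDepth d) (signCoef R (c - Pi.single ∅ 1))
      · have hdeg : DegLE (signCoef R (c - Pi.single ∅ 1)) d := by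
          refine DegLE.mono (DegLEOn.signCoef (j := j + 1) fun T hTR hT => ?_) hj
          have : T ≠ ∅ := by rintro rfl; simp at hT
          simp [this, hc T hTR hT]
        have h1 := nzProb_ge_of_robust hd0 hdeg hrob
        have h2 := le_orErr_unifWeight R c
        have h3 : (1 / 2 : ℝ) ^ R.card ≤ κ := by
          refine le_trans (pow_le_pow_of_le_one (by norm_num) (by norm_num) ?_) hK'
          exact le_trans (Nat.le_mul_of_pos_right K (by positivity)) hR
        have h4 : 1 / (2 ^ 20 * d ^ 2 : ℝ) = 2 * κ := by rw [hκ]; field_simp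
        have h5 : κ * (1 - ((j + 1 : ℕ) : ℝ) / (2 * d)) ≤ κ := by
          have : 0 ≤ ((j + 1 : ℕ) : ℝ) / (2 * d) := by positivity
          nlinarith
        have h6 : 0 ≤ 1 / (K : ℝ) * ∑ i, orErr (w i) c := by positivity
        linarith
      · obtain ⟨H, hH, hHdeg⟩ := exists_hitting_set_of_not_robust hc hrob
        set G := Finset.univ.filter fun i => Disjoint (B i) H
        -- Each point of `H` lies in at most one block, so at most `d * robustDepth d ≤ K / (2 d)`
        -- blocks are lost; this is the loss of `1 / (2 d)` per level.
        have hG : (K : ℝ) * (1 - 1 / (2 * d)) ≤ G.card := by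
          have h1 := card_filter_not_disjoint_le B hBdis H
          have h2 := Finset.card_filter_add_card_filter_not (s := (Finset.univ : Finset (Fin K)))
            (fun i => Disjoint (B i) H)
          rw [Finset.card_univ, Fintype.card_fin] at h2
          have h3 : (j + 1) * robustDepth d ≤ d * robustDepth d := Nat.mul_le_mul_right _ hj
          have h4 : K ≤ G.card + d * robustDepth d := by linarith
          have h5 : (K : ℝ) ≤ G.card + d * robustDepth d := by exact_mod_cast h4
          have h6 : 2 * (d : ℝ) ^ 2 * robustDepth d ≤ K := by exact_mod_cast hK
          have h7 : (d : ℝ) * robustDepth d ≤ K * (1 / (2 * d)) := by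
            rw [mul_one_div, le_div_iff₀ (by positivity)]
            linarith
          linarith
        have h1 : ∑ i ∈ G, κ * (1 - j / (2 * d)) ≤ ∑ i, orErr (w i) c := by
          refine (Finset.sum_le_sum fun i hi => hw2 i c ?_).trans
            (Finset.sum_le_sum_of_subset_of_nonneg (Finset.subset_univ G) fun i _ _ =>
              orErr_nonneg (hw0 i) c)
          exact hHdeg (B i) (hBR i) (Finset.mem_filter.1 hi).2
        rw [Finset.sum_const, nsmul_eq_mul] at h1
        have hj0 : (0 : ℝ) ≤ j / (2 * d) := by positivity
        have hj1 : (0 : ℝ) ≤ 1 - j / (2 * d) := by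
          rw [Nat.cast_succ, add_div] at hfrac
          have : (0 : ℝ) ≤ 1 / (2 * d) := by positivity
          linarith
        have h2 : κ * (1 - ((j + 1 : ℕ) : ℝ) / (2 * d)) ≤ 1 / K * ∑ i, orErr (w i) c := by
          rw [one_div, inv_mul_eq_div, le_div_iff₀ hKr]
          calc κ * (1 - ((j + 1 : ℕ) : ℝ) / (2 * d)) * K
              ≤ (κ * (1 - j / (2 * d))) * (1 - 1 / (2 * d)) * K := by
                rw [mul_assoc κ (1 - (j : ℝ) / (2 * d))]
                gcongr
                rw [Nat.cast_succ, add_div]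
                have : (0 : ℝ) ≤ 1 / (2 * d) := by positivity
                nlinarith
            _ = (K * (1 - 1 / (2 * d))) * (κ * (1 - j / (2 * d))) := by ring
            _ ≤ G.card * (κ * (1 - j / (2 * d))) := by gcongr
            _ ≤ _ := h1
        linarith

end HardMeasure

/-! ### The majority polynomial -/

section Majority
variable {A : Type*} [CommRing A] {t : ℕ}

/-- A polynomial expression in `t` quantities, computing the majority of bits. -/
def majPoly (p : Fin t → A) : A :=
  ∑ U : Finset (Fin t), if t < 2 * U.card then (∏ i ∈ U, p i) * ∏ i ∈ Uᶜ, (1 - p i) else 0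

/-- Expand `1 = ∏ (p i + (1 - p i))`: terms not containing `G` vanish, and all others appear in
`majPoly`. The values outside `G` need not be bits, which matters as an erring polynomial may take
any real value. -/
theorem majPoly_eq_one {p : Fin t → A} {G : Finset (Fin t)} (hG : t < 2 * G.card)
    (h : ∀ i ∈ G, p i = 1) : majPoly p = 1 := by
  have h1 : ∏ i, (p i + (1 - p i)) = 1 := by simp
  rw [Finset.prod_add, Finset.powerset_univ] at h1
  rw [← h1]
  refine Finset.sum_congr rfl fun U _ => ?_
  rw [Finset.compl_eq_univ_sdiff]
  by_cases hU : G ⊆ U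
  · rw [if_pos (hG.trans_le (Nat.mul_le_mul_left 2 (Finset.card_le_card hU)))]
  · obtain ⟨i, hi, hiU⟩ := Finset.not_subset.1 hU
    have : ∏ i ∈ Finset.univ \ U, (1 - p i) = 0 :=
      Finset.prod_eq_zero (i := i) (by simpa using hiU) (by rw [h i hi, sub_self])
    simp [this]

theorem majPoly_eq_zero {p : Fin t → A} {G : Finset (Fin t)} (hG : t < 2 * G.card)
    (h : ∀ i ∈ G, p i = 0) : majPoly p = 0 := by
  refine Finset.sum_eq_zero fun U _ => ?_
  split_ifs with hU
  · have : ¬ Disjoint G U := by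
      intro hdis
      have := Finset.card_union_of_disjoint hdis
      have h2 := Finset.card_le_univ (G ∪ U)
      rw [Fintype.card_fin] at h2
      omega
    obtain ⟨i, hi, hiU⟩ := Finset.not_disjoint_iff.1 this
    rw [Finset.prod_eq_zero hiU (h i hi), zero_mul]
  · rfl

theorem map_majPoly {B : Type*} [CommRing B] (f : A →+* B) (p : Fin t → A) :
    f (majPoly p) = majPoly fun i => f (p i) := by
  unfold majPoly
  rw [map_sum]
  refine Finset.sum_congr rfl fun U _ => ?_
  split_ifs <;> simp

theorem totalDegree_majPoly_le {X : Type*} {p : Fin t → MvPolynomial X ℝ} {D : ℕ}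
    (h : ∀ i, (p i).totalDegree ≤ D) : (majPoly p).totalDegree ≤ t * D := by
  refine MvPolynomial.totalDegree_finsetSum_le fun U _ => ?_
  split_ifs
  · have h1 : (∏ i ∈ U, p i).totalDegree ≤ U.card * D :=
      (MvPolynomial.totalDegree_finsetProd _ _).trans (Finset.sum_le_card_nsmul _ _ _ fun i _ => h i)
    have h2 : (∏ i ∈ Uᶜ, (1 - p i)).totalDegree ≤ Uᶜ.card * D :=
      (MvPolynomial.totalDegree_finsetProd _ _).trans (Finset.sum_le_card_nsmul _ _ _ fun i _ =>
        (MvPolynomial.totalDegree_sub _ _).trans (by simp [h i]))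
    have h3 := Finset.card_add_card_compl U
    rw [Fintype.card_fin] at h3
    calc _ ≤ U.card * D + Uᶜ.card * D := (MvPolynomial.totalDegree_mul _ _).trans (by omega)
      _ = t * D := by rw [← add_mul, h3]
  · simp

end Majority

/-! ### Multilinear coefficients of a real polynomial -/

section Multilinearization
variable {X : Type*} [Fintype X] [DecidableEq X]

/-- The coefficients of the multilinear polynomial agreeing with `p` at the Boolean points. -/
noncomputable def mlCoef (p : MvPolynomial X ℝ) (T : Finset X) : ℝ :=
  ∑ m ∈ p.support, if m.support = T then p.coeff m else 0

theorem evalSet_mlCoef (p : MvPolynomial X ℝ) (S : Finset X) :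
    evalSet (mlCoef p) S = MvPolynomial.eval (fun x => bitVal (decide (x ∈ S))) p := by
  rw [MvPolynomial.eval_eq]
  unfold evalSet mlCoef
  rw [Finset.sum_comm]
  refine Finset.sum_congr rfl fun m _ => ?_
  rw [Finset.sum_ite_eq]
  simp only [Finset.mem_powerset]
  split_ifs with h
  · rw [Finset.prod_eq_one, mul_one]
    intro x hx
    simp [bitVal, h hx]
  · obtain ⟨x, hx, hxS⟩ := Finset.not_subset.1 h
    rw [Finset.prod_eq_zero hx, mul_zero]
    simp [bitVal, hxS, Finsupp.mem_support_iff.1 hx]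

theorem degLE_mlCoef {p : MvPolynomial X ℝ} {d : ℕ} (h : p.totalDegree ≤ d) :
    DegLE (mlCoef p) d := by
  intro T hT
  refine Finset.sum_eq_zero fun m hm => ?_
  split_ifs with hmT
  · exfalso
    have h1 := MvPolynomial.le_totalDegree hm
    have h2 : m.support.card ≤ m.sum fun _ e => e := by
      rw [Finset.card_eq_sum_ones]
      exact Finset.sum_le_sum fun x hx => Nat.one_le_iff_ne_zero.2 (Finsupp.mem_support_iff.1 hx)
    rw [hmT] at h2
    omega
  · rfl

theorem bitVal_orFn (S : Finset X) : bitVal (orFn fun x => decide (x ∈ S)) = orVal S := by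
  rcases S.eq_empty_or_nonempty with rfl | hS
  · simp [orFn, orVal, bitVal]
  · have : ∃ x, x ∈ S := hS
    simp [orFn, orVal, bitVal, this, hS.ne_empty]

end Multilinearization

/-! ### Error reduction and averaging against hard weights -/

section Amplification
variable {Ω : Type*} [MeasurableSpace Ω] {μ : Measure Ω} [IsProbabilityMeasure μ]

/-- The event that at least half of `t` samples lie in `W`. -/
def halfIn (W : Set Ω) (t : ℕ) : Set (Fin t → Ω) :=
  {ω | ∃ U : Finset (Fin t), t ≤ 2 * U.card ∧ ∀ i, ω i ∈ W ↔ i ∈ U}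

theorem measurableSet_halfIn {W : Set Ω} (hW : MeasurableSet W) (t : ℕ) :
    MeasurableSet (halfIn W t) := by
  have : halfIn W t = ⋃ U : Finset (Fin t), ⋃ _ : t ≤ 2 * U.card, ⋂ i,
      (fun ω : Fin t → Ω => ω i) ⁻¹' (if i ∈ U then W else Wᶜ) := by
    ext ω
    simp only [halfIn, Set.mem_ofPred_eq, Set.mem_iUnion, Set.mem_iInter, Set.mem_preimage,
      exists_prop]
    refine exists_congr fun U => and_congr_right fun _ => forall_congr' fun i => ?_
    split_ifs with h <;> simp [h]
  rw [this]
  refine MeasurableSet.iUnion fun U => MeasurableSet.iUnion fun _ => MeasurableSet.iInter fun i => ?_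
  refine measurable_pi_apply i ?_
  split_ifs
  exacts [hW, hW.compl]

/-- Chernoff's bound. -/
theorem measure_halfIn_le {W : Set Ω} (hW : MeasurableSet W) (t : ℕ) {r : ℝ} (hr : 1 ≤ r) :
    (Measure.pi fun _ : Fin t => μ).real (halfIn W t) ≤
      (r * μ.real W + (1 - μ.real W) / r) ^ t := by
  classical
  have hr0 : 0 < r := by linarith
  -- `g` is `r` on `W` and `1 / r` off it, so the product over samples is at least `1` when half of
  -- them lie in `W`; its mean factors by independence.
  set g : Ω → ℝ := fun ω => W.indicator (fun _ => r - 1 / r) ω + 1 / r with hg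
  have hgi : Integrable (W.indicator fun _ : Ω => r - 1 / r) μ :=
    (integrable_const _).indicator hW
  have hgint : Integrable g μ := hgi.add (integrable_const _)
  have hgval : ∫ ω, g ω ∂μ = r * μ.real W + (1 - μ.real W) / r := by
    rw [hg, integral_add hgi (integrable_const _), integral_indicator_const _ hW]
    simp
    field_simp
    ring
  have hg1 : ∀ ω ∈ W, g ω = r := fun ω h => by simp [hg, h]
  have hg2 : ∀ ω ∉ W, g ω = 1 / r := fun ω h => by simp [hg, h]
  have hg0 : ∀ ω, 0 ≤ g ω := fun ω => by
    by_cases h : ω ∈ W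
    · rw [hg1 ω h]; exact hr0.le
    · rw [hg2 ω h]; positivity
  have hle : ∀ ω, (halfIn W t).indicator (fun _ => (1 : ℝ)) ω ≤ ∏ i, g (ω i) := by
    intro ω
    by_cases hω : ω ∈ halfIn W t
    · rw [Set.indicator_of_mem hω]
      obtain ⟨U, hU, hiff⟩ := hω
      have h1 : ∀ i, g (ω i) = if i ∈ U then r else 1 / r := by
        intro i
        split_ifs with h
        · exact hg1 _ ((hiff i).2 h)
        · exact hg2 _ (fun h' => h ((hiff i).1 h'))
      simp_rw [h1]
      rw [Finset.prod_ite]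
      simp only [Finset.prod_const]
      have h3 := Finset.card_add_card_compl U
      rw [Fintype.card_fin] at h3
      have e1 : (Finset.univ.filter fun i => i ∈ U) = U := by ext; simp
      have e2 : (Finset.univ.filter fun i => i ∉ U) = Uᶜ := by ext; simp
      rw [e1, e2, one_div, inv_pow, ← div_eq_mul_inv, le_div_iff₀ (by positivity), one_mul]
      exact pow_le_pow_right₀ hr (by omega)
    · rw [Set.indicator_of_notMem hω]
      exact Finset.prod_nonneg fun i _ => hg0 _
  have hE := measurableSet_halfIn hW t
  calc (Measure.pi fun _ : Fin t => μ).real (halfIn W t)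
      = ∫ ω, (halfIn W t).indicator (fun _ => (1 : ℝ)) ω ∂(Measure.pi fun _ : Fin t => μ) := by
        rw [integral_indicator_const _ hE]; simp
    _ ≤ ∫ ω, ∏ i, g (ω i) ∂(Measure.pi fun _ : Fin t => μ) :=
        integral_mono ((integrable_const _).indicator hE)
          (Integrable.fintype_prod fun _ => hgint) hle
    _ = _ := by rw [integral_fintype_prod_eq_pow, hgval, Fintype.card_fin]

/-- The easy direction of minimax: almost every majority of `t` samples has weighted error at least
`κ`, while at each point its error probability is bounded by Chernoff. The two are compared by
interchanging sum and integral. -/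
theorem IsProbPoly.le_of_hard_weights {X : Type*} [Fintype X] [DecidableEq X]
    {P : Ω → MvPolynomial X ℝ} {ε : ℝ} {D d t : ℕ} (hP : IsProbPoly μ ε orFn P)
    (hD : HasDegreeLE μ P D) (hd : t * D ≤ d) {r : ℝ} (hr : 1 ≤ r)
    {w : Finset X → ℝ} (hw : ∀ S, 0 ≤ w S) {κ : ℝ}
    (hκ : ∀ c : Finset X → ℝ, DegLE c d → κ ≤ orErr w c) :
    κ ≤ (∑ S, w S) * (r * ε + (1 - ε) / r) ^ t := by
  classical
  have hr0 : 0 < r := by linarith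
  set π := Measure.pi fun _ : Fin t => μ
  set a : Finset X → X → Bool := fun S x => decide (x ∈ S)
  set W : Finset X → Set Ω := fun S => errorEvent orFn P (a S)
  have hWm : ∀ S, MeasurableSet (W S) := fun S => hP.measurableSet_errorEvent _
  have hdeg : ∀ᵐ ω ∂π, ∀ i, (P (ω i)).totalDegree ≤ D := by
    rw [ae_all_iff]
    intro i
    exact (measurePreserving_eval (fun _ : Fin t => μ) i).quasiMeasurePreserving.ae hD
  have hae : ∀ᵐ ω ∂π, κ ≤ ∑ S, w S * (halfIn (W S) t).indicator (fun _ => (1 : ℝ)) ω := by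
    filter_upwards [hdeg] with ω hω
    refine (hκ (mlCoef (majPoly fun i => P (ω i)))
      (degLE_mlCoef ((totalDegree_majPoly_le hω).trans hd))).trans ?_
    refine Finset.sum_le_sum fun S _ => ?_
    by_cases hS : ω ∈ halfIn (W S) t
    · rw [Set.indicator_of_mem hS, mul_one]
      split_ifs
      exacts [le_rfl, hw S]
    · rw [Set.indicator_of_notMem hS, mul_zero, if_neg]
      rw [not_not, evalSet_mlCoef, map_majPoly, ← bitVal_orFn]
      set G : Finset (Fin t) := Finset.univ.filter fun i => ω i ∉ W S with hG
      have hGcard : t < 2 * G.card := by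
        by_contra hcon
        refine hS ⟨Gᶜ, ?_, fun i => by simp [hG]⟩
        have := Finset.card_add_card_compl G
        rw [Fintype.card_fin] at this
        omega
      have hGval : ∀ i ∈ G, MvPolynomial.eval (fun x => bitVal (a S x)) (P (ω i)) =
          bitVal (orFn (a S)) := by
        intro i hi
        have := (Finset.mem_filter.1 hi).2
        simpa [W, errorEvent] using this
      cases hb : orFn (a S)
      · rw [hb] at hGval
        simp only [bitVal] at hGval ⊢
        exact majPoly_eq_zero hGcard hGval
      · rw [hb] at hGval
        simp only [bitVal] at hGval ⊢
        exact majPoly_eq_one hGcard hGval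
  have hint : ∀ S, Integrable (fun ω => w S * (halfIn (W S) t).indicator (fun _ => (1 : ℝ)) ω) π :=
    fun S => ((integrable_const _).indicator (measurableSet_halfIn (hWm S) t)).const_mul _
  have h1 := integral_mono_ae (integrable_const κ) (integrable_finsetSum _ fun S _ => hint S) hae
  rw [integral_finsetSum _ fun S _ => hint S] at h1
  simp only [integral_const, probReal_univ, smul_eq_mul, one_mul] at h1
  refine h1.trans ?_
  rw [Finset.sum_mul]
  refine Finset.sum_le_sum fun S _ => ?_
  rw [integral_const_mul, integral_indicator_const _ (measurableSet_halfIn (hWm S) t), smul_eq_mul,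
    mul_one]
  refine mul_le_mul_of_nonneg_left ((measure_halfIn_le (hWm S) t hr).trans ?_) (hw S)
  have hp0 : 0 ≤ μ.real (W S) := measureReal_nonneg
  have hp1 : μ.real (W S) ≤ 1 := measureReal_le_one
  have hpe : μ.real (W S) ≤ ε := hP.error_le _
  refine pow_le_pow_left₀ (by have : 0 ≤ (1 - μ.real (W S)) / r := div_nonneg (by linarith) hr0.le
                              positivity) ?_ t
  have h2 : (1 : ℝ) / r ≤ r := by rw [div_le_iff₀ hr0]; nlinarith
  have h3 : ∀ p : ℝ, r * p + (1 - p) / r = p * (r - 1 / r) + 1 / r := fun p => by ring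
  rw [h3, h3]
  have : 0 ≤ r - 1 / r := by linarith
  gcongr

end Amplification

/-! ### Numerical estimates -/

section Numerics

theorem two_mul_sq_mul_robustDepth_le {d : ℕ} (hd : 1 ≤ d) :
    2 * d ^ 2 * robustDepth d ≤ (2 ^ 10 * d) ^ (18 * d) := by
  unfold robustDepth
  have h1 : 16 * d ^ 4 * 9 ^ d ≤ (2 ^ 10 * d) ^ (4 * d) := by
    calc 16 * d ^ 4 * 9 ^ d ≤ 16 ^ d * (d ^ 4) ^ d * 9 ^ d := by
          exact Nat.mul_le_mul_right _ (Nat.mul_le_mul (Nat.le_self_pow (by omega) 16)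
            (Nat.le_self_pow (by omega) (d ^ 4)))
      _ = (144 * d ^ 4) ^ d := by rw [← mul_pow, ← mul_pow]; ring_nf
      _ ≤ ((2 ^ 10 * d) ^ 4) ^ d := by
          rw [mul_pow (2 ^ 10) d 4]
          gcongr
          norm_num
      _ = _ := by rw [← pow_mul]
  calc 2 * d ^ 2 * (2 * 9 ^ d * (4 * d ^ 2 * (2 ^ 10 * d) ^ (14 * d)))
      = 16 * d ^ 4 * 9 ^ d * (2 ^ 10 * d) ^ (14 * d) := by ring
    _ ≤ (2 ^ 10 * d) ^ (4 * d) * (2 ^ 10 * d) ^ (14 * d) := by gcongr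
    _ = _ := by rw [← pow_add]; congr 1; ring

theorem half_pow_le {d : ℕ} (hd : 1 ≤ d) :
    (1 / 2 : ℝ) ^ ((2 ^ 10 * d) ^ (18 * d)) ≤ 1 / (2 ^ 21 * d ^ 2) := by
  have h1 : 21 + d * 2 ≤ (2 ^ 10 * d) ^ (18 * d) := by
    calc 21 + d * 2 ≤ 2 ^ 10 * d := by omega
      _ ≤ _ := Nat.le_self_pow (by omega) _
  have hdr : (1 : ℝ) ≤ d := by exact_mod_cast hd
  calc (1 / 2 : ℝ) ^ ((2 ^ 10 * d) ^ (18 * d)) ≤ (1 / 2) ^ (21 + d * 2) :=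
        pow_le_pow_of_le_one (by norm_num) (by norm_num) h1
    _ = 1 / (2 ^ 21 * (2 ^ d) ^ 2) := by
        rw [one_div_pow, pow_add, pow_mul]
    _ ≤ 1 / (2 ^ 21 * d ^ 2) := by
        have : (d : ℝ) ≤ 2 ^ d := by exact_mod_cast (Nat.lt_two_pow_self (n := d)).le
        gcongr

theorem pow_four_le_two_rpow {l : ℝ} (hl : 32 ≤ l) : l ^ 4 ≤ 2 ^ l := by
  set y : ℝ := 2 ^ (l / 8) with hy
  have h1 : l ≤ 16 * y := by
    have h2 := Real.add_one_le_exp (Real.log 2 * (l / 8))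
    rw [← Real.rpow_def_of_pos (by norm_num), ← hy] at h2
    have := Real.log_two_gt_d9
    nlinarith
  have h3 : 16 ≤ y := by
    calc (16 : ℝ) = 2 ^ (4 : ℝ) := by norm_num
      _ ≤ y := Real.rpow_le_rpow_of_exponent_le (by norm_num) (by linarith)
  have h4 : y ^ 8 = 2 ^ l := by
    rw [hy, ← Real.rpow_natCast, ← Real.rpow_mul (by norm_num)]
    congr 1
    push_cast
    ring
  rw [← h4]
  calc l ^ 4 ≤ (16 * y) ^ 4 := by gcongr
    _ ≤ (y * y) ^ 4 := by gcongr
    _ = y ^ 8 := by ring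

theorem one_le_sqrt_div_sq {L l : ℝ} (hL : L = 2 ^ l) (hl : 32 ≤ l) : 1 ≤ √L / l ^ 2 := by
  rw [le_div_iff₀ (by positivity), one_mul]
  refine Real.le_sqrt_of_sq_le ?_
  rw [hL, ← pow_mul]
  exact pow_four_le_two_rpow hl

/-- The amplified degree is at most `2 C √L / l`, so even after multiplication by `√l` a factor `√l`
remains to absorb `C`. -/
theorem degree_le_sqrt {L l : ℝ} {C D : ℕ} (hl : 144 * (C : ℝ) ^ 2 + 32 ≤ l)
    (hD : (D : ℝ) ≤ √L / l ^ 2) :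
    ((C * ⌈l⌉₊ * D : ℕ) : ℝ) ≤ √L ∧ 144 * ((C * ⌈l⌉₊ * D : ℕ) : ℝ) ^ 2 * l ≤ 4 * √L ^ 2 := by
  have hC0 : (0 : ℝ) ≤ (C : ℝ) ^ 2 := by positivity
  have hC1 : (C : ℝ) ≤ (C : ℝ) ^ 2 := by
    exact_mod_cast Nat.le_self_pow (by norm_num) C
  have hl0 : 0 < l := by linarith
  have ht : ((C * ⌈l⌉₊ : ℕ) : ℝ) ≤ 2 * C * l := by
    have := (Nat.ceil_lt_add_one hl0.le).le
    push_cast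
    have : (⌈l⌉₊ : ℝ) ≤ 2 * l := by linarith
    have := mul_le_mul_of_nonneg_left this (Nat.cast_nonneg (α := ℝ) C)
    linarith
  have hd : ((C * ⌈l⌉₊ * D : ℕ) : ℝ) ≤ 2 * C * √L / l := by
    rw [Nat.cast_mul]
    calc _ ≤ 2 * C * l * (√L / l ^ 2) := by gcongr
      _ = _ := by field_simp
  have hs := Real.sqrt_nonneg L
  constructor
  · refine hd.trans ?_
    rw [div_le_iff₀ hl0, mul_comm √L]
    gcongr
    linarith
  · calc 144 * ((C * ⌈l⌉₊ * D : ℕ) : ℝ) ^ 2 * l ≤ 144 * (2 * C * √L / l) ^ 2 * l := by gcongr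
      _ = 4 * √L ^ 2 * (144 * C ^ 2) / l := by field_simp; ring
      _ ≤ 4 * √L ^ 2 := by
        rw [div_le_iff₀ hl0]
        gcongr
        linarith

/-- Since `2 ^ 10 * d ≤ L ^ 2 = 2 ^ (2 l)`, the left side is at most `2 ^ (36 d ^ 2 l)`, and `36 d ^
2 l ≤ L`. -/
theorem pow_le_of_degree_le {L l n : ℝ} {d : ℕ} (hd : 1 ≤ d) (hL : L = 2 ^ l) (hn : n = 2 ^ L)
    (hl : 32 ≤ l) (h1 : (d : ℝ) ≤ √L) (h2 : 144 * (d : ℝ) ^ 2 * l ≤ 4 * √L ^ 2) :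
    (((2 ^ 10 * d) ^ (18 * d)) ^ d : ℝ) ≤ n := by
  have hL0 : 0 < L := by rw [hL]; positivity
  have hL1 : 1 ≤ L := by rw [hL]; exact Real.one_le_rpow (by norm_num) (by linarith)
  rw [Real.sq_sqrt hL0.le] at h2
  have hdr : (1 : ℝ) ≤ d := by exact_mod_cast hd
  have h3 : (2 ^ 10 * d : ℝ) ≤ 2 ^ (2 * l) := by
    have h4 : √L ≤ L := by rw [Real.sqrt_le_left (by linarith)]; nlinarith
    have h5 : (2 : ℝ) ^ 10 ≤ 2 ^ l := by
      rw [← Real.rpow_natCast]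
      exact Real.rpow_le_rpow_of_exponent_le (by norm_num) (by norm_num; linarith)
    rw [two_mul, Real.rpow_add (by norm_num), ← hL]
    rw [← hL] at h5
    gcongr
    linarith
  rw [← pow_mul]
  calc (2 ^ 10 * d : ℝ) ^ (18 * d * d) ≤ (2 ^ (2 * l)) ^ (18 * d * d) := by gcongr
    _ = 2 ^ (36 * (d : ℝ) ^ 2 * l) := by
        rw [← Real.rpow_natCast, ← Real.rpow_mul (by norm_num)]
        congr 1
        push_cast
        ring
    _ ≤ 2 ^ L := Real.rpow_le_rpow_of_exponent_le (by norm_num) (by linarith)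
    _ = n := hn.symm

end Numerics

/-! ### The degree lower bound -/

section Main
variable {X : Type u} [Fintype X] {Ω : Type v} [MeasurableSpace Ω] {μ : Measure Ω}
  [IsProbabilityMeasure μ]

theorem IsProbPoly.orBound_le {P : Ω → MvPolynomial X ℝ} {ε r : ℝ} {C D : ℕ} (hC : 1 ≤ C)
    (hr : 1 ≤ r) (hρ : 0 ≤ r * ε + (1 - ε) / r) (hρC : (r * ε + (1 - ε) / r) ^ C ≤ 1 / 16)
    (hX : 2 ^ 2 ^ (144 * C ^ 2 + 32) ≤ Fintype.card X) (hP : IsProbPoly μ ε orFn P)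
    (hD : HasDegreeLE μ P D) : orBound (Fintype.card X) ≤ D := by
  classical
  by_contra! hcon
  set n : ℝ := (Fintype.card X : ℝ) with hn
  set L : ℝ := Real.logb 2 n with hL
  set l : ℝ := Real.logb 2 L with hl
  have hn' : (2 : ℝ) ^ 2 ^ (144 * C ^ 2 + 32) ≤ n := by rw [hn]; exact_mod_cast hX
  have hn0 : 0 < n := lt_of_lt_of_le (by positivity) hn'
  have hL' : (2 : ℝ) ^ (144 * C ^ 2 + 32) ≤ L := by
    rw [hL, Real.le_logb_iff_rpow_le (by norm_num) hn0]
    exact_mod_cast hn'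
  have hL0 : 0 < L := lt_of_lt_of_le (by positivity) hL'
  have hl' : 144 * (C : ℝ) ^ 2 + 32 ≤ l := by
    rw [hl, Real.le_logb_iff_rpow_le (by norm_num) hL0]
    exact_mod_cast hL'
  have hLl : L = 2 ^ l := (Real.rpow_logb (by norm_num) (by norm_num) hL0).symm
  have hnL : n = 2 ^ L := (Real.rpow_logb (by norm_num) (by norm_num) hn0).symm
  have hl32 : 32 ≤ l := by
    have : (0 : ℝ) ≤ (C : ℝ) ^ 2 := by positivity
    linarith
  have hL32 : (2 : ℝ) ^ 32 ≤ L :=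
    (pow_le_pow_right₀ (by norm_num) (by omega)).trans hL'
  clear hX hn' hL'
  -- Replacing `D` by at least `1` ensures `1 ≤ d`; the upper bound survives because `√L / l ^ 2` is
  -- itself at least `1`.
  set E : ℕ := max D 1 with hE
  have hEle : (E : ℝ) ≤ √L / l ^ 2 := by
    rw [hE, Nat.cast_max, Nat.cast_one]
    exact max_le hcon.le (one_le_sqrt_div_sq hLl hl32)
  set t : ℕ := C * ⌈l⌉₊ with ht
  set d : ℕ := t * E with hd
  have ht1 : 1 ≤ t := Nat.mul_pos hC (Nat.ceil_pos.2 (by linarith))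
  have hd1 : 1 ≤ d := Nat.mul_pos ht1 (by simp [hE])
  obtain ⟨h1, h2⟩ := degree_le_sqrt hl' hEle
  have hcard : ((2 ^ 10 * d) ^ (18 * d)) ^ d ≤ (Finset.univ : Finset X).card := by
    rw [Finset.card_univ]
    have := pow_le_of_degree_le hd1 hLl hnL hl32 h1 h2
    rw [hn] at this
    exact_mod_cast this
  obtain ⟨w, hw0, hw1, hw2⟩ := exists_hard_weights hd1 (two_mul_sq_mul_robustDepth_le hd1)
    (half_pow_le hd1) le_rfl hcard
  have key := hP.le_of_hard_weights hD (d := d) (t := t)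
    (Nat.mul_le_mul_left t (le_max_left D 1)) hr hw0 (fun c hc => hw2 c fun T _ hT => hc T hT)
  have hdr : (1 : ℝ) ≤ d := by exact_mod_cast hd1
  -- `C` rounds give `1 / 16`, and `⌈l⌉₊` repetitions give `16 ^ (-l) = L ^ (-4)`.
  have hpow : (r * ε + (1 - ε) / r) ^ t ≤ 1 / L ^ 4 := by
    rw [ht, pow_mul]
    calc _ ≤ (1 / 16 : ℝ) ^ ⌈l⌉₊ := by gcongr
      _ = 1 / (2 ^ (⌈l⌉₊ : ℝ)) ^ 4 := by
          rw [one_div_pow, Real.rpow_natCast, ← pow_mul, mul_comm, pow_mul]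
          norm_num
      _ ≤ 1 / L ^ 4 := by
          rw [hLl]
          gcongr
          · norm_num
          · exact Nat.le_ceil l
  have h3 : 1 / (2 ^ 21 * d ^ 2 : ℝ) * (1 - d / (2 * d)) ≤ 3 * d * (1 / L ^ 4) := by
    refine key.trans ?_
    gcongr
    exact hw1.trans (by linarith)
  have h4 : 1 / (2 ^ 21 * d ^ 2 : ℝ) * (1 - d / (2 * d)) = 1 / (2 ^ 22 * d ^ 2) := by
    field_simp
    norm_num
  rw [h4, mul_one_div, div_le_div_iff₀ (by positivity) (by positivity), one_mul] at h3
  have hdL : (d : ℝ) ≤ L := by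
    refine h1.trans ?_
    rw [Real.sqrt_le_left hL0.le]
    nlinarith
  have h5 : 3 * d * (2 ^ 22 * d ^ 2) ≤ 3 * 2 ^ 22 * L ^ 3 := by
    calc (3 * d * (2 ^ 22 * d ^ 2) : ℝ) = 3 * 2 ^ 22 * (d : ℝ) ^ 3 := by ring
      _ ≤ _ := by gcongr
  -- Hence `L ≤ 3 * 2 ^ 22`, against `L ≥ 2 ^ 32`.
  have h6 : L * L ^ 3 ≤ 3 * 2 ^ 22 * L ^ 3 := by
    rw [← pow_succ']
    exact h3.trans h5
  have h7 := le_of_mul_le_mul_right h6 (by positivity)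
  linarith

theorem IsProbPoly.mono {P : Ω → MvPolynomial X ℝ} {f : (X → Bool) → Bool} {ε ε' : ℝ}
    (h : IsProbPoly μ ε f P) (hε : ε ≤ ε') : IsProbPoly μ ε' f P :=
  ⟨h.measurableSet_errorEvent, fun a => (h.error_le a).trans hε⟩

end Main

theorem exists_forall_orBound_le {ε : ℝ} (hε : ε < 1 / 2) :
    ∃ N : ℕ, ∀ (X : Type u) [Fintype X], N ≤ Fintype.card X →
      ∀ (Ω : Type v) [MeasurableSpace Ω] (μ : Measure Ω) [IsProbabilityMeasure μ]
        (P : Ω → MvPolynomial X ℝ) (D : ℕ),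
        IsProbPoly μ ε orFn P → HasDegreeLE μ P D → orBound (Fintype.card X) ≤ D := by
  -- Raising the error to at least `1 / 4` covers all small or negative `ε` at once. With `r = 2 - 2
  -- e` the Chernoff base is `2 e (1 - e) + 1 / 2`, which is below `1` exactly because `e ≠ 1 / 2`.
  set e : ℝ := max ε (1 / 4) with he
  have he0 : 1 / 4 ≤ e := le_max_right _ _
  have he1 : e < 1 / 2 := max_lt hε (by norm_num)
  set r : ℝ := 2 - 2 * e with hr
  have hr1 : 1 < r := by linarith
  have hρ0 : 0 ≤ r * e + (1 - e) / r := by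
    have : 0 ≤ (1 - e) / r := div_nonneg (by linarith) (by linarith)
    have : 0 ≤ r * e := mul_nonneg (by linarith) (by linarith)
    linarith
  have hρ1 : r * e + (1 - e) / r < 1 := by
    have : (1 - e) / r = 1 / 2 := by
      rw [div_eq_iff (by linarith), hr]; ring
    rw [this, hr]
    nlinarith
  obtain ⟨C, hC⟩ := exists_pow_lt_of_lt_one (show (0 : ℝ) < 1 / 16 by norm_num) hρ1
  have hC1 : 1 ≤ C := by
    rcases Nat.eq_zero_or_pos C with rfl | h
    · norm_num at hC
    · exact h
  exact ⟨2 ^ 2 ^ (144 * C ^ 2 + 32), fun X _ hX Ω _ μ _ P D hP hD =>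
    (hP.mono (le_max_left ε (1 / 4))).orBound_le hC1 hr1.le hρ0 hC.le hX hD⟩

theorem theorem3p1 :
    (∃ N : ℕ, ∀ (X : Type u) [Fintype X], N ≤ Fintype.card X →
      ∀ (Ω : Type v) [MeasurableSpace Ω] (μ : Measure Ω) [IsProbabilityMeasure μ]
        (P : Ω → MvPolynomial X ℝ) (D : ℕ),
        IsProbPoly μ (1 / 8) orFn P → HasDegreeLE μ P D →
          orBound (Fintype.card X) ≤ D) ∧
    (∀ ε : ℝ, ε < 1 / 2 → ∃ c : ℝ, 0 < c ∧
      ∃ N : ℕ, ∀ (X : Type u) [Fintype X], N ≤ Fintype.card X →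
      ∀ (Ω : Type v) [MeasurableSpace Ω] (μ : Measure Ω) [IsProbabilityMeasure μ]
        (P : Ω → MvPolynomial X ℝ) (D : ℕ),
        IsProbPoly μ ε orFn P → HasDegreeLE μ P D →
          c * orBound (Fintype.card X) ≤ D) := by
  -- The constant can be `1` for every `ε`: the dependence on `ε` enters only through the threshold
  -- on `n`.
  refine ⟨exists_forall_orBound_le (by norm_num), fun ε hε => ⟨1, one_pos, ?_⟩⟩
  simp_rw [one_mul]
  exact exists_forall_orBound_le hε
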